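/- Let $V\in C^\infty(\mathbb R)$ be real-valued and even, $V=V_{\rm per}+V_{\rm def}$ with $V_{\rm per}(x+1)=V_{\rm per}(x)$ for all $x$ and $V_{\rm def}(x)=0$ for $|x|>\rho$, where $\rho\ge 0$. Suppose that $H=-\frac{d^2}{dx^2}+V$ on $L^2(\mathbb R)$ has a bound state $\Phi\in L^2(\mathbb R)$, $\Phi\neq 0$, $H\Phi=E\Phi$, with $E>0$. Then $\Phi$ is even or odd. For $z\in\mathbb C$ let $u_z,v_z$ be the solutions of $-w''+Vw=zw$ with $u_z(0)=1,\ u_z'(0)=0,\ v_z(0)=0,\ v_z'(0)=1$ if $\Phi$ is even, and with $u_z(0)=0,\ u_z'(0)=1,\ v_z(0)=-1,\ v_z'(0)=0$ if $\Phi$ is odd. Let $\sqrt{\cdot}$ be the principal branch of the square root on $\mathbb C\setminus(-\infty,0]$. For $M>0$ let $V_{\rm trunc}(x)=V(x)$ for $|x|\le M$ and $V_{\rm trunc}(x)=0$ for $|x|>M$, and let $H_{\rm trunc}=-\frac{d^2}{dx^2}+V_{\rm trunc}$ on $L^2(\mathbb R)$. A resonance of $H_{\rm trunc}$ is a number $z$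 such that $\lambda=\sqrt z$ has $\operatorname{Im}\lambda<0$ and is a pole of the resolvent $(H_{\rm trunc}-\lambda^2)^{-1}$, continued meromorphically in $\lambda$ from the upper half-plane (as an operator from compactly supported $L^2$ functions to $L^2_{\rm loc}$). A resonant state at $z$ is a nonzero solution $\Psi\in H^2_{\rm loc}(\mathbb R)$ of $-\Psi''+V_{\rm trunc}\Psi=z\Psi$ that is outgoing: it is a constant multiple of $e^{i\sqrt z\,|x|}$ near $+\infty$, and a constant multiple of it near $-\infty$. Let $k$ be the logarithm of the larger of the absolute values of the two characteristic multipliers of $-\psi''+V_{\rm per}\psi=E\psi$ (these are real with product $1$). Then $k>0$, and there are $M_0>\rho$ and $C$ such that for all real $M\ge M_0$ the operator $H_{\rm trunc}$ has a resonance $z^*$ with $\operatorname{Re}z^*>0$, $\operatorname{Im}z^*<0$, $|\operatorname{Im}z^*|\le Ce^{-2kM}$ and $$\operatorname{Re}z^*=E+\frac{u_E'(M)v_E'(M)+E\,u_E(M)v_E(M)}{\left[(v_E'(M))^2+E\,(v_E(M))^2\right]\int_0^M u_E^2(y)\,dy}+O(Me^{-4kM}),$$ $$\operatorname{Im}z^*=\frac{-\sqrt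 E}{\left[(v_E'(M))^2+E\,(v_E(M))^2\right]\int_0^M u_E^2(y)\,dy}+O(Me^{-4kM}),$$ where each $O(Me^{-4kM})$ is bounded in absolute value by $C\,Me^{-4kM}$. The associated resonant state $\Phi^*$, unique up to a constant factor, is for $x\ge0$ given by $$\Phi^*(x)=\begin{cases}u_{z^*}(x),&0\le x\le M,\\ u_{z^*}(M)\,e^{i\sqrt{z^*}(x-M)},&x>M,\end{cases}$$ and $\Phi^*$ is even if $\Phi$ is even, and odd if $\Phi$ is odd. -/

import Mathlib

open MeasureTheory Set
open scoped ContDiff Interval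

noncomputable section

/-- The potential cut off outside the interval of half-length `M`. -/
def truncate (V : ℝ → ℝ) (M : ℝ) : ℝ → ℝ :=
  fun x => if |x| ≤ M then V x else 0

/-- The principal branch of the complex square root, cut along the negative real axis. -/
def csqrt (z : ℂ) : ℂ := z ^ ((1 : ℂ) / 2)

/-- `(-d²/dx² + U - z) w = f` in the sense of functions `w` that are locally `H²`:
`w` is continuously differentiable, its derivative is locally absolutely continuous, and
`w'' = (U - z) w - f` almost everywhere (written in integrated form, since `U` and `f` may jump).
For continuous `U` and `f` this is the classical equation. -/
def SolvesSchrodinger (U : ℝ → ℝ) (z : ℂ) (f w : ℝ → ℂ) : Prop :=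
  Differentiable ℝ w ∧
  (∀ a b : ℝ, IntervalIntegrable (fun x => ((U x : ℂ) - z) * w x - f x) volume a b) ∧
  ∀ a b : ℝ, deriv w b - deriv w a = ∫ x in a..b, (((U x : ℂ) - z) * w x - f x)

/-- The solution of `(-d²/dx² + U - z) w = 0` with initial data `w 0 = a`, `w' 0 = b`. -/
def SolvesIVP (U : ℝ → ℝ) (z a b : ℂ) (w : ℝ → ℂ) : Prop :=
  SolvesSchrodinger U z 0 w ∧ w 0 = a ∧ deriv w 0 = b

/-- `w` lies in the domain `H²(ℝ)` of the operator `H_U = -d²/dx² + U` on `L²(ℝ)` and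
`(H_U - z) w = f`. Since `U` is bounded, `w ∈ L²` together with `w'' = (U - z) w - f ∈ L²` is
exactly membership in `H²(ℝ)`. -/
def IsResolventImage (U : ℝ → ℝ) (z : ℂ) (f w : ℝ → ℂ) : Prop :=
  MemLp w 2 volume ∧ SolvesSchrodinger U z f w

/-- `Φ` is a bound state (a nonzero `L²` eigenfunction) of `-d²/dx² + U` with eigenvalue `E`. -/
def IsBoundState (U : ℝ → ℝ) (E : ℝ) (Φ : ℝ → ℂ) : Prop :=
  Φ ≠ 0 ∧ IsResolventImage U (E : ℂ) 0 Φ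

/-- `μ` is a characteristic (Floquet) multiplier of `-ψ'' + W ψ = E ψ`, where `W` has period `1`. -/
def IsCharacteristicMultiplier (W : ℝ → ℝ) (E : ℝ) (μ : ℝ) : Prop :=
  ∃ ψ : ℝ → ℂ, ψ ≠ 0 ∧ SolvesSchrodinger W (E : ℂ) 0 ψ ∧ ∀ x, ψ (x + 1) = (μ : ℂ) * ψ x

/-- `F` is the meromorphic continuation to `ℂ`, in the variable `ζ = √z`, of the matrix element
`∫ g (H_U - ζ²)⁻¹ f` of the resolvent of `H_U = -d²/dx² + U`. For `ζ` in the open first quadrant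
`ζ²` has positive imaginary part, so it is never in the spectrum of the self-adjoint operator `H_U`
and `w = (H_U - ζ²)⁻¹ f` is the only possible `w`; by the identity theorem the values of `F` there
determine the continuation (and they agree with the resolvent wherever it exists on `Im ζ > 0`). -/
def IsContinuedResolvent (U : ℝ → ℝ) (f g : ℝ → ℂ) (F : ℂ → ℂ) : Prop :=
  MeromorphicOn F univ ∧
  ∀ ζ : ℂ, 0 < ζ.re → 0 < ζ.im →
    ∃ w : ℝ → ℂ, IsResolventImage U (ζ ^ 2) f w ∧ F ζ = ∫ x, g x * w x

/-- `ζ₀` is a pole of the resolvent `(H_U - ζ²)⁻¹ : L²_comp → L²_loc`, continued meromorphically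
in `ζ`: some matrix element between compactly supported `L²` functions has a pole at `ζ₀`. -/
def IsResolventPole (U : ℝ → ℝ) (ζ₀ : ℂ) : Prop :=
  ∃ f g : ℝ → ℂ, MemLp f 2 volume ∧ HasCompactSupport f ∧
    MemLp g 2 volume ∧ HasCompactSupport g ∧
    ∃ F : ℂ → ℂ, IsContinuedResolvent U f g F ∧ meromorphicOrderAt F ζ₀ < 0

/-- `z` is a resonance of `-d²/dx² + U`: `√z` lies in the open lower half-plane and is a pole of
the continued resolvent. -/
def IsResonance (U : ℝ → ℝ) (z : ℂ) : Prop :=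
  (csqrt z).im < 0 ∧ IsResolventPole U (csqrt z)

/-- `Ψ` is a resonant state of `-d²/dx² + U` (with `U` compactly supported) at `z`: a nonzero
solution of the eigenvalue equation that is outgoing, i.e. a multiple of `e^{i√z|x|}` near `+∞`
and a multiple of it near `-∞`. -/
def IsResonantState (U : ℝ → ℝ) (z : ℂ) (Ψ : ℝ → ℂ) : Prop :=
  Ψ ≠ 0 ∧ SolvesSchrodinger U z 0 Ψ ∧
  ∃ (R : ℝ) (a b : ℂ),
    (∀ x, R < x → Ψ x = a * Complex.exp (Complex.I * csqrt z * (x : ℂ))) ∧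
    (∀ x, x < -R → Ψ x = b * Complex.exp (-(Complex.I * csqrt z * (x : ℂ))))

/-- `[(v_E'(M))² + E (v_E(M))²] ∫₀ᴹ u_E²` for the solutions `uE`, `vE` at energy `E`. -/
def correctionDenom (E : ℝ) (uE vE : ℝ → ℂ) (M : ℝ) : ℂ :=
  ((deriv vE M) ^ 2 + (E : ℂ) * (vE M) ^ 2) * ∫ y in (0 : ℝ)..M, (uE y) ^ 2

end

/-!
Since `V` is even and the Wronskian of two square-integrable solutions vanishes, `Φ` is even or odd,
hence a multiple of `u_E`. Beyond `ρ` the equation is periodic; square-integrability of `u_E` rules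
out multipliers on the unit circle, so `u_E` decays like `e^{-kx}` while `v_E` grows like `e^{kx}`.

A solution of the same parity is outgoing for the truncated potential exactly when
`F(z) = u_z'(M) - i√z u_z(M)` vanishes. Variation of constants about `E`, with `u_z v_z' - u_z' v_z`
equal to `1`, gives `F(z) = N(z) - (z - E) D(z)`, where for `|z - E|` of order `e^{-2kM}` the term
`N` has order `e^{-kM}`, `D` has order `e^{kM}`, and both vary little with `z`. A zero of `F` near
`E + N(E) / D(E)` follows by comparison with the linear function `N(E) - (z - E) D(E)`, and
the asymptotics of `N / D` are those of the resonance: multiplying by the conjugate of the outgoing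
combination of `v_E`, the Wronskian produces the imaginary part `-√E`.

At a zero of `F`, the solution continued by `e^{i√z|x|}` and extended by parity is a resonant state,
and the resolvent matrix element obtained from the one-dimensional Green's function has `F` in its
denominator.
-/

open Filter Topology

/-! ### Classical solutions and uniqueness -/

/-- Classical solutions `w` of `-w'' + V w = z w`. The derivative `w₁` of `w` is carried along, so
that the equation is a first-order system and linear combinations need no computation of `deriv`. -/
def IsClassicalSolution (V : ℝ → ℝ) (z : ℂ) (w w₁ : ℝ → ℂ) : Prop :=
  ∀ x, HasDerivAt w (w₁ x) x ∧ HasDerivAt w₁ (((V x : ℂ) - z) * w x) x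

namespace IsClassicalSolution

variable {V : ℝ → ℝ} {z z' : ℂ} {w w₁ y y₁ : ℝ → ℂ}

theorem continuous (h : IsClassicalSolution V z w w₁) : Continuous w :=
  continuous_iff_continuousAt.2 fun x => (h x).1.continuousAt

theorem continuous_snd (h : IsClassicalSolution V z w w₁) : Continuous w₁ :=
  continuous_iff_continuousAt.2 fun x => (h x).2.continuousAt

theorem deriv_eq (h : IsClassicalSolution V z w w₁) : deriv w = w₁ :=
  funext fun x => (h x).1.deriv

theorem const_mul (h : IsClassicalSolution V z w w₁) (c : ℂ) :
    IsClassicalSolution V z (fun x => c * w x) (fun x => c * w₁ x) := fun x =>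
  ⟨(h x).1.const_mul c, ((h x).2.const_mul c).congr_deriv (by ring)⟩

theorem add (h : IsClassicalSolution V z w w₁) (h' : IsClassicalSolution V z y y₁) :
    IsClassicalSolution V z (fun x => w x + y x) (fun x => w₁ x + y₁ x) := fun x =>
  ⟨(h x).1.add (h' x).1, ((h x).2.add (h' x).2).congr_deriv (by ring)⟩

theorem sub (h : IsClassicalSolution V z w w₁) (h' : IsClassicalSolution V z y y₁) :
    IsClassicalSolution V z (fun x => w x - y x) (fun x => w₁ x - y₁ x) := fun x =>
  ⟨(h x).1.sub (h' x).1, ((h x).2.sub (h' x).2).congr_deriv (by ring)⟩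

theorem conj (h : IsClassicalSolution V z w w₁) :
    IsClassicalSolution V (starRingEnd ℂ z) (fun x => starRingEnd ℂ (w x))
      (fun x => starRingEnd ℂ (w₁ x)) := fun x =>
  ⟨(h x).1.star, ((h x).2.star).congr_deriv (by simp)⟩

theorem comp_neg (hV : Function.Even V) (h : IsClassicalSolution V z w w₁) :
    IsClassicalSolution V z (fun x => w (-x)) (fun x => -w₁ (-x)) := fun x => by
  have h1 := (h (-x)).1.scomp x (hasDerivAt_neg x)
  have h2 := ((h (-x)).2.scomp x (hasDerivAt_neg x)).neg
  exact ⟨h1.congr_deriv (by simp), h2.congr_deriv (by simp [hV x])⟩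

theorem hasDerivAt_wronskian (h : IsClassicalSolution V z w w₁)
    (h' : IsClassicalSolution V z' y y₁) (x : ℝ) :
    HasDerivAt (fun x => w x * y₁ x - w₁ x * y x) ((z - z') * (w x * y x)) x :=
  (((h x).1.mul (h' x).2).sub ((h x).2.mul (h' x).1)).congr_deriv (by ring)

theorem wronskian_sub (h : IsClassicalSolution V z w w₁)
    (h' : IsClassicalSolution V z' y y₁) (a b : ℝ) :
    (w b * y₁ b - w₁ b * y b) - (w a * y₁ a - w₁ a * y a)
      = (z - z') * ∫ t in a..b, w t * y t := by
  rw [← intervalIntegral.integral_const_mul]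
  refine (intervalIntegral.integral_eq_sub_of_hasDerivAt
    (fun x _ => h.hasDerivAt_wronskian h' x) ?_).symm
  exact (continuous_const.mul (h.continuous.mul h'.continuous)).intervalIntegrable _ _

theorem wronskian_const (h : IsClassicalSolution V z w w₁)
    (h' : IsClassicalSolution V z y y₁) (a b : ℝ) :
    w b * y₁ b - w₁ b * y b = w a * y₁ a - w₁ a * y a := by
  simpa [sub_eq_zero] using h.wronskian_sub h' a b

end IsClassicalSolution

theorem eq_zero_of_le_const_mul_integral {f : ℝ → ℝ} {a b K : ℝ} (hf : Continuous f)
    (hf₀ : ∀ x ∈ Icc a b, 0 ≤ f x) (h : ∀ x ∈ Icc a b, f x ≤ K * ∫ t in a..x, f t) :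
    ∀ x ∈ Icc a b, f x = 0 := by
  have hderiv : ∀ x, HasDerivAt (fun x => ∫ t in a..x, f t) (f x) x := fun x =>
    intervalIntegral.integral_hasDerivAt_right (hf.intervalIntegrable _ _)
      (hf.stronglyMeasurableAtFilter _ _) hf.continuousAt
  have hnonneg : ∀ x ∈ Icc a b, 0 ≤ ∫ t in a..x, f t := fun x hx =>
    intervalIntegral.integral_nonneg hx.1 fun t ht => hf₀ t ⟨ht.1, ht.2.trans hx.2⟩
  intro x hx
  have gronwall := norm_le_gronwallBound_of_norm_deriv_right_le
    (f := fun x => ∫ t in a..x, f t) (f' := f) (δ := 0) (K := K) (ε := 0) (a := a) (b := b)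
    (fun t _ => (hderiv t).continuousAt.continuousWithinAt)
    (fun t _ => (hderiv t).hasDerivWithinAt) (by simp)
    (fun t ht => by
      have ht' := Ico_subset_Icc_self ht
      simpa [abs_of_nonneg (hf₀ t ht'), abs_of_nonneg (hnonneg t ht')] using h t ht') x hx
  rw [gronwallBound_ε0_δ0, norm_le_zero_iff] at gronwall
  exact le_antisymm ((h x hx).trans_eq (by rw [gronwall, mul_zero])) (hf₀ x hx)

theorem eq_zero_of_integral_eq {w w₁ q : ℝ → ℂ} {a b K : ℝ} (hwc : Continuous w)
    (hw₁c : Continuous w₁) (hw : ∀ x ∈ Icc a b, w x = ∫ t in a..x, w₁ t)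
    (hw₁ : ∀ x ∈ Icc a b, w₁ x = ∫ t in a..x, q t * w t) (hq : ∀ x ∈ Icc a b, ‖q x‖ ≤ K) :
    ∀ x ∈ Icc a b, w x = 0 ∧ w₁ x = 0 := by
  have hsum : ∀ x ∈ Icc a b, ‖w x‖ + ‖w₁ x‖ ≤ (1 + |K|) * ∫ t in a..x, (‖w t‖ + ‖w₁ t‖) := by
    intro x hx
    have hI : 0 ≤ ∫ t in a..x, ‖w t‖ :=
      intervalIntegral.integral_nonneg hx.1 fun t _ => norm_nonneg _
    have hI₁ : 0 ≤ ∫ t in a..x, ‖w₁ t‖ :=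
      intervalIntegral.integral_nonneg hx.1 fun t _ => norm_nonneg _
    have bound : ‖w x‖ ≤ ∫ t in a..x, ‖w₁ t‖ :=
      hw x hx ▸ intervalIntegral.norm_integral_le_integral_norm hx.1
    have bound₁ : ‖w₁ x‖ ≤ |K| * ∫ t in a..x, ‖w t‖ := by
      rw [hw₁ x hx, ← intervalIntegral.integral_const_mul]
      refine intervalIntegral.norm_integral_le_of_norm_le hx.1 (ae_of_all _ fun t ht => ?_)
        ((continuous_const.mul hwc.norm).intervalIntegrable _ _)
      rw [norm_mul]
      gcongr
      exact (hq t ⟨ht.1.le, ht.2.trans hx.2⟩).trans (le_abs_self K)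
    rw [intervalIntegral.integral_add (hwc.norm.intervalIntegrable _ _)
      (hw₁c.norm.intervalIntegrable _ _)]
    nlinarith [mul_nonneg (abs_nonneg K) hI₁]
  intro x hx
  have hzero : ‖w x‖ + ‖w₁ x‖ = 0 := eq_zero_of_le_const_mul_integral (hwc.norm.add hw₁c.norm)
    (fun t _ => add_nonneg (norm_nonneg _) (norm_nonneg _)) hsum x hx
  rwa [add_eq_zero_iff_of_nonneg (norm_nonneg _) (norm_nonneg _), norm_eq_zero,
    norm_eq_zero] at hzero

theorem norm_ofReal_sub_le {r K : ℝ} (hr : |r| ≤ K) (z : ℂ) : ‖(r : ℂ) - z‖ ≤ K + ‖z‖ :=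
  (norm_sub_le _ _).trans (by simpa using hr)

namespace SolvesSchrodinger

variable {U : ℝ → ℝ} {z : ℂ} {f w y : ℝ → ℂ}

theorem deriv_eq_add_integral (h : SolvesSchrodinger U z f w) (a : ℝ) :
    deriv w = fun x => deriv w a + ∫ t in a..x, (((U t : ℂ) - z) * w t - f t) :=
  funext fun x => by rw [← h.2.2 a x, add_sub_cancel]

theorem continuous_deriv (h : SolvesSchrodinger U z f w) : Continuous (deriv w) := by
  rw [h.deriv_eq_add_integral 0]
  exact continuous_const.add (intervalIntegral.continuous_primitive h.2.1 0)

theorem isClassicalSolution (hU : Continuous U) (h : SolvesSchrodinger U z 0 w) :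
    IsClassicalSolution U z w (deriv w) := by
  intro x
  have hc : Continuous fun t => ((U t : ℂ) - z) * w t :=
    ((Complex.continuous_ofReal.comp hU).sub continuous_const).mul h.1.continuous
  refine ⟨(h.1 x).hasDerivAt, ?_⟩
  have hderiv := h.deriv_eq_add_integral 0
  simp only [Pi.zero_apply, sub_zero] at hderiv
  rw [hderiv]
  exact (intervalIntegral.integral_hasDerivAt_right (hc.intervalIntegrable _ _)
    (hc.stronglyMeasurableAtFilter _ _) hc.continuousAt).const_add _

theorem of_hasDerivAt {w₁ : ℝ → ℂ} {s : Set ℝ} (hs : s.Countable)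
    (hw : ∀ x, HasDerivAt w (w₁ x) x) (hc : Continuous w₁)
    (hi : ∀ a b, IntervalIntegrable (fun x => ((U x : ℂ) - z) * w x - f x) volume a b)
    (hw₁ : ∀ x, x ∉ s → HasDerivAt w₁ (((U x : ℂ) - z) * w x - f x) x) :
    SolvesSchrodinger U z f w := by
  refine ⟨fun x => (hw x).differentiableAt, hi, fun a b => ?_⟩
  rw [funext fun x => (hw x).deriv]
  exact (integral_eq_of_hasDerivAt_off_countable w₁ _ hs hc.continuousOn
    (fun x hx => hw₁ x hx.2) (hi a b)).symm

theorem sub_const_mul (h : SolvesSchrodinger U z 0 w) (h' : SolvesSchrodinger U z 0 y) (c : ℂ) :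
    SolvesSchrodinger U z 0 (fun x => w x - c * y x) := by
  have hderiv : deriv (fun x => w x - c * y x) = fun x => deriv w x - c * deriv y x :=
    funext fun x => ((h.1 x).hasDerivAt.sub ((h'.1 x).hasDerivAt.const_mul c)).deriv
  have hrhs : (fun x => ((U x : ℂ) - z) * (w x - c * y x) - (0 : ℝ → ℂ) x)
      = fun x => (((U x : ℂ) - z) * w x - (0 : ℝ → ℂ) x)
        - c * (((U x : ℂ) - z) * y x - (0 : ℝ → ℂ) x) := by
    funext x
    simp only [Pi.zero_apply]
    ring
  refine ⟨fun x => (h.1 x).sub ((h'.1 x).const_mul c), fun a b => ?_, fun a b => ?_⟩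
  · rw [hrhs]
    exact (h.2.1 a b).sub ((h'.2.1 a b).const_mul c)
  · rw [hderiv, hrhs, intervalIntegral.integral_sub (h.2.1 a b) ((h'.2.1 a b).const_mul c),
      intervalIntegral.integral_const_mul, ← h.2.2, ← h'.2.2]
    ring

theorem comp_neg (h : SolvesSchrodinger U z 0 w) :
    SolvesSchrodinger (fun x => U (-x)) z 0 (fun x => w (-x)) := by
  refine ⟨fun x => (h.1 (-x)).comp x differentiable_neg.differentiableAt, fun a b => ?_,
    fun a b => ?_⟩
  · simpa using (IntervalIntegrable.iff_comp_neg).1 (h.2.1 (-a) (-b))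
  · have hsubst := intervalIntegral.integral_comp_neg (a := a) (b := b)
      (fun x => ((U x : ℂ) - z) * w x - (0 : ℝ → ℂ) x)
    rw [← h.2.2] at hsubst
    simp only [Pi.zero_apply] at hsubst ⊢
    rw [deriv_comp_neg, deriv_comp_neg, hsubst]
    ring

theorem eq_zero_right {a b K : ℝ} (h : SolvesSchrodinger U z 0 w)
    (hU : ∀ x ∈ Icc a b, |U x| ≤ K) (ha : w a = 0) (ha' : deriv w a = 0) :
    ∀ x ∈ Icc a b, w x = 0 := by
  refine fun x hx => (eq_zero_of_integral_eq (q := fun t => (U t : ℂ) - z) h.1.continuous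
    h.continuous_deriv (fun x _ => ?_) (fun x _ => ?_)
    (fun x hx => norm_ofReal_sub_le (hU x hx) z) x hx).1
  · rw [intervalIntegral.integral_deriv_eq_sub (fun t _ => h.1 t)
      (h.continuous_deriv.intervalIntegrable _ _), ha, sub_zero]
  · simpa [ha'] using h.2.2 a x

theorem eq_zero (h : SolvesSchrodinger U z 0 w)
    (hU : ∀ a b, ∃ K, ∀ x ∈ Icc a b, |U x| ≤ K) {a : ℝ} (ha : w a = 0) (ha' : deriv w a = 0)
    (x : ℝ) : w x = 0 := by
  rcases le_total a x with hx | hx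
  · obtain ⟨K, hK⟩ := hU a x
    exact h.eq_zero_right hK ha ha' x ⟨hx, le_rfl⟩
  · obtain ⟨K, hK⟩ := hU x a
    have hreflect := h.comp_neg.eq_zero_right (a := -a) (b := -x)
      (fun t ht => hK (-t) ⟨le_neg.1 ht.2, neg_le.1 ht.1⟩) (by simpa using ha)
      (by rw [deriv_comp_neg, neg_neg, ha', neg_zero]) (-x) ⟨neg_le_neg hx, le_rfl⟩
    simpa using hreflect

end SolvesSchrodinger

theorem exists_abs_le_on_Icc_of_continuous {V : ℝ → ℝ} (hV : Continuous V) (a b : ℝ) :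
    ∃ K, ∀ x ∈ Icc a b, |V x| ≤ K :=
  isCompact_Icc.exists_bound_of_continuousOn hV.continuousOn

namespace IsClassicalSolution

variable {V : ℝ → ℝ} {z ε : ℂ} {w w₁ y y₁ : ℝ → ℂ}

theorem solvesSchrodinger (hV : Continuous V) (h : IsClassicalSolution V z w w₁) :
    SolvesSchrodinger V z 0 w := by
  refine .of_hasDerivAt countable_empty (fun x => (h x).1) h.continuous_snd
    (fun a b => ?_) fun x _ => (h x).2.congr_deriv (by simp)
  have hrhs : Continuous fun x => ((V x : ℂ) - z) * w x - (0 : ℝ → ℂ) x := by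
    simp only [Pi.zero_apply, sub_zero]
    exact ((Complex.continuous_ofReal.comp hV).sub continuous_const).mul h.continuous
  exact hrhs.intervalIntegrable _ _

theorem eq_zero (hV : Continuous V) (h : IsClassicalSolution V z w w₁) {a : ℝ} (ha : w a = 0)
    (ha' : w₁ a = 0) (x : ℝ) : w x = 0 :=
  (h.solvesSchrodinger hV).eq_zero (exists_abs_le_on_Icc_of_continuous hV) ha
    (h.deriv_eq ▸ ha') x

theorem unique (hV : Continuous V) (hw : IsClassicalSolution V z w w₁)
    (hy : IsClassicalSolution V z y y₁) {a : ℝ} (ha : w a = y a) (ha' : w₁ a = y₁ a) :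
    w = y ∧ w₁ = y₁ := by
  have hwy : w = y := funext fun x =>
    sub_eq_zero.1 ((hw.sub hy).eq_zero hV (sub_eq_zero.2 ha) (sub_eq_zero.2 ha') x)
  exact ⟨hwy, by rw [← hw.deriv_eq, ← hy.deriv_eq, hwy]⟩

theorem parity (hV : Continuous V) (hVe : Function.Even V) (h : IsClassicalSolution V z w w₁)
    (h0 : w 0 = ε * w 0) (h0' : -w₁ 0 = ε * w₁ 0) :
    (∀ x, w (-x) = ε * w x) ∧ ∀ x, w₁ (-x) = -ε * w₁ x := by
  obtain ⟨hw, hw₁⟩ := (h.comp_neg hVe).unique hV (h.const_mul ε) (a := 0)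
    (by rwa [neg_zero]) (by rwa [neg_zero])
  exact ⟨congrFun hw, fun x => by linear_combination -congrFun hw₁ x⟩

theorem conj_eq {E : ℝ} (hV : Continuous V) (h : IsClassicalSolution V E w w₁)
    (h0 : starRingEnd ℂ (w 0) = w 0) (h0' : starRingEnd ℂ (w₁ 0) = w₁ 0) :
    (∀ x, starRingEnd ℂ (w x) = w x) ∧ ∀ x, starRingEnd ℂ (w₁ x) = w₁ x := by
  have hconj := h.conj
  rw [Complex.conj_ofReal] at hconj
  obtain ⟨hw, hw₁⟩ := hconj.unique hV h h0 h0'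
  exact ⟨congrFun hw, congrFun hw₁⟩

end IsClassicalSolution

/-! ### Decay and parity of square-integrable solutions -/

theorem sq_integral_le_integral_sq {f : ℝ → ℝ} (hf : Continuous f) (x : ℝ) :
    (∫ t in x..x + 1, f t) ^ 2 ≤ ∫ t in x..x + 1, f t ^ 2 := by
  set η := ∫ t in x..x + 1, f t
  have hvar : 0 ≤ ∫ t in x..x + 1, (f t - η) ^ 2 :=
    intervalIntegral.integral_nonneg (by linarith) fun t _ => sq_nonneg _
  have hexpand : ∫ t in x..x + 1, (f t - η) ^ 2 = (∫ t in x..x + 1, f t ^ 2) - η ^ 2 := by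
    have hsq : ∀ t, (f t - η) ^ 2 = f t ^ 2 - 2 * η * f t + η ^ 2 := fun t => by ring
    simp only [hsq]
    rw [intervalIntegral.integral_add (Continuous.intervalIntegrable (by fun_prop) _ _)
      intervalIntegrable_const, intervalIntegral.integral_sub
      (Continuous.intervalIntegrable (by fun_prop) _ _)
      (Continuous.intervalIntegrable (by fun_prop) _ _), intervalIntegral.integral_const_mul,
      intervalIntegral.integral_const, smul_eq_mul]
    ring
  linarith

theorem tendsto_integral_norm_of_memLp_two {w : ℝ → ℂ} (hc : Continuous w)
    (hw : MemLp w 2 volume) : Tendsto (fun x => ∫ t in x..x + 1, ‖w t‖) atTop (𝓝 0) := by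
  have hint : Integrable fun t => ‖w t‖ ^ 2 :=
    (memLp_two_iff_integrable_sq_norm hw.aestronglyMeasurable).1 hw
  have hsq : Tendsto (fun x => ∫ t in x..x + 1, ‖w t‖ ^ 2) atTop (𝓝 0) := by
    have hright := intervalIntegral_tendsto_integral_Ioi (μ := volume) 0 hint.integrableOn
      (tendsto_atTop_add_const_right atTop (1 : ℝ) tendsto_id)
    have hleft := intervalIntegral_tendsto_integral_Ioi (μ := volume) 0 hint.integrableOn
      tendsto_id
    refine (sub_self (∫ t in Ioi (0 : ℝ), ‖w t‖ ^ 2) ▸ hright.sub hleft).congr fun x => ?_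
    exact intervalIntegral.integral_interval_sub_left hint.intervalIntegrable
      hint.intervalIntegrable
  refine squeeze_zero (fun x => intervalIntegral.integral_nonneg (by linarith)
    fun t _ => norm_nonneg _) (fun x => Real.le_sqrt_of_sq_le ?_)
    (by simpa using hsq.sqrt)
  exact sq_integral_le_integral_sq hc.norm x

namespace IsClassicalSolution

variable {V : ℝ → ℝ} {z : ℂ} {w w₁ : ℝ → ℂ} {K : ℝ}

theorem norm_mul_sub_mul_le_integral (hV : Continuous V) (hK : ∀ x, |V x| ≤ K)
    (h : IsClassicalSolution V z w w₁) {p p' p'' : ℝ → ℝ} {A B : ℝ}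
    (hp : ∀ s, HasDerivAt p (p' s) s) (hp' : ∀ s, HasDerivAt p' (p'' s) s)
    (hp'' : Continuous p'') (h1 : p 1 = 0) (h1' : p' 1 = 0)
    (hA : ∀ s ∈ Icc (0 : ℝ) 1, |p s| ≤ A) (hB : ∀ s ∈ Icc (0 : ℝ) 1, |p'' s| ≤ B) (x : ℝ) :
    ‖p 0 * w₁ x - p' 0 * w x‖ ≤ (A * (K + ‖z‖) + B) * ∫ t in x..x + 1, ‖w t‖ := by
  have hwc := h.continuous
  have hpc : Continuous p := continuous_iff_continuousAt.2 fun s => (hp s).continuousAt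
  have hx : x ≤ x + 1 := by linarith
  have hderiv : ∀ t, HasDerivAt (fun t => p (t - x) * w₁ t - p' (t - x) * w t)
      ((p (t - x) * ((V t : ℂ) - z) - p'' (t - x)) * w t) t := fun t =>
    ((((hp (t - x)).comp_sub_const t x).ofReal_comp.mul (h t).2).sub
      (((hp' (t - x)).comp_sub_const t x).ofReal_comp.mul (h t).1)).congr_deriv (by ring)
  have hftc := intervalIntegral.integral_eq_sub_of_hasDerivAt (a := x) (b := x + 1)
    (fun t _ => hderiv t) (Continuous.intervalIntegrable (by fun_prop) _ _)
  have hboundary : p 0 * w₁ x - p' 0 * w x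
      = -∫ t in x..x + 1, (p (t - x) * ((V t : ℂ) - z) - p'' (t - x)) * w t := by
    simp [hftc, h1, h1']
  rw [hboundary, norm_neg, ← intervalIntegral.integral_const_mul]
  refine intervalIntegral.norm_integral_le_of_norm_le hx (ae_of_all _ fun t ht => ?_)
    (Continuous.intervalIntegrable (by fun_prop) _ _)
  have hs : t - x ∈ Icc (0 : ℝ) 1 := ⟨by linarith [ht.1], by linarith [ht.2]⟩
  rw [norm_mul]
  refine mul_le_mul_of_nonneg_right ((norm_sub_le _ _).trans (add_le_add ?_ ?_)) (norm_nonneg _)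
  · rw [norm_mul, Complex.norm_real, Real.norm_eq_abs]
    exact mul_le_mul (hA _ hs) (norm_ofReal_sub_le (hK t) z) (norm_nonneg _)
      ((abs_nonneg _).trans (hA _ hs))
  · rw [Complex.norm_real, Real.norm_eq_abs]
    exact hB _ hs

-- The test functions are the cubic Hermite polynomials with boundary data `(1, 0)` and `(0, 1)`
-- at the left end point of the window and `(0, 0)` at the right one.
theorem norm_snd_le_integral (hV : Continuous V) (hK : ∀ x, |V x| ≤ K)
    (h : IsClassicalSolution V z w w₁) (x : ℝ) :
    ‖w₁ x‖ ≤ (K + ‖z‖ + 6) * ∫ t in x..x + 1, ‖w t‖ := by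
  have hp : ∀ s ∈ Icc (0 : ℝ) 1, |1 - 3 * s ^ 2 + 2 * s ^ 3| ≤ 1 := fun s hs => by
    have hs' := mul_nonneg (sub_nonneg.2 hs.2) (sq_nonneg s)
    exact abs_le.2 ⟨by nlinarith [mul_nonneg hs.1 (sq_nonneg s), mul_nonneg hs.1 hs.1, hs.2],
      by nlinarith [sq_nonneg s]⟩
  have hbound := h.norm_mul_sub_mul_le_integral hV hK (p := fun s => 1 - 3 * s ^ 2 + 2 * s ^ 3)
    (p' := fun s => -6 * s + 6 * s ^ 2) (p'' := fun s => -6 + 12 * s) (A := 1) (B := 6)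
    (fun s => (((hasDerivAt_const s 1).sub ((hasDerivAt_pow 2 s).const_mul 3)).add
      ((hasDerivAt_pow 3 s).const_mul 2)).congr_deriv (by norm_num; ring))
    (fun s => (((hasDerivAt_id s).const_mul (-6)).add
      ((hasDerivAt_pow 2 s).const_mul 6)).congr_deriv (by norm_num; ring))
    (by fun_prop) (by norm_num) (by norm_num) hp
    (fun s hs => abs_le.2 ⟨by linarith [hs.1], by linarith [hs.2]⟩) x
  simpa using hbound

theorem norm_le_integral (hV : Continuous V) (hK : ∀ x, |V x| ≤ K)
    (h : IsClassicalSolution V z w w₁) (x : ℝ) :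
    ‖w x‖ ≤ (K + ‖z‖ + 4) * ∫ t in x..x + 1, ‖w t‖ := by
  have hq : ∀ s ∈ Icc (0 : ℝ) 1, |s - 2 * s ^ 2 + s ^ 3| ≤ 1 := fun s hs =>
    abs_le.2 ⟨by nlinarith [mul_nonneg hs.1 (sq_nonneg (1 - s))],
      by nlinarith [mul_nonneg (sub_nonneg.2 hs.2) (sq_nonneg s), sq_nonneg s, hs.2]⟩
  have hbound := h.norm_mul_sub_mul_le_integral hV hK (p := fun s => s - 2 * s ^ 2 + s ^ 3)
    (p' := fun s => 1 - 4 * s + 3 * s ^ 2) (p'' := fun s => -4 + 6 * s) (A := 1) (B := 4)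
    (fun s => (((hasDerivAt_id s).sub ((hasDerivAt_pow 2 s).const_mul 2)).add
      (hasDerivAt_pow 3 s)).congr_deriv (by norm_num; ring))
    (fun s => (((hasDerivAt_const s 1).sub ((hasDerivAt_id s).const_mul 4)).add
      ((hasDerivAt_pow 2 s).const_mul 3)).congr_deriv (by norm_num; ring))
    (by fun_prop) (by norm_num) (by norm_num) hq
    (fun s hs => abs_le.2 ⟨by linarith [hs.1], by linarith [hs.2]⟩) x
  simpa using hbound

theorem tendsto_zero (hV : Continuous V) (hK : ∀ x, |V x| ≤ K)
    (h : IsClassicalSolution V z w w₁) (hw : MemLp w 2 volume) :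
    Tendsto w atTop (𝓝 0) ∧ Tendsto w₁ atTop (𝓝 0) := by
  have hwindow := tendsto_integral_norm_of_memLp_two h.continuous hw
  exact ⟨squeeze_zero_norm (h.norm_le_integral hV hK) (by simpa using hwindow.const_mul _),
    squeeze_zero_norm (h.norm_snd_le_integral hV hK) (by simpa using hwindow.const_mul _)⟩

-- The Wronskian of `w` and its reflection is constant and decays at `+∞`.
theorem mul_eq_zero_of_memLp (hV : Continuous V) (hVe : Function.Even V) (hK : ∀ x, |V x| ≤ K)
    (h : IsClassicalSolution V z w w₁) (hw : MemLp w 2 volume) : w 0 * w₁ 0 = 0 := by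
  obtain ⟨hlim, hlim₁⟩ := h.tendsto_zero hV hK hw
  obtain ⟨hlim', hlim₁'⟩ := (h.comp_neg hVe).tendsto_zero hV hK
    (hw.comp_measurePreserving (Measure.measurePreserving_neg volume))
  have hwronskian : Tendsto (fun _ : ℝ => w 0 * -w₁ (-0) - w₁ 0 * w (-0)) atTop
      (𝓝 (0 * 0 - 0 * 0)) :=
    ((hlim.mul hlim₁').sub (hlim₁.mul hlim')).congr fun x =>
      h.wronskian_const (h.comp_neg hVe) 0 x
  have hzero := tendsto_nhds_unique tendsto_const_nhds hwronskian
  rw [neg_zero] at hzero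
  linear_combination (-1 / 2 : ℂ) * hzero

theorem even_or_odd (hV : Continuous V) (hVe : Function.Even V)
    (h : IsClassicalSolution V z w w₁) (h0 : w 0 * w₁ 0 = 0) :
    (w₁ 0 = 0 ∧ Function.Even w) ∨ (w 0 = 0 ∧ Function.Odd w) := by
  rcases mul_eq_zero.1 h0 with h0 | h0
  · refine .inr ⟨h0, fun x => ?_⟩
    simpa using (h.parity (ε := -1) hV hVe (by simp [h0]) (by simp)).1 x
  · refine .inl ⟨h0, fun x => ?_⟩
    simpa using (h.parity (ε := 1) hV hVe (by simp) (by simp [h0])).1 x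

end IsClassicalSolution

/-! ### Floquet theory on a half-line -/

theorem exists_bound_of_periodic_right {h : ℝ → ℝ} {R : ℝ} (hc : Continuous h)
    (hp : ∀ x, R ≤ x → h (x + 1) = h x) : ∃ C, ∀ x, 0 ≤ x → |h x| ≤ C := by
  obtain ⟨C, hC⟩ := exists_abs_le_on_Icc_of_continuous hc 0 (|R| + 1)
  refine ⟨C, fun x hx => ?_⟩
  obtain ⟨n, hn⟩ := exists_nat_ge x
  have hbound : ∀ n : ℕ, ∀ x, 0 ≤ x → x ≤ |R| + 1 + n → |h x| ≤ C := by
    intro n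
    induction n with
    | zero => exact fun x hx hxn => hC x ⟨hx, by simpa using hxn⟩
    | succ n ih =>
      intro x hx hxn
      push_cast at hxn
      rcases le_total x (|R| + 1 + n) with hle | hle
      · exact ih x hx hle
      · have hR : |R| ≤ x - 1 := by linarith [n.cast_nonneg (α := ℝ)]
        rw [← sub_add_cancel x 1, hp (x - 1) ((le_abs_self R).trans hR)]
        exact ih (x - 1) ((abs_nonneg R).trans hR) (by linarith)
  exact hbound n x hx (by linarith [abs_nonneg R])

theorem exists_abs_le_of_even {V Vper Vdef : ℝ → ℝ} {ρ : ℝ} (hV : Continuous V)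
    (hVe : Function.Even V) (hVsum : ∀ x, V x = Vper x + Vdef x)
    (hVper : ∀ x, Vper (x + 1) = Vper x) (hVdef : ∀ x, ρ < |x| → Vdef x = 0) :
    ∃ K, ∀ x, |V x| ≤ K := by
  obtain ⟨K, hK⟩ := exists_bound_of_periodic_right (R := ρ + 1) hV fun x hx => by
    rw [hVsum, hVsum, hVdef x ((lt_add_one ρ).trans_le (hx.trans (le_abs_self x))),
      hVdef (x + 1) (lt_of_lt_of_le (by linarith) (le_abs_self _)), hVper]
  refine ⟨K, fun x => ?_⟩
  rcases le_total 0 x with hx | hx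
  · exact hK x hx
  · rw [← hVe x]
    exact hK (-x) (neg_nonneg.2 hx)

/-- `g` is multiplied by `m` under a shift by the period `1`, as long as one stays in `[R, ∞)`. -/
def IsQuasiperiodicFrom (R : ℝ) (m : ℂ) (g : ℝ → ℂ) : Prop :=
  ∀ x, R ≤ x → g (x + 1) = m * g x

namespace IsQuasiperiodicFrom

variable {R x : ℝ} {m : ℂ} {g : ℝ → ℂ}

theorem add_nat (h : IsQuasiperiodicFrom R m g) (hx : R ≤ x) (n : ℕ) :
    g (x + n) = m ^ n * g x := by
  induction n with
  | zero => simp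
  | succ n ih =>
    rw [Nat.cast_succ, ← add_assoc, h _ (by linarith [n.cast_nonneg (α := ℝ)]), ih]
    ring

theorem norm_lt_one (h : IsQuasiperiodicFrom R m g) (hg : Tendsto g atTop (𝓝 0)) (hx : R ≤ x)
    (hgx : g x ≠ 0) : ‖m‖ < 1 := by
  have hseq : Tendsto (fun n : ℕ => m ^ n * g x) atTop (𝓝 0) :=
    (hg.comp (tendsto_atTop_add_const_left _ x tendsto_natCast_atTop_atTop)).congr (h.add_nat hx)
  refine tendsto_pow_atTop_nhds_zero_iff_norm_lt_one.1 ?_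
  simpa [mul_assoc, mul_inv_cancel₀ hgx] using hseq.mul_const (g x)⁻¹

theorem conj_eq (h : IsQuasiperiodicFrom R m g) (hg : ∀ x, starRingEnd ℂ (g x) = g x)
    (hx : R ≤ x) (hgx : g x ≠ 0) : starRingEnd ℂ m = m := by
  have hconj := congrArg (starRingEnd ℂ) (h x hx)
  rw [map_mul, hg, hg, h x hx] at hconj
  exact (mul_right_cancel₀ hgx hconj).symm

theorem exists_norm_le_exp (h : IsQuasiperiodicFrom R m g) (hg : Continuous g) (hm : m ≠ 0) :
    ∃ C, 0 ≤ C ∧ ∀ x, 0 ≤ x → ‖g x‖ ≤ C * Real.exp (Real.log ‖m‖ * x) := by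
  obtain ⟨C, hC⟩ := exists_bound_of_periodic_right
    (h := fun x => ‖g x‖ * Real.exp (-(Real.log ‖m‖ * x))) (R := R) (by fun_prop) fun x hx => by
      have hexp : Real.exp (-(Real.log ‖m‖ * (x + 1)))
          = Real.exp (-(Real.log ‖m‖ * x)) * ‖m‖⁻¹ := by
        rw [mul_add, neg_add, Real.exp_add, mul_one, Real.exp_neg (Real.log ‖m‖),
          Real.exp_log (norm_pos_iff.2 hm)]
      have hm' := norm_ne_zero_iff.2 hm
      rw [h x hx, norm_mul, hexp]
      field_simp
  refine ⟨C, (abs_nonneg _).trans (hC 0 le_rfl), fun x hx => ?_⟩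
  have hbound := (le_abs_self _).trans (hC x hx)
  rwa [Real.exp_neg, mul_inv_le_iff₀ (Real.exp_pos _)] at hbound

end IsQuasiperiodicFrom

namespace IsClassicalSolution

variable {V : ℝ → ℝ} {z : ℂ} {u u₁ v v₁ w w₁ y y₁ : ℝ → ℂ} {R : ℝ}

theorem exists_ge_ne_zero (hw : IsClassicalSolution V z w w₁)
    (hW : ∀ x, w x * y₁ x - w₁ x * y x ≠ 0) (R : ℝ) : ∃ x, R ≤ x ∧ w x ≠ 0 := by
  by_contra! hzero
  have hderiv : w₁ (R + 1) = 0 := by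
    refine (hw (R + 1)).1.unique ((hasDerivAt_const (R + 1) (0 : ℂ)).congr_of_eventuallyEq ?_)
    filter_upwards [lt_mem_nhds (lt_add_one R)] with x hx using hzero x hx.le
  exact hW (R + 1) (by rw [hzero _ (lt_add_one R).le, hderiv]; ring)

theorem shift_eq (hV : Continuous V) (hp : ∀ x, R ≤ x → V (x + 1) = V x)
    (hw : IsClassicalSolution V z w w₁) (hy : IsClassicalSolution V z y y₁)
    (h0 : w (R + 1) = y R) (h1 : w₁ (R + 1) = y₁ R) {x : ℝ} (hx : R ≤ x) :
    w (x + 1) = y x ∧ w₁ (x + 1) = y₁ x := by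
  obtain ⟨K, hK⟩ := exists_abs_le_on_Icc_of_continuous hV R x
  have hwc := hw.continuous
  have hw₁c := hw.continuous_snd
  have hyc := hy.continuous
  have hy₁c := hy.continuous_snd
  have hd : ∀ t, HasDerivAt (fun t => w (t + 1) - y t) (w₁ (t + 1) - y₁ t) t := fun t =>
    ((hw (t + 1)).1.comp_add_const t 1).sub (hy t).1
  have hd₁ : ∀ t, R ≤ t → HasDerivAt (fun t => w₁ (t + 1) - y₁ t)
      (((V t : ℂ) - z) * (w (t + 1) - y t)) t := fun t ht =>
    (((hw (t + 1)).2.comp_add_const t 1).sub (hy t).2).congr_deriv (by rw [hp t ht]; ring)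
  have hzero := eq_zero_of_integral_eq (w := fun t => w (t + 1) - y t)
    (w₁ := fun t => w₁ (t + 1) - y₁ t) (q := fun t => (V t : ℂ) - z) (by fun_prop) (by fun_prop)
    (fun s _ => by
      rw [intervalIntegral.integral_eq_sub_of_hasDerivAt (fun t _ => hd t)
        (Continuous.intervalIntegrable (by fun_prop) _ _), h0, sub_self, sub_zero])
    (fun s hs => by
      rw [intervalIntegral.integral_eq_sub_of_hasDerivAt
        (fun t ht => hd₁ t (uIcc_of_le hs.1 ▸ ht).1)
        (Continuous.intervalIntegrable (by fun_prop) _ _), h1, sub_self, sub_zero])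
    (fun t ht => norm_ofReal_sub_le (hK t ht) z) x ⟨hx, le_rfl⟩
  exact ⟨sub_eq_zero.1 hzero.1, sub_eq_zero.1 hzero.2⟩

theorem exists_shift_eq (hV : Continuous V) (hp : ∀ x, R ≤ x → V (x + 1) = V x)
    (hu : IsClassicalSolution V z u u₁) (hv : IsClassicalSolution V z v v₁)
    (hW : ∀ x, u x * v₁ x - u₁ x * v x = 1) (hw : IsClassicalSolution V z w w₁) :
    ∃ α β : ℂ, ∀ x, R ≤ x → w (x + 1) = α * u x + β * v x ∧ w₁ (x + 1) = α * u₁ x + β * v₁ x := by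
  refine ⟨w (R + 1) * v₁ R - w₁ (R + 1) * v R, u R * w₁ (R + 1) - u₁ R * w (R + 1),
    fun x => shift_eq hV hp hw ((hu.const_mul _).add (hv.const_mul _)) ?_ ?_⟩
  · linear_combination (-w (R + 1)) * hW R
  · linear_combination (-w₁ (R + 1)) * hW R

theorem exists_isQuasiperiodicFrom_of_tendsto_zero (hV : Continuous V)
    (hp : ∀ x, R ≤ x → V (x + 1) = V x) (hu : IsClassicalSolution V z u u₁)
    (hv : IsClassicalSolution V z v v₁) (hW : ∀ x, u x * v₁ x - u₁ x * v x = 1)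
    (hlim : Tendsto u atTop (𝓝 0)) (hlim₁ : Tendsto u₁ atTop (𝓝 0)) :
    ∃ m, IsQuasiperiodicFrom R m u ∧ IsQuasiperiodicFrom R m u₁ := by
  obtain ⟨m, β, hshift⟩ := exists_shift_eq hV hp hu hv hW hu
  have hsucc : Tendsto (fun x : ℝ => x + 1) atTop atTop :=
    tendsto_atTop_add_const_right _ _ tendsto_id
  -- `β` is the Wronskian of `u` and its shift, which decays.
  have hβ : β = 0 := by
    have hwronskian := (hlim.mul (hlim₁.comp hsucc)).sub (hlim₁.mul (hlim.comp hsucc))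
    refine tendsto_nhds_unique (tendsto_const_nhds.congr' ?_) (by simpa using hwronskian)
    filter_upwards [eventually_ge_atTop R] with x hx
    simp only [(hshift x hx).1, (hshift x hx).2]
    linear_combination (-β) * hW x
  exact ⟨m, fun x hx => by simpa [hβ] using (hshift x hx).1,
    fun x hx => by simpa [hβ] using (hshift x hx).2⟩

theorem exists_isQuasiperiodicFrom_inv {m : ℂ} (hm : m ^ 2 ≠ 1) (hV : Continuous V)
    (hp : ∀ x, R ≤ x → V (x + 1) = V x) (hu : IsClassicalSolution V z u u₁)
    (hv : IsClassicalSolution V z v v₁) (hW : ∀ x, u x * v₁ x - u₁ x * v x = 1)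
    (hum : IsQuasiperiodicFrom R m u) (hum₁ : IsQuasiperiodicFrom R m u₁) :
    m ≠ 0 ∧ ∃ γ, IsQuasiperiodicFrom R m⁻¹ (fun x => v x + γ * u x) ∧
      IsQuasiperiodicFrom R m⁻¹ (fun x => v₁ x + γ * u₁ x) := by
  obtain ⟨α, β, hshift⟩ := exists_shift_eq hV hp hu hv hW hv
  have hdet : m * β = 1 := by
    have hWR := hW (R + 1)
    rw [hum R le_rfl, hum₁ R le_rfl, (hshift R le_rfl).1, (hshift R le_rfl).2] at hWR
    linear_combination hWR - m * β * hW R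
  have hm0 : m ≠ 0 := left_ne_zero_of_mul_eq_one hdet
  have hden : 1 - m ^ 2 ≠ 0 := sub_ne_zero.2 hm.symm
  refine ⟨hm0, α * m / (1 - m ^ 2), fun x hx => ?_, fun x hx => ?_⟩
  · simp only [hum x hx]
    rw [(hshift x hx).1, eq_inv_of_mul_eq_one_right hdet]
    field_simp
    ring
  · simp only [hum₁ x hx]
    rw [(hshift x hx).2, eq_inv_of_mul_eq_one_right hdet]
    field_simp
    ring

theorem exists_floquet_pair (hV : Continuous V) (hp : ∀ x, R ≤ x → V (x + 1) = V x)
    (hu : IsClassicalSolution V z u u₁) (hv : IsClassicalSolution V z v v₁)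
    (hW : ∀ x, u x * v₁ x - u₁ x * v x = 1) (hreal : ∀ x, starRingEnd ℂ (u x) = u x)
    (hlim : Tendsto u atTop (𝓝 0)) (hlim₁ : Tendsto u₁ atTop (𝓝 0)) :
    ∃ (m : ℝ) (γ : ℂ), m ≠ 0 ∧ |m| < 1 ∧ IsQuasiperiodicFrom R m u ∧ IsQuasiperiodicFrom R m u₁ ∧
      IsQuasiperiodicFrom R (m : ℂ)⁻¹ (fun x => v x + γ * u x) ∧
      IsQuasiperiodicFrom R (m : ℂ)⁻¹ (fun x => v₁ x + γ * u₁ x) := by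
  obtain ⟨m, hum, hum₁⟩ := exists_isQuasiperiodicFrom_of_tendsto_zero hV hp hu hv hW hlim hlim₁
  obtain ⟨x, hx, hux⟩ := hu.exists_ge_ne_zero (fun x => (hW x).symm ▸ one_ne_zero) R
  obtain ⟨m, rfl⟩ := Complex.conj_eq_iff_real.1 (hum.conj_eq hreal hx hux)
  have hm1 : |m| < 1 := by simpa using hum.norm_lt_one hlim hx hux
  have hmsq : (m : ℂ) ^ 2 ≠ 1 := by
    exact_mod_cast ((sq_lt_one_iff_abs_lt_one m).2 hm1).ne
  obtain ⟨hm0, γ, hγ⟩ := exists_isQuasiperiodicFrom_inv hmsq hV hp hu hv hW hum hum₁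
  exact ⟨m, γ, by exact_mod_cast hm0, hm1, hum, hum₁, hγ⟩

end IsClassicalSolution

/-- On `[0, ∞)` the function `u` and its derivative decay like `e^{-kx}`, while `v` and its
derivative grow at most like `e^{kx}`, with the common constant `C`. -/
structure HasExponentialDichotomy (k C : ℝ) (u v : ℝ → ℂ) : Prop where
  norm_left_le : ∀ x, 0 ≤ x → ‖u x‖ ≤ C * Real.exp (-(k * x))
  norm_deriv_left_le : ∀ x, 0 ≤ x → ‖deriv u x‖ ≤ C * Real.exp (-(k * x))
  norm_right_le : ∀ x, 0 ≤ x → ‖v x‖ ≤ C * Real.exp (k * x)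
  norm_deriv_right_le : ∀ x, 0 ≤ x → ‖deriv v x‖ ≤ C * Real.exp (k * x)

theorem exists_norm_le_exp_pair {f g : ℝ → ℂ} {R m : ℝ} {γ : ℂ} (hf : Continuous f)
    (hg : Continuous g) (hm : m ≠ 0) (hm1 : |m| < 1) (hfm : IsQuasiperiodicFrom R m f)
    (hgm : IsQuasiperiodicFrom R (m : ℂ)⁻¹ (fun x => g x + γ * f x)) :
    ∃ C, ∀ x, 0 ≤ x → ‖f x‖ ≤ C * Real.exp (-(Real.log |m⁻¹| * x)) ∧
      ‖g x‖ ≤ C * Real.exp (Real.log |m⁻¹| * x) := by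
  have hmC : (m : ℂ) ≠ 0 := by exact_mod_cast hm
  obtain ⟨A, hA, hfA⟩ := hfm.exists_norm_le_exp hf hmC
  obtain ⟨B, hB, hgB⟩ := hgm.exists_norm_le_exp (by fun_prop) (inv_ne_zero hmC)
  have hlog : Real.log ‖(m : ℂ)‖ = -Real.log |m⁻¹| := by
    rw [abs_inv, Real.log_inv, neg_neg, Complex.norm_real, Real.norm_eq_abs]
  rw [norm_inv, Real.log_inv, hlog, neg_neg] at hgB
  rw [hlog] at hfA
  have hk : 0 ≤ Real.log |m⁻¹| :=
    Real.log_nonneg (by rw [abs_inv]; exact (one_le_inv₀ (abs_pos.2 hm)).2 hm1.le)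
  set k := Real.log |m⁻¹|
  simp only [neg_mul] at hfA
  have hγA : 0 ≤ ‖γ‖ * A := by positivity
  refine ⟨A + B + ‖γ‖ * A, fun x hx => ⟨(hfA x hx).trans ?_, ?_⟩⟩
  · gcongr
    linarith
  · have hexp : Real.exp (-(k * x)) ≤ Real.exp (k * x) :=
      Real.exp_le_exp.2 (by linarith [mul_nonneg hk hx])
    calc ‖g x‖ = ‖(g x + γ * f x) - γ * f x‖ := by rw [add_sub_cancel_right]
      _ ≤ ‖g x + γ * f x‖ + ‖γ‖ * ‖f x‖ := (norm_sub_le _ _).trans (by rw [norm_mul])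
      _ ≤ B * Real.exp (k * x) + ‖γ‖ * (A * Real.exp (k * x)) := by
        gcongr
        · exact hgB x hx
        · exact (hfA x hx).trans (by gcongr)
      _ ≤ (A + B + ‖γ‖ * A) * Real.exp (k * x) := by
        rw [← mul_assoc, ← add_mul]
        gcongr
        linarith

theorem exists_hasExponentialDichotomy {V : ℝ → ℝ} {z γ : ℂ} {u v : ℝ → ℂ} {R m : ℝ}
    (hu : IsClassicalSolution V z u (deriv u)) (hv : IsClassicalSolution V z v (deriv v))
    (hm : m ≠ 0) (hm1 : |m| < 1) (hum : IsQuasiperiodicFrom R m u)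
    (hum₁ : IsQuasiperiodicFrom R m (deriv u))
    (hvm : IsQuasiperiodicFrom R (m : ℂ)⁻¹ (fun x => v x + γ * u x))
    (hvm₁ : IsQuasiperiodicFrom R (m : ℂ)⁻¹ (fun x => deriv v x + γ * deriv u x)) :
    ∃ C, HasExponentialDichotomy (Real.log |m⁻¹|) C u v := by
  obtain ⟨A, hA⟩ := exists_norm_le_exp_pair hu.continuous hv.continuous hm hm1 hum hvm
  obtain ⟨B, hB⟩ := exists_norm_le_exp_pair hu.continuous_snd hv.continuous_snd hm hm1 hum₁ hvm₁
  have weakenA : ∀ {t s}, t ≤ A * Real.exp s → t ≤ max A B * Real.exp s := fun h =>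
    h.trans (by gcongr; exact le_max_left _ _)
  have weakenB : ∀ {t s}, t ≤ B * Real.exp s → t ≤ max A B * Real.exp s := fun h =>
    h.trans (by gcongr; exact le_max_right _ _)
  exact ⟨max A B, fun x hx => weakenA (hA x hx).1, fun x hx => weakenB (hB x hx).1,
    fun x hx => weakenA (hA x hx).2, fun x hx => weakenB (hB x hx).2⟩

/-- The extension to the whole line of a function `g` that is quasi-periodic from `R` on, obtained
by moving `x` into `[R, ∞)` by whole periods. It turns a solution near `+∞` into a Floquet solution
of the periodic equation. -/
noncomputable def floquetExtension (R : ℝ) (m : ℂ) (g : ℝ → ℂ) (x : ℝ) : ℂ :=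
  (m ^ ⌈R - x⌉₊)⁻¹ * g (x + (⌈R - x⌉₊ : ℕ))

theorem floquetExtension_eq {R x : ℝ} {m : ℂ} {g : ℝ → ℂ} (hm : m ≠ 0)
    (h : IsQuasiperiodicFrom R m g) {n : ℕ} (hx : R ≤ x + n) :
    floquetExtension R m g x = (m ^ n)⁻¹ * g (x + n) := by
  obtain ⟨d, rfl⟩ := Nat.exists_eq_add_of_le (Nat.ceil_le.2 (sub_le_iff_le_add'.2 hx))
  have hceil : R ≤ x + (⌈R - x⌉₊ : ℕ) := by linarith [Nat.le_ceil (R - x)]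
  rw [Nat.cast_add, ← add_assoc, h.add_nat hceil, pow_add, floquetExtension]
  field_simp

theorem floquetExtension_add_one {R : ℝ} {m : ℂ} {g : ℝ → ℂ} (hm : m ≠ 0)
    (h : IsQuasiperiodicFrom R m g) (x : ℝ) :
    floquetExtension R m g (x + 1) = m * floquetExtension R m g x := by
  obtain ⟨n, hn⟩ := exists_nat_ge (R - x)
  rw [floquetExtension_eq hm h (n := n) (by linarith),
    floquetExtension_eq hm h (n := n) (by linarith), add_right_comm, h _ (by linarith)]
  ring

theorem exists_nat_eventually_lt_add (R x : ℝ) : ∃ n : ℕ, ∀ᶠ t in 𝓝 x, R < t + n := by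
  obtain ⟨n, hn⟩ := exists_nat_gt (R - x)
  exact ⟨n, (continuous_add_const (n : ℝ)).continuousAt.eventually
    (lt_mem_nhds (by simp only; linarith))⟩

theorem continuous_of_periodic_of_eq_of_lt {V W : ℝ → ℝ} {R : ℝ} (hV : Continuous V)
    (hW : Function.Periodic W 1) (hVW : ∀ x, R < x → V x = W x) : Continuous W := by
  refine continuous_iff_continuousAt.2 fun x => ?_
  obtain ⟨n, hn⟩ := exists_nat_eventually_lt_add R x
  refine (hV.comp (continuous_add_const (n : ℝ))).continuousAt.congr ?_
  filter_upwards [hn] with t ht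
  rw [Function.comp_apply, hVW _ ht]
  simpa using hW.nat_mul n t

theorem IsClassicalSolution.floquetExtension {V W : ℝ → ℝ} {z : ℂ} {R : ℝ} {m : ℂ}
    {ψ ψ₁ : ℝ → ℂ} (hW : Function.Periodic W 1) (hVW : ∀ x, R < x → V x = W x) (hm : m ≠ 0)
    (hψ : IsClassicalSolution V z ψ ψ₁) (h : IsQuasiperiodicFrom R m ψ)
    (h₁ : IsQuasiperiodicFrom R m ψ₁) :
    IsClassicalSolution W z (floquetExtension R m ψ) (floquetExtension R m ψ₁) := by
  intro x
  obtain ⟨n, hn⟩ := exists_nat_eventually_lt_add R x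
  have hx : R < x + n := hn.self_of_nhds
  have hWx : V (x + n) = W x := (hVW _ hx).trans (by simpa using hW.nat_mul n x)
  rw [floquetExtension_eq hm h hx.le, floquetExtension_eq hm h₁ hx.le, ← hWx]
  have hderiv := ((hψ (x + n)).1.comp_add_const x n).const_mul (m ^ n)⁻¹
  have hderiv₁ := ((hψ (x + n)).2.comp_add_const x n).const_mul (m ^ n)⁻¹
  rw [mul_left_comm] at hderiv₁
  refine ⟨hderiv.congr_of_eventuallyEq ?_, hderiv₁.congr_of_eventuallyEq ?_⟩
  · filter_upwards [hn] with t ht using floquetExtension_eq hm h ht.le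
  · filter_upwards [hn] with t ht using floquetExtension_eq hm h₁ ht.le

theorem isCharacteristicMultiplier_of_isQuasiperiodicFrom {V W : ℝ → ℝ} {E R m : ℝ} {ψ ψ₁ : ℝ → ℂ}
    (hV : Continuous V) (hW : Function.Periodic W 1) (hVW : ∀ x, R < x → V x = W x) (hm : m ≠ 0)
    (hψ : IsClassicalSolution V E ψ ψ₁) (hne : ∃ x, R ≤ x ∧ ψ x ≠ 0)
    (h : IsQuasiperiodicFrom R m ψ) (h₁ : IsQuasiperiodicFrom R m ψ₁) :
    IsCharacteristicMultiplier W E m := by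
  have hmC : (m : ℂ) ≠ 0 := by exact_mod_cast hm
  refine ⟨floquetExtension R m ψ, fun hzero => ?_,
    (hψ.floquetExtension hW hVW hmC h h₁).solvesSchrodinger
      (continuous_of_periodic_of_eq_of_lt hV hW hVW), floquetExtension_add_one hmC h⟩
  obtain ⟨x, hx, hψx⟩ := hne
  have hext := floquetExtension_eq hmC h (n := 0) (by simpa using hx)
  rw [hzero] at hext
  exact hψx (by simpa using hext.symm)

/-! ### Dependence of solutions on the spectral parameter -/

/-- Families, indexed by the energy `z`, of solutions `u z` and `v z` of `-w'' + V w = z w` with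
Wronskian `1`, where the Cauchy data of `u z` at `0` do not depend on `z`. -/
structure IsSolutionFamily (V : ℝ → ℝ) (u v : ℂ → ℝ → ℂ) : Prop where
  left : ∀ z, IsClassicalSolution V z (u z) (deriv (u z))
  right : ∀ z, IsClassicalSolution V z (v z) (deriv (v z))
  apply_zero : ∀ z z', u z 0 = u z' 0
  deriv_zero : ∀ z z', deriv (u z) 0 = deriv (u z') 0
  wronskian_zero : ∀ z, u z 0 * deriv (v z) 0 - deriv (u z) 0 * v z 0 = 1

theorem norm_integral_mul_le {f g : ℝ → ℂ} {x X S P : ℝ} (hx : 0 ≤ x) (hxX : x ≤ X) (hS : 0 ≤ S)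
    (hP : 0 ≤ P) (hf : ∀ t, 0 ≤ t → t ≤ X → ‖f t‖ ≤ S) (hg : ∀ t, 0 ≤ t → t ≤ X → ‖g t‖ ≤ P) :
    ‖∫ t in (0 : ℝ)..x, f t * g t‖ ≤ X * (S * P) := by
  have h := intervalIntegral.norm_integral_le_of_norm_le_const (a := 0) (b := x)
    (f := fun t => f t * g t) (C := S * P) fun t ht => by
      rw [uIoc_of_le hx] at ht
      rw [norm_mul]
      exact mul_le_mul (hf t ht.1.le (ht.2.trans hxX)) (hg t ht.1.le (ht.2.trans hxX))
        (norm_nonneg _) hS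
  rw [sub_zero, abs_of_nonneg hx] at h
  refine h.trans ?_
  rw [mul_comm]
  exact mul_le_mul_of_nonneg_right hxX (mul_nonneg hS hP)

theorem differentiable_of_eq_add_sub_mul {f : ℂ → ℂ} {g : ℂ → ℂ → ℂ}
    (hf : ∀ z₀ z, f z = f z₀ + (z - z₀) * g z₀ z)
    (hg : ∀ z₀, Tendsto (g z₀) (𝓝 z₀) (𝓝 (g z₀ z₀))) : Differentiable ℂ f := by
  intro z₀
  refine HasDerivAt.differentiableAt (f' := g z₀ z₀) ?_
  rw [hasDerivAt_iff_tendsto_slope]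
  refine ((hg z₀).mono_left nhdsWithin_le_nhds).congr' ?_
  filter_upwards [self_mem_nhdsWithin] with z hz
  have hz₀ : z - z₀ ≠ 0 := sub_ne_zero.2 hz
  rw [slope_def_field, hf z₀ z]
  field_simp
  ring

namespace IsSolutionFamily

variable {V : ℝ → ℝ} {u v : ℂ → ℝ → ℂ}

theorem wronskian (h : IsSolutionFamily V u v) (z : ℂ) (x : ℝ) :
    u z x * deriv (v z) x - deriv (u z) x * v z x = 1 :=
  ((h.left z).wronskian_const (h.right z) 0 x).trans (h.wronskian_zero z)

theorem wronskian_left (h : IsSolutionFamily V u v) (z z₀ : ℂ) (x : ℝ) :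
    u z x * deriv (v z₀) x - deriv (u z) x * v z₀ x
      = 1 + (z - z₀) * ∫ t in (0 : ℝ)..x, u z t * v z₀ t := by
  have hsub := (h.left z).wronskian_sub (h.right z₀) 0 x
  rw [h.apply_zero z z₀, h.deriv_zero z z₀, h.wronskian_zero z₀] at hsub
  linear_combination hsub

theorem wronskian_right (h : IsSolutionFamily V u v) (z z₀ : ℂ) (x : ℝ) :
    u z₀ x * deriv (u z) x - deriv (u z₀) x * u z x
      = -((z - z₀) * ∫ t in (0 : ℝ)..x, u z t * u z₀ t) := by
  have hsub := (h.left z).wronskian_sub (h.left z₀) 0 x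
  rw [h.apply_zero z z₀, h.deriv_zero z z₀] at hsub
  linear_combination -hsub

theorem variation (h : IsSolutionFamily V u v) (z z₀ : ℂ) (x : ℝ) :
    u z x = (1 + (z - z₀) * ∫ t in (0 : ℝ)..x, u z t * v z₀ t) * u z₀ x
      - ((z - z₀) * ∫ t in (0 : ℝ)..x, u z t * u z₀ t) * v z₀ x := by
  rw [← h.wronskian_left]
  linear_combination (-u z x) * h.wronskian z₀ x + v z₀ x * h.wronskian_right z z₀ x

theorem variation_deriv (h : IsSolutionFamily V u v) (z z₀ : ℂ) (x : ℝ) :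
    deriv (u z) x = (1 + (z - z₀) * ∫ t in (0 : ℝ)..x, u z t * v z₀ t) * deriv (u z₀) x
      - ((z - z₀) * ∫ t in (0 : ℝ)..x, u z t * u z₀ t) * deriv (v z₀) x := by
  rw [← h.wronskian_left]
  linear_combination (-deriv (u z) x) * h.wronskian z₀ x + deriv (v z₀) x * h.wronskian_right z z₀ x

theorem norm_le_two_mul (h : IsSolutionFamily V u v) {z z₀ : ℂ} {X P Q : ℝ} (hX : 0 ≤ X)
    (hP : ∀ t, 0 ≤ t → t ≤ X → ‖u z₀ t‖ ≤ P) (hQ : ∀ t, 0 ≤ t → t ≤ X → ‖v z₀ t‖ ≤ Q)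
    (hz : 4 * (‖z - z₀‖ * X * P * Q) ≤ 1) : ∀ t, 0 ≤ t → t ≤ X → ‖u z t‖ ≤ 2 * P := by
  have hP0 : 0 ≤ P := (norm_nonneg _).trans (hP 0 le_rfl hX)
  have hQ0 : 0 ≤ Q := (norm_nonneg _).trans (hQ 0 le_rfl hX)
  obtain ⟨p, hp, hmax⟩ := isCompact_Icc.exists_isMaxOn (nonempty_Icc.2 hX)
    ((h.left z).continuous.norm.continuousOn (s := Icc 0 X))
  set S := ‖u z p‖ with hS
  have hS0 : 0 ≤ S := norm_nonneg _
  have hm : ∀ t, 0 ≤ t → t ≤ X → ‖u z t‖ ≤ S := fun t h0 h1 => hmax ⟨h0, h1⟩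
  have hIv := norm_integral_mul_le hp.1 hp.2 hS0 hQ0 hm hQ
  have hIu := norm_integral_mul_le hp.1 hp.2 hS0 hP0 hm hP
  have hS_le : S ≤ (1 + ‖z - z₀‖ * (X * (S * Q))) * P + ‖z - z₀‖ * (X * (S * P)) * Q := by
    rw [hS]
    nth_rewrite 1 [h.variation z z₀ p]
    refine (norm_sub_le _ _).trans (add_le_add ?_ ?_)
    · rw [norm_mul]
      refine mul_le_mul ((norm_add_le _ _).trans ?_) (hP p hp.1 hp.2) (norm_nonneg _)
        (by positivity)
      rw [norm_one, norm_mul]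
      gcongr
    · rw [norm_mul, norm_mul]
      have hQp := hQ p hp.1 hp.2
      gcongr
  have hSP : S ≤ 2 * P := by nlinarith [mul_le_mul_of_nonneg_right hz hS0]
  exact fun t h0 h1 => (hm t h0 h1).trans hSP

theorem norm_sub_le_of_bound (h : IsSolutionFamily V u v) {z z₀ : ℂ} {X P Q : ℝ} (hX : 0 ≤ X)
    (hP : ∀ t, 0 ≤ t → t ≤ X → ‖u z₀ t‖ ≤ P) (hQ : ∀ t, 0 ≤ t → t ≤ X → ‖v z₀ t‖ ≤ Q)
    (hz : 4 * (‖z - z₀‖ * X * P * Q) ≤ 1) :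
    ∀ t, 0 ≤ t → t ≤ X → ‖u z t - u z₀ t‖ ≤ 4 * (X * P * P * Q) * ‖z - z₀‖ := by
  intro t h0 h1
  have hP0 : 0 ≤ P := (norm_nonneg _).trans (hP 0 le_rfl hX)
  have hQ0 : 0 ≤ Q := (norm_nonneg _).trans (hQ 0 le_rfl hX)
  have hm := h.norm_le_two_mul hX hP hQ hz
  have hIv := norm_integral_mul_le h0 h1 (by positivity) hQ0 hm hQ
  have hIu := norm_integral_mul_le h0 h1 (by positivity) hP0 hm hP
  have hdiff : u z t - u z₀ t = (z - z₀) * ((∫ s in (0 : ℝ)..t, u z s * v z₀ s) * u z₀ t)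
      - (z - z₀) * ((∫ s in (0 : ℝ)..t, u z s * u z₀ s) * v z₀ t) := by
    rw [sub_eq_iff_eq_add]
    nth_rewrite 1 [h.variation z z₀ t]
    ring
  rw [hdiff]
  refine (norm_sub_le _ _).trans ?_
  rw [norm_mul, norm_mul, norm_mul, norm_mul]
  have hPt := hP t h0 h1
  have hQt := hQ t h0 h1
  calc _ ≤ ‖z - z₀‖ * (X * (2 * P * Q) * P) + ‖z - z₀‖ * (X * (2 * P * P) * Q) := by gcongr
    _ = _ := by ring

theorem tendsto_integral_mul (h : IsSolutionFamily V u v) (z₀ : ℂ) {x : ℝ} (hx : 0 ≤ x)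
    {g : ℝ → ℂ} (hg : Continuous g) :
    Tendsto (fun z => ∫ t in (0 : ℝ)..x, u z t * g t) (𝓝 z₀)
      (𝓝 (∫ t in (0 : ℝ)..x, u z₀ t * g t)) := by
  obtain ⟨P, hP⟩ := isCompact_Icc.exists_bound_of_continuousOn
    ((h.left z₀).continuous.continuousOn (s := Icc 0 x))
  obtain ⟨Q, hQ⟩ := isCompact_Icc.exists_bound_of_continuousOn
    ((h.right z₀).continuous.continuousOn (s := Icc 0 x))
  obtain ⟨G, hG⟩ := isCompact_Icc.exists_bound_of_continuousOn (hg.continuousOn (s := Icc 0 x))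
  have hP0 : 0 ≤ P := (norm_nonneg _).trans (hP 0 ⟨le_rfl, hx⟩)
  have hQ0 : 0 ≤ Q := (norm_nonneg _).trans (hQ 0 ⟨le_rfl, hx⟩)
  have hG0 : 0 ≤ G := (norm_nonneg _).trans (hG 0 ⟨le_rfl, hx⟩)
  have hdist : Tendsto (fun z => ‖z - z₀‖) (𝓝 z₀) (𝓝 0) := by
    have hcont : Continuous fun z => ‖z - z₀‖ := by fun_prop
    simpa using hcont.tendsto z₀
  have hsmall : Tendsto (fun z => 4 * (‖z - z₀‖ * x * P * Q)) (𝓝 z₀) (𝓝 0) := by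
    simpa using (((hdist.mul_const x).mul_const P).mul_const Q).const_mul 4
  rw [tendsto_iff_norm_sub_tendsto_zero]
  refine squeeze_zero' (g := fun z => x * (4 * (x * P * P * Q) * ‖z - z₀‖ * G))
    (Eventually.of_forall fun z => norm_nonneg _) ?_ ?_
  · filter_upwards [hsmall.eventually (ge_mem_nhds zero_lt_one)] with z hz
    have hi : ∀ z, IntervalIntegrable (fun t => u z t * g t) volume 0 x := fun z =>
      ((h.left z).continuous.mul hg).intervalIntegrable _ _
    rw [← intervalIntegral.integral_sub (hi z) (hi z₀)]
    simp_rw [← sub_mul]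
    exact norm_integral_mul_le hx le_rfl (by positivity) hG0
      (h.norm_sub_le_of_bound hx (fun t a b => hP t ⟨a, b⟩) (fun t a b => hQ t ⟨a, b⟩) hz)
      fun t a b => hG t ⟨a, b⟩
  · simpa using ((hdist.const_mul (4 * (x * P * P * Q))).mul_const G).const_mul x

theorem differentiable_apply (h : IsSolutionFamily V u v) {x : ℝ} (hx : 0 ≤ x) :
    Differentiable ℂ fun z => u z x := by
  refine differentiable_of_eq_add_sub_mul
    (g := fun z₀ z => (∫ t in (0 : ℝ)..x, u z t * v z₀ t) * u z₀ x
      - (∫ t in (0 : ℝ)..x, u z t * u z₀ t) * v z₀ x) (fun z₀ z => ?_) fun z₀ => ?_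
  · rw [h.variation z z₀ x]
    ring
  · exact ((h.tendsto_integral_mul z₀ hx (h.right z₀).continuous).mul_const _).sub
      ((h.tendsto_integral_mul z₀ hx (h.left z₀).continuous).mul_const _)

theorem differentiable_deriv_apply (h : IsSolutionFamily V u v) {x : ℝ} (hx : 0 ≤ x) :
    Differentiable ℂ fun z => deriv (u z) x := by
  refine differentiable_of_eq_add_sub_mul
    (g := fun z₀ z => (∫ t in (0 : ℝ)..x, u z t * v z₀ t) * deriv (u z₀) x
      - (∫ t in (0 : ℝ)..x, u z t * u z₀ t) * deriv (v z₀) x) (fun z₀ z => ?_) fun z₀ => ?_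
  · rw [h.variation_deriv z z₀ x]
    ring
  · exact ((h.tendsto_integral_mul z₀ hx (h.right z₀).continuous).mul_const _).sub
      ((h.tendsto_integral_mul z₀ hx (h.left z₀).continuous).mul_const _)

end IsSolutionFamily

/-! ### Gluing solutions across the edges of the truncated potential -/

theorem hasDerivAt_of_eq_left_right {F f g : ℝ → ℂ} {d : ℂ} {a : ℝ} (hf : HasDerivAt f d a)
    (hg : HasDerivAt g d a) (hleft : ∀ x, x ≤ a → F x = f x) (hright : ∀ x, a ≤ x → F x = g x) :
    HasDerivAt F d a := by
  have hIic : HasDerivWithinAt F d (Iic a) a :=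
    hf.hasDerivWithinAt.congr (fun x hx => hleft x hx) (hleft a le_rfl)
  have hIci : HasDerivWithinAt F d (Ici a) a :=
    hg.hasDerivWithinAt.congr (fun x hx => hright x hx) (hright a le_rfl)
  simpa only [Iic_union_Ici, hasDerivWithinAt_univ] using hIic.union hIci

theorem hasDerivAt_ite_le {f g f' g' : ℝ → ℂ} {a : ℝ} (hf : ∀ x, HasDerivAt f (f' x) x)
    (hg : ∀ x, HasDerivAt g (g' x) x) (h : f a = g a) (h' : f' a = g' a) (x : ℝ) :
    HasDerivAt (fun x => if x ≤ a then f x else g x) (if x ≤ a then f' x else g' x) x := by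
  rcases lt_trichotomy x a with hx | rfl | hx
  · rw [if_pos hx.le]
    refine (hf x).congr_of_eventuallyEq ?_
    filter_upwards [Iio_mem_nhds hx] with t ht
    exact if_pos (le_of_lt ht)
  · rw [if_pos le_rfl]
    refine hasDerivAt_of_eq_left_right (hf x) (h' ▸ hg x) (fun t ht => if_pos ht) fun t ht => ?_
    rcases ht.eq_or_lt with rfl | ht
    · rw [if_pos le_rfl, h]
    · rw [if_neg (not_le.2 ht)]
  · rw [if_neg (not_le.2 hx)]
    refine (hg x).congr_of_eventuallyEq ?_
    filter_upwards [Ioi_mem_nhds hx] with t ht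
    exact if_neg (not_le.2 ht)

/-- The function equal to `w` on `(-M, M]` that continues as `h (x - M)` to the right of `M` and as
`ε h (-x - M)` to the left of `-M`; for `ε = ±1` it is even or odd if `w` is. -/
noncomputable def outerExtend (ε : ℂ) (M : ℝ) (w h : ℝ → ℂ) (x : ℝ) : ℂ :=
  if x ≤ -M then ε * h (-x - M) else if x ≤ M then w x else h (x - M)

section OuterExtend

variable {ε : ℂ} {M x : ℝ} {w w₁ h h₁ : ℝ → ℂ}

theorem outerExtend_of_gt (hM : 0 < M) (hx : M < x) : outerExtend ε M w h x = h (x - M) := by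
  rw [outerExtend, if_neg (by linarith), if_neg (by linarith)]

theorem outerExtend_of_le (hx : x ≤ -M) : outerExtend ε M w h x = ε * h (-x - M) :=
  if_pos hx

theorem outerExtend_of_mem (hx : x ∈ Ioc (-M) M) : outerExtend ε M w h x = w x := by
  rw [outerExtend, if_neg (not_le.2 hx.1), if_pos hx.2]

theorem outerExtend_zero (ε : ℂ) (M : ℝ) : outerExtend ε M 0 0 = 0 := by
  funext x
  simp [outerExtend]

theorem outerExtend_neg (hM : 0 < M) (hε : ε * ε = 1) (hw : ∀ x, w (-x) = ε * w x)
    (h0 : h 0 = w M) (x : ℝ) : outerExtend ε M w h (-x) = ε * outerExtend ε M w h x := by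
  rcases lt_trichotomy x M with hxM | rfl | hxM
  · rcases lt_trichotomy x (-M) with hx | rfl | hx
    · rw [outerExtend_of_le hx.le, outerExtend_of_gt hM (by linarith), ← mul_assoc, hε, one_mul]
    · rw [outerExtend_of_le le_rfl, neg_neg, outerExtend_of_mem ⟨by linarith, le_rfl⟩, sub_self,
        ← mul_assoc, hε, one_mul, h0]
    · rw [outerExtend_of_mem ⟨hx, hxM.le⟩, outerExtend_of_mem ⟨by linarith, by linarith⟩, hw]
  · rw [outerExtend_of_mem ⟨by linarith, le_rfl⟩, outerExtend_of_le le_rfl, neg_neg, sub_self, h0]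
  · rw [outerExtend_of_gt hM hxM, outerExtend_of_le (by linarith), neg_neg]

theorem hasDerivAt_comp_neg_sub_const {d : ℂ} (hh : HasDerivAt h d (-x - M)) :
    HasDerivAt (fun x => ε * h (-x - M)) (-ε * d) x :=
  ((hh.scomp x ((hasDerivAt_neg x).sub_const M)).const_mul ε).congr_deriv (by simp)

theorem hasDerivAt_outerExtend (hM : 0 < M) (hw : ∀ x, HasDerivAt w (w₁ x) x)
    (hh : ∀ x, HasDerivAt h (h₁ x) x) (hwε : ∀ x, w (-x) = ε * w x)
    (hw₁ε : ∀ x, w₁ (-x) = -ε * w₁ x) (h0 : h 0 = w M) (h0' : h₁ 0 = w₁ M) (x : ℝ) :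
    HasDerivAt (outerExtend ε M w h) (outerExtend (-ε) M w₁ h₁ x) x := by
  have hle : -M ≤ M := by linarith
  refine hasDerivAt_ite_le (fun x => hasDerivAt_comp_neg_sub_const (hh (-x - M)))
    (hasDerivAt_ite_le hw (fun x => (hh (x - M)).comp_sub_const x M) ?_ ?_) ?_ ?_ x
  · rw [sub_self, h0]
  · rw [sub_self, h0']
  · rw [neg_neg, sub_self, h0, if_pos hle, hwε]
  · rw [neg_neg, sub_self, h0', if_pos hle, hw₁ε]

theorem continuous_outerExtend (hM : 0 < M) (hw : Continuous w) (hh : Continuous h)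
    (hwε : ∀ x, w (-x) = ε * w x) (h0 : h 0 = w M) : Continuous (outerExtend ε M w h) := by
  refine Continuous.if_le (by fun_prop) (Continuous.if_le hw (by fun_prop) continuous_id
    continuous_const fun x hx => ?_) continuous_id continuous_const fun x hx => ?_
  · rw [hx, sub_self, h0]
  · rw [hx, if_pos (by linarith), neg_neg, sub_self, h0, hwε]

theorem hasDerivAt_outerExtend_of_gt {d : ℂ} (hM : 0 < M) (hx : M < x)
    (hh : HasDerivAt h d (x - M)) : HasDerivAt (outerExtend ε M w h) d x := by
  refine (hh.comp_sub_const x M).congr_of_eventuallyEq ?_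
  filter_upwards [Ioi_mem_nhds hx] with t ht
  exact outerExtend_of_gt hM ht

theorem hasDerivAt_outerExtend_of_lt {d : ℂ} (hx : x < -M) (hh : HasDerivAt h d (-x - M)) :
    HasDerivAt (outerExtend ε M w h) (-ε * d) x := by
  refine (hasDerivAt_comp_neg_sub_const hh).congr_of_eventuallyEq ?_
  filter_upwards [Iio_mem_nhds hx] with t ht
  exact outerExtend_of_le (le_of_lt ht)

theorem hasDerivAt_outerExtend_of_mem {d : ℂ} (hx : x ∈ Ioo (-M) M) (hw : HasDerivAt w d x) :
    HasDerivAt (outerExtend ε M w h) d x := by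
  refine hw.congr_of_eventuallyEq ?_
  filter_upwards [Ioo_mem_nhds hx.1 hx.2] with t ht
  exact outerExtend_of_mem ⟨ht.1, ht.2.le⟩

end OuterExtend

theorem truncate_of_abs_gt {V : ℝ → ℝ} {M x : ℝ} (hx : M < |x|) : truncate V M x = 0 :=
  if_neg (not_le.2 hx)

theorem truncate_of_abs_le {V : ℝ → ℝ} {M x : ℝ} (hx : |x| ≤ M) : truncate V M x = V x :=
  if_pos hx

theorem abs_truncate_le (V : ℝ → ℝ) (M x : ℝ) : |truncate V M x| ≤ |V x| := by
  rw [truncate]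
  split_ifs
  · exact le_rfl
  · rw [abs_zero]
    exact abs_nonneg _

theorem truncate_eq_indicator (V : ℝ → ℝ) (M : ℝ) :
    truncate V M = (Icc (-M) M).indicator V := by
  funext x
  simp only [truncate, indicator, mem_Icc, abs_le]

theorem intervalIntegrable_truncate {V : ℝ → ℝ} (hV : Continuous V) (M a b : ℝ) :
    IntervalIntegrable (fun x => (truncate V M x : ℂ)) volume a b := by
  have hint : Integrable (truncate V M) := by
    rw [truncate_eq_indicator]
    exact (hV.integrableOn_Icc).integrable_indicator measurableSet_Icc
  exact hint.ofReal.intervalIntegrable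

/-- The exterior function `h` may have a corner in its derivative at one point `b`, where its
source `φ` may jump. -/
theorem solvesSchrodinger_outerExtend {V : ℝ → ℝ} {z ε : ℂ} {M b : ℝ} {w w₁ h h₁ φ : ℝ → ℂ}
    (hV : Continuous V) (hM : 0 < M) (hw : IsClassicalSolution V z w w₁)
    (hh : ∀ x, HasDerivAt h (h₁ x) x) (hh₁c : Continuous h₁)
    (hh₁ : ∀ y, 0 < y → y ≠ b → HasDerivAt h₁ (-z * h y - φ y) y)
    (hwε : ∀ x, w (-x) = ε * w x) (hw₁ε : ∀ x, w₁ (-x) = -ε * w₁ x)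
    (h0 : h 0 = w M) (h0' : h₁ 0 = w₁ M)
    (hφ : ∀ c d, IntervalIntegrable (outerExtend ε M 0 φ) volume c d) :
    SolvesSchrodinger (truncate V M) z (outerExtend ε M 0 φ) (outerExtend ε M w h) := by
  have hderiv := hasDerivAt_outerExtend hM (fun x => (hw x).1) hh hwε hw₁ε h0 h0'
  have hcont : Continuous (outerExtend ε M w h) :=
    continuous_iff_continuousAt.2 fun x => (hderiv x).continuousAt
  refine .of_hasDerivAt (s := {M, -M, M + b, -M - b}) (Set.toFinite _).countable hderiv
    (continuous_outerExtend hM hw.continuous_snd hh₁c hw₁ε h0') (fun c d =>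
      (((intervalIntegrable_truncate hV M c d).sub intervalIntegrable_const).mul_continuousOn
        hcont.continuousOn).sub (hφ c d)) fun x hx => ?_
  simp only [mem_insert_iff, mem_singleton_iff, not_or] at hx
  obtain ⟨hxM, hxM', hxb, hxb'⟩ := hx
  rcases lt_or_gt_of_ne hxM with hlt | hgt
  · rcases lt_or_gt_of_ne hxM' with hlt' | hgt'
    · rw [outerExtend_of_le hlt'.le, outerExtend_of_le hlt'.le,
        truncate_of_abs_gt (by rw [abs_of_neg (by linarith)]; linarith)]
      refine (hasDerivAt_outerExtend_of_lt hlt'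
        (hh₁ (-x - M) (by linarith) fun hb => hxb' (by linarith))).congr_deriv ?_
      push_cast
      ring
    · rw [outerExtend_of_mem ⟨hgt', hlt.le⟩, outerExtend_of_mem ⟨hgt', hlt.le⟩,
        truncate_of_abs_le (abs_le.2 ⟨hgt'.le, hlt.le⟩), Pi.zero_apply, sub_zero]
      exact hasDerivAt_outerExtend_of_mem ⟨hgt', hlt⟩ (hw x).2
  · rw [outerExtend_of_gt hM hgt, outerExtend_of_gt hM hgt,
      truncate_of_abs_gt (by rwa [abs_of_pos (by linarith)]), Complex.ofReal_zero, zero_sub]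
    exact hasDerivAt_outerExtend_of_gt hM hgt
      (hh₁ (x - M) (by linarith) fun hb => hxb (by linarith))

/-! ### Resonant states -/

theorem csqrt_sq (z : ℂ) : csqrt z ^ 2 = z := by
  rw [csqrt, ← Complex.cpow_nat_mul]
  simp

theorem hasDerivAt_exp_mul (a : ℂ) (x : ℝ) :
    HasDerivAt (fun x : ℝ => Complex.exp (a * x)) (a * Complex.exp (a * x)) x := by
  have h := ((hasDerivAt_id x).ofReal_comp.const_mul a).cexp
  simpa [mul_comm] using h

/-- The solution `w` on `[-M, M]`, continued to `ℝ` by multiples of the outgoing exponential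
`e^{iζ|x|}`. -/
noncomputable def outgoingState (ε ζ : ℂ) (M : ℝ) (w : ℝ → ℂ) : ℝ → ℂ :=
  outerExtend ε M w fun y => w M * Complex.exp (Complex.I * ζ * y)

theorem outgoingState_neg {ε ζ : ℂ} {M : ℝ} {w : ℝ → ℂ} (hM : 0 < M) (hε : ε * ε = 1)
    (hw : ∀ x, w (-x) = ε * w x) (x : ℝ) :
    outgoingState ε ζ M w (-x) = ε * outgoingState ε ζ M w x :=
  outerExtend_neg hM hε hw (by simp) x

theorem solvesSchrodinger_outgoingState {V : ℝ → ℝ} {ζ ε : ℂ} {M : ℝ} {w w₁ : ℝ → ℂ}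
    (hV : Continuous V) (hM : 0 < M) (hw : IsClassicalSolution V (ζ ^ 2) w w₁)
    (hwε : ∀ x, w (-x) = ε * w x) (hw₁ε : ∀ x, w₁ (-x) = -ε * w₁ x)
    (hout : w₁ M = Complex.I * ζ * w M) :
    SolvesSchrodinger (truncate V M) (ζ ^ 2) 0 (outgoingState ε ζ M w) := by
  rw [← outerExtend_zero ε M]
  refine solvesSchrodinger_outerExtend (b := 0)
    (h₁ := fun y => w M * (Complex.I * ζ * Complex.exp (Complex.I * ζ * y))) hV hM hw
    (fun x => (hasDerivAt_exp_mul _ x).const_mul _) (by fun_prop) (fun y _ _ => ?_) hwε hw₁ε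
    (by simp) (by simp [hout, mul_comm]) fun c d => ?_
  · refine (((hasDerivAt_exp_mul (Complex.I * ζ) y).const_mul (Complex.I * ζ)).const_mul
      (w M)).congr_deriv ?_
    rw [Pi.zero_apply]
    linear_combination w M * ζ ^ 2 * Complex.exp (Complex.I * ζ * y) * Complex.I_sq
  · rw [outerExtend_zero]
    exact intervalIntegrable_const

theorem isResonantState_outgoingState {V : ℝ → ℝ} {z ε : ℂ} {M : ℝ} {w w₁ : ℝ → ℂ}
    (hV : Continuous V) (hM : 0 < M) (hw : IsClassicalSolution V z w w₁)
    (hwε : ∀ x, w (-x) = ε * w x) (hw₁ε : ∀ x, w₁ (-x) = -ε * w₁ x)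
    (hout : w₁ M = Complex.I * csqrt z * w M) (hne : w M ≠ 0) :
    IsResonantState (truncate V M) z (outgoingState ε (csqrt z) M w) := by
  refine ⟨fun h => hne ?_, ?_, M, w M * Complex.exp (-(Complex.I * csqrt z * M)),
    ε * (w M * Complex.exp (-(Complex.I * csqrt z * M))), fun x hx => ?_, fun x hx => ?_⟩
  · simpa only [outgoingState, outerExtend_of_mem (x := M) ⟨by linarith, le_rfl⟩,
      Pi.zero_apply] using congrFun h M
  · simpa only [csqrt_sq] using
      solvesSchrodinger_outgoingState hV hM ((csqrt_sq z).symm ▸ hw) hwε hw₁ε hout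
  · rw [outgoingState, outerExtend_of_gt hM hx, mul_assoc (w M), ← Complex.exp_add]
    push_cast
    ring_nf
  · rw [outgoingState, outerExtend_of_le hx.le, mul_assoc ε, mul_assoc (w M), ← Complex.exp_add]
    push_cast
    ring_nf

/-- Two outgoing solutions agree, up to a factor, near `+∞`, hence everywhere. -/
theorem IsResonantState.eq_const_mul_outgoingState {V : ℝ → ℝ} {z ε : ℂ} {M : ℝ} {w Ψ : ℝ → ℂ}
    (hV : Continuous V) (hM : 0 < M) (hne : w M ≠ 0)
    (hw : SolvesSchrodinger (truncate V M) z 0 (outgoingState ε (csqrt z) M w))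
    (hΨ : IsResonantState (truncate V M) z Ψ) :
    ∃ c : ℂ, ∀ x, Ψ x = c * outgoingState ε (csqrt z) M w x := by
  obtain ⟨-, hΨ, R, a, -, ha, -⟩ := hΨ
  set c := a * Complex.exp (Complex.I * csqrt z * M) / w M with hc
  have hout : ∀ x, max R M < x → Ψ x - c * outgoingState ε (csqrt z) M w x = 0 := by
    intro x hx
    have hexp : Complex.exp (Complex.I * csqrt z * x) = Complex.exp (Complex.I * csqrt z * M) *
        Complex.exp (Complex.I * csqrt z * ((x - M : ℝ) : ℂ)) := by
      rw [← Complex.exp_add]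
      push_cast
      ring_nf
    rw [ha x ((le_max_left _ _).trans_lt hx), outgoingState,
      outerExtend_of_gt hM ((le_max_right _ _).trans_lt hx), hc, hexp]
    field_simp
    ring
  have hlt : max R M < max R M + 1 := lt_add_one _
  have hlocal : (fun x => Ψ x - c * outgoingState ε (csqrt z) M w x)
      =ᶠ[𝓝 (max R M + 1)] fun _ => 0 := by
    filter_upwards [Ioi_mem_nhds hlt] with t ht
    exact hout t ht
  have hbound : ∀ a b, ∃ K, ∀ x ∈ Icc a b, |truncate V M x| ≤ K := fun a b =>
    (exists_abs_le_on_Icc_of_continuous hV a b).imp fun _ hK x hx =>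
      (abs_truncate_le V M x).trans (hK x hx)
  exact ⟨c, fun x => sub_eq_zero.1 ((hΨ.sub_const_mul hw c).eq_zero hbound (hout _ hlt)
    (by rw [hlocal.deriv_eq, deriv_const]) x)⟩

/-! ### Poles of the continued resolvent -/

theorem memLp_two_of_isBigO_exp {W : ℝ → ℂ} {η : ℝ} (hW : Continuous W) (hη : 0 < η)
    (hbot : W =O[atBot] fun x => Real.exp (η * x))
    (htop : W =O[atTop] fun x => Real.exp (-η * x)) : MemLp W 2 volume := by
  have hsq : ∀ c x : ℝ, Real.exp (c * x) ^ 2 = Real.exp (2 * c * x) := fun c x => by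
    rw [← Real.exp_nat_mul]
    push_cast
    ring_nf
  rw [memLp_two_iff_integrable_sq_norm hW.aestronglyMeasurable]
  refine (hW.norm.pow 2).locallyIntegrable.integrable_of_isBigO_atBot_atTop
    (g := fun x => Real.exp (2 * η * x)) (g' := fun x => Real.exp (2 * -η * x))
    ?_ ⟨Iic 0, Iic_mem_atBot 0, integrableOn_exp_mul_Iic (by positivity) 0⟩
    ?_ ⟨Ioi 0, Ioi_mem_atTop 0, integrableOn_exp_mul_Ioi (by linarith) 0⟩
  · simpa only [hsq] using hbot.norm_left.pow 2
  · simpa only [hsq] using htop.norm_left.pow 2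

theorem isBigO_exp_of_eq_exp {W : ℝ → ℂ} {ζ β : ℂ} {M : ℝ} {l : Filter ℝ} {s : ℝ → ℝ}
    (h : ∀ᶠ x in l, W x = β * Complex.exp (Complex.I * ζ * ((s x - M : ℝ) : ℂ))) :
    W =O[l] fun x => Real.exp (-ζ.im * s x) := by
  refine .of_bound (‖β‖ * Real.exp (ζ.im * M)) ?_
  filter_upwards [h] with x hx
  rw [hx, norm_mul, Complex.norm_exp, Real.norm_of_nonneg (Real.exp_pos _).le, mul_assoc ‖β‖,
    ← Real.exp_add]
  refine le_of_eq ?_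
  congr 2
  simp only [Complex.mul_re, Complex.mul_im, Complex.I_re, Complex.I_im, Complex.ofReal_re,
    Complex.ofReal_im]
  ring

namespace IsClassicalSolution

variable {V : ℝ → ℝ} {ζ : ℂ} {M : ℝ} {w w₁ : ℝ → ℂ}

theorem normSq_mul_re_add_integral_eq_zero (h : IsClassicalSolution V (ζ ^ 2) w w₁)
    (h0 : w 0 * starRingEnd ℂ (w₁ 0) - w₁ 0 * starRingEnd ℂ (w 0) = 0)
    (hout : w₁ M = Complex.I * ζ * w M) :
    Complex.normSq (w M) * ζ.re
      + 2 * ζ.re * ζ.im * ∫ t in (0 : ℝ)..M, Complex.normSq (w t) = 0 := by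
  have hwronskian := h.wronskian_sub h.conj 0 M
  have hintegral : ∫ t in (0 : ℝ)..M, w t * starRingEnd ℂ (w t)
      = ((∫ t in (0 : ℝ)..M, Complex.normSq (w t) : ℝ) : ℂ) := by
    rw [← intervalIntegral.integral_ofReal]
    simp only [Complex.mul_conj]
  have hboundary : w M * starRingEnd ℂ (Complex.I * ζ * w M)
      - Complex.I * ζ * w M * starRingEnd ℂ (w M)
      = (Complex.normSq (w M) : ℂ) * (-2 * Complex.I * ζ.re) := by
    have hre := Complex.add_conj ζ
    push_cast at hre
    rw [← Complex.mul_conj, map_mul, map_mul, Complex.conj_I]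
    linear_combination (-Complex.I * w M * starRingEnd ℂ (w M)) * hre
  have hspectral : ζ ^ 2 - starRingEnd ℂ (ζ ^ 2) = 4 * Complex.I * ζ.re * ζ.im := by
    conv_lhs => rw [← Complex.re_add_im ζ]
    simp only [map_pow, map_add, map_mul, Complex.conj_ofReal, Complex.conj_I]
    ring
  rw [h0, hout, hintegral, hboundary, hspectral] at hwronskian
  have hI : (-2 * Complex.I : ℂ) ≠ 0 := by simp
  rw [← Complex.ofReal_eq_zero]
  push_cast
  refine mul_left_cancel₀ hI ?_
  linear_combination hwronskian

/-- Otherwise `ζ ^ 2` would be a nonreal eigenvalue of a self-adjoint operator. -/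
theorem ne_outgoing (h : IsClassicalSolution V (ζ ^ 2) w w₁) (hM : 0 < M) (hre : 0 < ζ.re)
    (him : 0 < ζ.im) (h0 : w 0 * starRingEnd ℂ (w₁ 0) - w₁ 0 * starRingEnd ℂ (w 0) = 0)
    (hne : w M ≠ 0 ∨ w₁ M ≠ 0) : w₁ M - Complex.I * ζ * w M ≠ 0 := by
  intro hsub
  have hout : w₁ M = Complex.I * ζ * w M := sub_eq_zero.1 hsub
  have hidentity := h.normSq_mul_re_add_integral_eq_zero h0 hout
  have hintegral : 0 ≤ ∫ t in (0 : ℝ)..M, Complex.normSq (w t) :=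
    intervalIntegral.integral_nonneg hM.le fun t _ => Complex.normSq_nonneg _
  have hnonneg : 0 ≤ 2 * ζ.re * ζ.im * ∫ t in (0 : ℝ)..M, Complex.normSq (w t) := by positivity
  have hzero : w M = 0 := by
    have hpos := Complex.normSq_nonneg (w M)
    exact Complex.normSq_eq_zero.1 (le_antisymm (by nlinarith) hpos)
  exact hne.elim (fun hw => hw hzero) fun hw₁ => hw₁ (by rw [hout, hzero, mul_zero])

end IsClassicalSolution

/-- The source term `1` on `(-∞, 1]`, placed just outside the support of the potential to detect
the poles of the resolvent. -/
noncomputable def unitPulse (y : ℝ) : ℂ := if y ≤ 1 then 1 else 0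

/-- The solution of `-p'' - ζ² p = unitPulse` that vanishes on `[1, ∞)`. -/
noncomputable def pulseResponse (ζ : ℂ) (y : ℝ) : ℂ :=
  if y ≤ 1 then (Complex.cos (ζ * ((y - 1 : ℝ) : ℂ)) - 1) / ζ ^ 2 else 0

/-- The derivative of `pulseResponse ζ`. -/
noncomputable def pulseResponseDeriv (ζ : ℂ) (y : ℝ) : ℂ :=
  if y ≤ 1 then -Complex.sin (ζ * ((y - 1 : ℝ) : ℂ)) / ζ else 0

/-- The integral of `e^{iζy}` over `[0, 1]`. -/
noncomputable def pulseTransform (ζ : ℂ) : ℂ :=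
  (Complex.exp (Complex.I * ζ) - 1) / (Complex.I * ζ)

/-- The part of the resolvent matrix element in the pulse that has no pole off `0`. -/
noncomputable def pulseRemainder (ζ : ℂ) : ℂ :=
  pulseTransform ζ * ((1 - Complex.cos ζ) / ζ ^ 2) + (Complex.sin ζ / ζ - 1) / ζ ^ 2

section Pulse

variable {ε ζ : ℂ} {M : ℝ}

theorem hasDerivAt_cos_mul (ζ : ℂ) (y : ℝ) :
    HasDerivAt (fun y : ℝ => Complex.cos (ζ * ((y - 1 : ℝ) : ℂ)))
      (-Complex.sin (ζ * ((y - 1 : ℝ) : ℂ)) * ζ) y := by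
  have hlin : HasDerivAt (fun t : ℝ => ζ * ((t - 1 : ℝ) : ℂ)) ζ y := by
    simpa using ((hasDerivAt_id y).sub_const 1).ofReal_comp.const_mul ζ
  exact (Complex.hasDerivAt_cos _).comp y hlin

theorem hasDerivAt_sin_mul (ζ : ℂ) (y : ℝ) :
    HasDerivAt (fun y : ℝ => Complex.sin (ζ * ((y - 1 : ℝ) : ℂ)))
      (Complex.cos (ζ * ((y - 1 : ℝ) : ℂ)) * ζ) y := by
  have hlin : HasDerivAt (fun t : ℝ => ζ * ((t - 1 : ℝ) : ℂ)) ζ y := by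
    simpa using ((hasDerivAt_id y).sub_const 1).ofReal_comp.const_mul ζ
  exact (Complex.hasDerivAt_sin _).comp y hlin

theorem hasDerivAt_pulseResponse (hζ : ζ ≠ 0) (y : ℝ) :
    HasDerivAt (pulseResponse ζ) (pulseResponseDeriv ζ y) y := by
  have hleft : ∀ y : ℝ, HasDerivAt (fun y : ℝ => (Complex.cos (ζ * ((y - 1 : ℝ) : ℂ)) - 1) / ζ ^ 2)
      (-Complex.sin (ζ * ((y - 1 : ℝ) : ℂ)) / ζ) y := fun y =>
    (((hasDerivAt_cos_mul ζ y).sub_const 1).div_const (ζ ^ 2)).congr_deriv (by field_simp)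
  exact hasDerivAt_ite_le hleft (fun y => hasDerivAt_const y 0) (by simp) (by simp) y

theorem continuous_pulseResponseDeriv : Continuous (pulseResponseDeriv ζ) := by
  refine Continuous.if_le (by fun_prop) continuous_const continuous_id continuous_const
    fun y hy => ?_
  rw [show y = 1 from hy]
  simp

theorem hasDerivAt_pulseResponseDeriv (hζ : ζ ≠ 0) {y : ℝ} (hy : y ≠ 1) :
    HasDerivAt (pulseResponseDeriv ζ) (-ζ ^ 2 * pulseResponse ζ y - unitPulse y) y := by
  rcases lt_or_gt_of_ne hy with hlt | hgt
  · refine HasDerivAt.congr_of_eventuallyEq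
      (((hasDerivAt_sin_mul ζ y).neg.div_const ζ).congr_deriv ?_) ?_
    · rw [pulseResponse, unitPulse, if_pos hlt.le, if_pos hlt.le]
      field_simp
      ring
    · filter_upwards [Iio_mem_nhds hlt] with t ht
      exact if_pos (le_of_lt ht)
  · rw [pulseResponse, unitPulse, if_neg (not_le.2 hgt), if_neg (not_le.2 hgt), mul_zero, sub_zero]
    refine (hasDerivAt_const y 0).congr_of_eventuallyEq ?_
    filter_upwards [Ioi_mem_nhds hgt] with t ht
    exact if_neg (not_le.2 ht)

theorem integral_pulseResponse (hζ : ζ ≠ 0) :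
    ∫ y in (0 : ℝ)..1, pulseResponse ζ y = (Complex.sin ζ / ζ - 1) / ζ ^ 2 := by
  have hcongr : ∫ y in (0 : ℝ)..1, pulseResponse ζ y
      = ∫ y in (0 : ℝ)..1, (Complex.cos (ζ * ((y - 1 : ℝ) : ℂ)) - 1) / ζ ^ 2 :=
    intervalIntegral.integral_congr fun y hy => if_pos (by
      rw [uIcc_of_le zero_le_one] at hy
      exact hy.2)
  have hcos : ∫ y in (0 : ℝ)..1, Complex.cos (ζ * ((y - 1 : ℝ) : ℂ)) = Complex.sin ζ / ζ := by
    rw [intervalIntegral.integral_comp_sub_right (fun y : ℝ => Complex.cos (ζ * (y : ℂ))),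
      integral_cos_mul_complex hζ]
    simp [neg_div]
  rw [hcongr, intervalIntegral.integral_div, intervalIntegral.integral_sub
    (Continuous.intervalIntegrable (by fun_prop) _ _) intervalIntegrable_const, hcos]
  simp

theorem integral_exp_eq_pulseTransform (hζ : ζ ≠ 0) :
    ∫ y in (0 : ℝ)..1, Complex.exp (Complex.I * ζ * y) = pulseTransform ζ := by
  rw [integral_exp_mul_complex (mul_ne_zero Complex.I_ne_zero hζ), pulseTransform]
  simp

theorem pulseTransform_eq (hζ : ζ ≠ 0) :
    pulseTransform ζ = Complex.sin ζ / ζ + Complex.I * ((1 - Complex.cos ζ) / ζ) := by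
  have hI := Complex.I_ne_zero
  rw [pulseTransform, mul_comm Complex.I ζ, Complex.exp_mul_I]
  field_simp
  linear_combination (Complex.cos ζ - 1) * Complex.I_sq

theorem outerExtend_unitPulse (ε : ℂ) (hM : 0 < M) :
    outerExtend ε M 0 unitPulse = fun x => (Ioc M (M + 1)).indicator (fun _ => (1 : ℂ)) x
      + (Icc (-M - 1) (-M)).indicator (fun _ => ε) x := by
  funext x
  rcases lt_or_ge M x with hgt | hle
  · rw [outerExtend_of_gt hM hgt, indicator_of_notMem (s := Icc _ _)
      (fun h => by linarith [h.2]), add_zero]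
    simp only [unitPulse, indicator, mem_Ioc, hgt, true_and, sub_le_iff_le_add, add_comm]
  rw [indicator_of_notMem (s := Ioc _ _) (fun h => by linarith [h.1]), zero_add]
  rcases le_or_gt x (-M) with hle' | hgt'
  · have hiff : -x - M ≤ 1 ↔ -M - 1 ≤ x := by constructor <;> intro <;> linarith
    simp only [outerExtend_of_le hle', unitPulse, indicator, mem_Icc, hle', and_true, hiff,
      mul_ite, mul_one, mul_zero]
  · rw [outerExtend_of_mem ⟨hgt', hle⟩, indicator_of_notMem (fun h => by linarith [h.2])]
    rfl

theorem memLp_outerExtend_unitPulse (ε : ℂ) (hM : 0 < M) :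
    MemLp (outerExtend ε M 0 unitPulse) 2 volume := by
  have hindicator : ∀ (s : Set ℝ) (c : ℂ), MeasurableSet s → volume s ≠ ⊤ →
      MemLp (s.indicator fun _ => c) 2 volume := fun s c hs hs' =>
    memLp_indicator_const 2 hs c (.inr hs')
  rw [outerExtend_unitPulse ε hM]
  exact (hindicator _ _ measurableSet_Ioc (by simp)).add
    (hindicator _ _ measurableSet_Icc (by simp))

theorem hasCompactSupport_outerExtend_unitPulse (ε : ℂ) (hM : 0 < M) :
    HasCompactSupport (outerExtend ε M 0 unitPulse) := by
  rw [outerExtend_unitPulse ε hM]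
  refine HasCompactSupport.intro (isCompact_Icc (a := -M - 1) (b := M + 1)) fun x hx => ?_
  rw [indicator_of_notMem fun hx' => hx ⟨by linarith [hx'.1], hx'.2⟩,
    indicator_of_notMem fun hx' => hx ⟨hx'.1, by linarith [hx'.2]⟩, add_zero]

theorem intervalIntegrable_outerExtend_unitPulse (ε : ℂ) (hM : 0 < M) (a b : ℝ) :
    IntervalIntegrable (outerExtend ε M 0 unitPulse) volume a b := by
  rw [outerExtend_unitPulse ε hM]
  exact (((integrable_indicator_iff measurableSet_Ioc).2 (by simp)).add
    ((integrable_indicator_iff measurableSet_Icc).2 (by simp))).intervalIntegrable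

theorem integral_indicator_mul_outerExtend (hM : 0 < M) (w h : ℝ → ℂ) :
    ∫ x, (Ioc M (M + 1)).indicator (fun _ => (1 : ℂ)) x * outerExtend ε M w h x
      = ∫ y in (0 : ℝ)..1, h y := by
  have hcongr : (fun x => (Ioc M (M + 1)).indicator (fun _ => (1 : ℂ)) x * outerExtend ε M w h x)
      = (Ioc M (M + 1)).indicator fun x => h (x - M) := by
    funext x
    by_cases hx : x ∈ Ioc M (M + 1)
    · simp [hx, outerExtend_of_gt hM hx.1]
    · simp [hx]
  rw [hcongr, integral_indicator measurableSet_Ioc,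
    ← intervalIntegral.integral_of_le (by linarith), intervalIntegral.integral_comp_sub_right,
    sub_self, add_sub_cancel_left]

end Pulse

theorem memLp_outerExtend_of_eq_exp {ε ζ β : ℂ} {M : ℝ} {w h : ℝ → ℂ} (hM : 0 < M)
    (him : 0 < ζ.im) (hcont : Continuous (outerExtend ε M w h))
    (hh : ∀ y, 1 < y → h y = β * Complex.exp (Complex.I * ζ * y)) :
    MemLp (outerExtend ε M w h) 2 volume := by
  refine memLp_two_of_isBigO_exp hcont him ?_ ?_
  · have hleft : ∀ᶠ x in atBot, outerExtend ε M w h x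
        = ε * β * Complex.exp (Complex.I * ζ * ((-x - M : ℝ) : ℂ)) := by
      filter_upwards [Iio_mem_atBot (-M - 1)] with x (hx : x < -M - 1)
      rw [outerExtend_of_le (by linarith), hh _ (by linarith), mul_assoc ε]
    simpa only [neg_mul_neg] using isBigO_exp_of_eq_exp hleft
  · have hright : ∀ᶠ x in atTop, outerExtend ε M w h x
        = β * Complex.exp (Complex.I * ζ * ((x - M : ℝ) : ℂ)) := by
      filter_upwards [Ioi_mem_atTop (M + 1)] with x (hx : M + 1 < x)
      rw [outerExtend_of_gt hM (by linarith), hh _ (by linarith)]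
    exact isBigO_exp_of_eq_exp hright

theorem IsClassicalSolution.solvesSchrodinger_outerExtend_pulseResponse {V : ℝ → ℝ} {ε ζ β : ℂ}
    {M : ℝ} {w w₁ : ℝ → ℂ} (hw : IsClassicalSolution V (ζ ^ 2) w w₁) (hV : Continuous V)
    (hM : 0 < M) (hζ : ζ ≠ 0) (hwε : ∀ x, w (-x) = ε * w x) (hw₁ε : ∀ x, w₁ (-x) = -ε * w₁ x)
    (hβ : β = w M + (1 - Complex.cos ζ) / ζ ^ 2)
    (hJ : w₁ M - Complex.I * ζ * w M = pulseTransform ζ) :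
    SolvesSchrodinger (truncate V M) (ζ ^ 2) (outerExtend ε M 0 unitPulse)
      (outerExtend ε M w fun y => β * Complex.exp (Complex.I * ζ * y) + pulseResponse ζ y) := by
  refine solvesSchrodinger_outerExtend (b := 1) hV hM hw
    (fun y => ((hasDerivAt_exp_mul _ y).const_mul β).add (hasDerivAt_pulseResponse hζ y))
    (Continuous.add (by fun_prop) continuous_pulseResponseDeriv) (fun y _ hy => ?_) hwε hw₁ε ?_ ?_
    (intervalIntegrable_outerExtend_unitPulse ε hM)
  · refine ((((hasDerivAt_exp_mul (Complex.I * ζ) y).const_mul (Complex.I * ζ)).const_mul β).add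
      (hasDerivAt_pulseResponseDeriv hζ hy)).congr_deriv ?_
    linear_combination β * ζ ^ 2 * Complex.exp (Complex.I * ζ * y) * Complex.I_sq
  · simp only [hβ, pulseResponse, zero_le_one, if_true, zero_sub, Complex.ofReal_neg,
      Complex.ofReal_one, mul_neg, mul_one, Complex.cos_neg, Complex.ofReal_zero, mul_zero,
      Complex.exp_zero]
    ring
  · rw [pulseTransform_eq hζ] at hJ
    simp only [hβ, pulseResponseDeriv, zero_le_one, if_true, zero_sub, Complex.ofReal_neg,
      Complex.ofReal_one, mul_neg, mul_one, Complex.sin_neg, neg_neg, Complex.ofReal_zero, mul_zero,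
      Complex.exp_zero]
    field_simp at hJ ⊢
    linear_combination -hJ

/-- The solution is a multiple of `w` on `[-M, M]`; outside it is an outgoing exponential plus the
pulse response, and matching the two at `M` fixes both coefficients. -/
theorem IsClassicalSolution.exists_isResolventImage {V : ℝ → ℝ} {ε ζ : ℂ} {M : ℝ} {w w₁ : ℝ → ℂ}
    (hw : IsClassicalSolution V (ζ ^ 2) w w₁) (hV : Continuous V) (hM : 0 < M) (him : 0 < ζ.im)
    (hwε : ∀ x, w (-x) = ε * w x) (hw₁ε : ∀ x, w₁ (-x) = -ε * w₁ x)
    (hD : w₁ M - Complex.I * ζ * w M ≠ 0) :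
    ∃ W, IsResolventImage (truncate V M) (ζ ^ 2) (outerExtend ε M 0 unitPulse) W ∧
      pulseTransform ζ ^ 2 * w M / (w₁ M - Complex.I * ζ * w M) + pulseRemainder ζ
        = ∫ x, (Ioc M (M + 1)).indicator (fun _ => (1 : ℂ)) x * W x := by
  have hζ : ζ ≠ 0 := by
    rintro rfl
    exact him.ne rfl
  set c := pulseTransform ζ / (w₁ M - Complex.I * ζ * w M) with hc
  set β := c * w M + (1 - Complex.cos ζ) / ζ ^ 2 with hβ
  have hcD : c * (w₁ M - Complex.I * ζ * w M) = pulseTransform ζ := div_mul_cancel₀ _ hD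
  have hsol := (hw.const_mul c).solvesSchrodinger_outerExtend_pulseResponse (ε := ε) hV hM hζ
    (fun x => by rw [hwε]; ring) (fun x => by rw [hw₁ε]; ring) hβ (by rw [← hcD]; ring)
  refine ⟨_, ⟨memLp_outerExtend_of_eq_exp (β := β) hM him hsol.1.continuous fun y hy => ?_, hsol⟩,
    ?_⟩
  · rw [pulseResponse, if_neg (not_le.2 hy), add_zero]
  · rw [integral_indicator_mul_outerExtend hM, intervalIntegral.integral_add
      (Continuous.intervalIntegrable (by fun_prop) _ _) (Continuous.intervalIntegrable
        (continuous_iff_continuousAt.2 fun y => (hasDerivAt_pulseResponse hζ y).continuousAt) _ _),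
      intervalIntegral.integral_const_mul, integral_exp_eq_pulseTransform hζ,
      integral_pulseResponse hζ, pulseRemainder, hβ, hc]
    ring

theorem meromorphicOrderAt_div_add_neg {N D G : ℂ → ℂ} {z : ℂ} (hN : AnalyticAt ℂ N z)
    (hNz : N z ≠ 0) (hD : AnalyticAt ℂ D z) (hDz : D z = 0) (hDne : ¬∀ᶠ ζ in 𝓝 z, D ζ = 0)
    (hG : AnalyticAt ℂ G z) : meromorphicOrderAt (N / D + G) z < 0 := by
  have hN0 : meromorphicOrderAt N z = 0 := by
    rw [hN.meromorphicOrderAt_eq, hN.analyticOrderAt_eq_zero.2 hNz]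
    rfl
  obtain ⟨n, hn⟩ := ENat.ne_top_iff_exists.1 fun htop => hDne (analyticOrderAt_eq_top.1 htop)
  have hn0 : n ≠ 0 := by
    rintro rfl
    exact hD.analyticOrderAt_eq_zero.1 hn.symm hDz
  have hdiv : meromorphicOrderAt (N / D) z < 0 := by
    rw [div_eq_mul_inv, meromorphicOrderAt_mul hN.meromorphicAt hD.meromorphicAt.inv, hN0, zero_add,
      meromorphicOrderAt_inv, hD.meromorphicOrderAt_eq, ← hn]
    change ((-(n : ℤ) : ℤ) : WithTop ℤ) < 0
    exact_mod_cast neg_neg_of_pos (Int.natCast_pos.2 (Nat.pos_of_ne_zero hn0))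
  rwa [meromorphicOrderAt_add_eq_left_of_lt hG.meromorphicAt
    (hdiv.trans_le hG.meromorphicOrderAt_nonneg)]

theorem analyticAt_pulseTransform {ζ : ℂ} (hζ : ζ ≠ 0) : AnalyticAt ℂ pulseTransform ζ := by
  unfold pulseTransform
  have hIζ := mul_ne_zero Complex.I_ne_zero hζ
  fun_prop (disch := assumption)

theorem analyticAt_pulseRemainder {ζ : ℂ} (hζ : ζ ≠ 0) : AnalyticAt ℂ pulseRemainder ζ := by
  have hJ := analyticAt_pulseTransform hζ
  have hζ2 := pow_ne_zero 2 hζ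
  unfold pulseRemainder
  fun_prop (disch := assumption)

theorem meromorphicAt_pulseTransform (ζ : ℂ) : MeromorphicAt pulseTransform ζ := by
  unfold pulseTransform
  fun_prop

theorem meromorphicAt_pulseRemainder (ζ : ℂ) : MeromorphicAt pulseRemainder ζ := by
  have hJ := meromorphicAt_pulseTransform ζ
  unfold pulseRemainder
  fun_prop

theorem pulseTransform_ne_zero {ζ : ℂ} (him : ζ.im < 0) : pulseTransform ζ ≠ 0 := by
  have hζ : ζ ≠ 0 := by
    rintro rfl
    exact him.ne rfl
  have hnorm : ‖Complex.exp (Complex.I * ζ)‖ ≠ 1 := by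
    rw [Complex.norm_exp, Complex.I_mul_re, Ne, Real.exp_eq_one_iff, neg_eq_zero]
    exact him.ne
  refine div_ne_zero (sub_ne_zero.2 fun hexp => hnorm ?_) (mul_ne_zero Complex.I_ne_zero hζ)
  rw [hexp, norm_one]

/-- The quantity `w'(M) - iζ w(M)`, which vanishes iff `w` can be continued beyond `M` by a
multiple of the outgoing exponential `e^{iζx}`. -/
noncomputable def outgoingDefect (w : ℝ → ℂ) (ζ : ℂ) (M : ℝ) : ℂ :=
  deriv w M - Complex.I * ζ * w M

namespace IsSolutionFamily

variable {V : ℝ → ℝ} {u v : ℂ → ℝ → ℂ} {ε ζ₀ : ℂ} {M : ℝ}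

theorem ne_zero_or_deriv_ne_zero (h : IsSolutionFamily V u v) (z : ℂ) (x : ℝ) :
    u z x ≠ 0 ∨ deriv (u z) x ≠ 0 := by
  by_contra! hzero
  have hwronskian := h.wronskian z x
  rw [hzero.1, hzero.2] at hwronskian
  simp at hwronskian

theorem differentiable_outgoingDefect (h : IsSolutionFamily V u v) (hM : 0 ≤ M) :
    Differentiable ℂ fun ζ => outgoingDefect (u (ζ ^ 2)) ζ M :=
  ((h.differentiable_deriv_apply hM).comp (differentiable_id.pow 2)).sub
    ((differentiable_id.const_mul _).mul
      ((h.differentiable_apply hM).comp (differentiable_id.pow 2)))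

theorem isResolventPole (h : IsSolutionFamily V u v) (hV : Continuous V) (hM : 0 < M)
    (huε : ∀ z x, u z (-x) = ε * u z x) (hu₁ε : ∀ z x, deriv (u z) (-x) = -ε * deriv (u z) x)
    (h0 : ∀ z, u z 0 * starRingEnd ℂ (deriv (u z) 0)
      - deriv (u z) 0 * starRingEnd ℂ (u z 0) = 0)
    (him : ζ₀.im < 0) (hz : outgoingDefect (u (ζ₀ ^ 2)) ζ₀ M = 0) :
    IsResolventPole (truncate V M) ζ₀ := by
  set p : ℂ → ℂ := fun ζ => u (ζ ^ 2) M
  set D : ℂ → ℂ := fun ζ => outgoingDefect (u (ζ ^ 2)) ζ M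
  have hp : Differentiable ℂ p := (h.differentiable_apply hM.le).comp (differentiable_id.pow 2)
  have hD : Differentiable ℂ D := h.differentiable_outgoingDefect hM.le
  have hDne : ∀ ζ : ℂ, 0 < ζ.re → 0 < ζ.im → D ζ ≠ 0 := fun ζ hre him =>
    (h.left (ζ ^ 2)).ne_outgoing hM hre him (h0 _) (h.ne_zero_or_deriv_ne_zero _ _)
  have hζ₀ : ζ₀ ≠ 0 := by
    rintro rfl
    exact him.ne rfl
  have hp₀ : p ζ₀ ≠ 0 := by
    refine fun hp₀ => (h.ne_zero_or_deriv_ne_zero (ζ₀ ^ 2) M).elim (· hp₀) fun hu₁ => hu₁ ?_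
    rw [sub_eq_zero.1 hz, show u (ζ₀ ^ 2) M = 0 from hp₀, mul_zero]
  have hDnear : ¬∀ᶠ ζ in 𝓝 ζ₀, D ζ = 0 := fun hzero =>
    hDne (1 + Complex.I) (by simp) (by simp)
      (AnalyticOnNhd.eqOn_zero_of_preconnected_of_eventuallyEq_zero (fun ζ _ => hD.analyticAt ζ)
        isPreconnected_univ (mem_univ ζ₀) hzero (mem_univ _))
  refine ⟨_, _, memLp_outerExtend_unitPulse ε hM, hasCompactSupport_outerExtend_unitPulse ε hM,
    memLp_indicator_const 2 (measurableSet_Ioc (a := M) (b := M + 1)) (1 : ℂ) (.inr (by simp)),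
    HasCompactSupport.intro isCompact_Icc fun x hx =>
      indicator_of_notMem (fun hx' => hx (Ioc_subset_Icc_self hx')) _,
    (fun ζ => pulseTransform ζ ^ 2 * p ζ) / D + pulseRemainder, ⟨fun ζ _ => ?_, ?_⟩, ?_⟩
  · exact ((((meromorphicAt_pulseTransform ζ).pow 2).mul (hp.analyticAt ζ).meromorphicAt).div
      (hD.analyticAt ζ).meromorphicAt).add (meromorphicAt_pulseRemainder ζ)
  · exact fun ζ hre him => (h.left (ζ ^ 2)).exists_isResolventImage hV hM him (huε _) (hu₁ε _)
      (hDne ζ hre him)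
  · exact meromorphicOrderAt_div_add_neg
      (((analyticAt_pulseTransform hζ₀).pow 2).mul (hp.analyticAt ζ₀))
      (mul_ne_zero (pow_ne_zero 2 (pulseTransform_ne_zero him)) hp₀) (hD.analyticAt ζ₀) hz hDnear
      (analyticAt_pulseRemainder hζ₀)

end IsSolutionFamily

/-! ### Solutions exponentially close to the energy of the bound state -/

theorem tendsto_exp_neg_mul {k : ℝ} (hk : 0 < k) :
    Tendsto (fun M => Real.exp (-(k * M))) atTop (𝓝 0) :=
  Real.tendsto_exp_neg_atTop_nhds_zero.comp (tendsto_id.const_mul_atTop hk)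

theorem tendsto_mul_exp_neg_mul {k : ℝ} (hk : 0 < k) :
    Tendsto (fun M => M * Real.exp (-(k * M))) atTop (𝓝 0) := by
  simpa using tendsto_rpow_mul_exp_neg_mul_atTop_nhds_zero 1 k hk

theorem integral_exp_neg_mul_le {k : ℝ} (hk : 0 < k) (x : ℝ) :
    ∫ t in (0 : ℝ)..x, Real.exp (-(k * t)) ≤ 1 / k := by
  have hderiv : ∀ t ∈ uIcc 0 x, HasDerivAt (fun t => -(Real.exp (-(k * t)) / k))
      (Real.exp (-(k * t))) t := fun t _ =>
    ((((hasDerivAt_id t).const_mul k).neg.exp.div_const k).neg).congr_deriv (by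
      simp only [id]
      field_simp
      rfl)
  rw [intervalIntegral.integral_eq_sub_of_hasDerivAt hderiv
    ((by fun_prop : Continuous fun t => Real.exp (-(k * t))).intervalIntegrable _ _)]
  have hpos := div_nonneg (Real.exp_pos (-(k * x))).le hk.le
  simp only [mul_zero, neg_zero, Real.exp_zero]
  linarith

theorem norm_integral_mul_le_of_decay {f g : ℝ → ℂ} {C k X S x : ℝ} (hk : 0 < k) (hC : 0 ≤ C)
    (hg : ∀ x, 0 ≤ x → ‖g x‖ ≤ C * Real.exp (-(k * x))) (hS : 0 ≤ S)
    (hf : ∀ x, 0 ≤ x → x ≤ X → ‖f x‖ ≤ S) (hx : 0 ≤ x) (hxX : x ≤ X) :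
    ‖∫ t in (0 : ℝ)..x, f t * g t‖ ≤ S * C / k := by
  have hcont : Continuous fun t => S * C * Real.exp (-(k * t)) := by fun_prop
  refine (intervalIntegral.norm_integral_le_of_norm_le hx (ae_of_all _ fun t ht => ?_)
    (hcont.intervalIntegrable _ _)).trans ?_
  · rw [norm_mul, mul_assoc]
    exact mul_le_mul (hf t ht.1.le (ht.2.trans hxX)) (hg t ht.1.le) (norm_nonneg _) hS
  · rw [intervalIntegral.integral_const_mul, div_eq_mul_one_div]
    exact mul_le_mul_of_nonneg_left (integral_exp_neg_mul_le hk x) (by positivity)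

theorem norm_integral_mul_le_of_exp_bounds {f g : ℝ → ℂ} {A B k X x : ℝ} (hA : 0 ≤ A) (hB : 0 ≤ B)
    (hf : ∀ t, 0 ≤ t → t ≤ X → ‖f t‖ ≤ A * Real.exp (-(k * t)))
    (hg : ∀ t, 0 ≤ t → ‖g t‖ ≤ B * Real.exp (k * t)) (hx : 0 ≤ x) (hxX : x ≤ X) :
    ‖∫ t in (0 : ℝ)..x, f t * g t‖ ≤ A * B * X := by
  have h := intervalIntegral.norm_integral_le_of_norm_le_const (a := 0) (b := x)
    (f := fun t => f t * g t) (C := A * B) fun t ht => by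
      rw [uIoc_of_le hx] at ht
      rw [norm_mul]
      refine (mul_le_mul (hf t ht.1.le (ht.2.trans hxX)) (hg t ht.1.le) (norm_nonneg _)
        (by positivity)).trans (le_of_eq ?_)
      rw [mul_mul_mul_comm, ← Real.exp_add, neg_add_cancel, Real.exp_zero, mul_one]
  rw [sub_zero, abs_of_nonneg hx] at h
  exact h.trans (mul_le_mul_of_nonneg_left hxX (by positivity))

namespace HasExponentialDichotomy

variable {k C x : ℝ} {u v : ℝ → ℂ}

theorem const_nonneg (hd : HasExponentialDichotomy k C u v) : 0 ≤ C :=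
  nonneg_of_mul_nonneg_left ((norm_nonneg _).trans (hd.norm_left_le 0 le_rfl)) (Real.exp_pos _)

theorem norm_left_le_const (hd : HasExponentialDichotomy k C u v) (hk : 0 < k) (hx : 0 ≤ x) :
    ‖u x‖ ≤ C :=
  (hd.norm_left_le x hx).trans (mul_le_of_le_one_right hd.const_nonneg
    (Real.exp_le_one_iff.2 (neg_nonpos.2 (mul_nonneg hk.le hx))))

theorem norm_right_mul_left_le (hd : HasExponentialDichotomy k C u v) (hx : 0 ≤ x) :
    ‖v x * u x‖ ≤ C * C := by
  rw [norm_mul]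
  refine (mul_le_mul (hd.norm_right_le x hx) (hd.norm_left_le x hx) (norm_nonneg _)
    (mul_nonneg hd.const_nonneg (Real.exp_pos _).le)).trans (le_of_eq ?_)
  rw [mul_mul_mul_comm, ← Real.exp_add, add_neg_cancel, Real.exp_zero, mul_one]

end HasExponentialDichotomy

namespace IsSolutionFamily

variable {V : ℝ → ℝ} {u v : ℂ → ℝ → ℂ} {z z₀ : ℂ} {A C k M t Λ : ℝ}

theorem norm_le_of_hasExponentialDichotomy (h : IsSolutionFamily V u v)
    (hd : HasExponentialDichotomy k C (u z₀) (v z₀)) (hk : 0 < k)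
    (hsmall : 4 * (‖z - z₀‖ * M * C * (C * Real.exp (k * M))) ≤ 1) (ht : 0 ≤ t) (htM : t ≤ M) :
    ‖u z t‖ ≤ 2 * C :=
  h.norm_le_two_mul (ht.trans htM) (fun _ hs _ => hd.norm_left_le_const hk hs)
    (fun s hs hsM => (hd.norm_right_le s hs).trans (mul_le_mul_of_nonneg_left
      (Real.exp_le_exp.2 (mul_le_mul_of_nonneg_left hsM hk.le)) hd.const_nonneg)) hsmall t ht htM

/-- The growing part of `u z` has size `‖z - z₀‖ e^{kt} ≤ Λ e^{-2kM + kt}`, so it does not exceed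
the decaying part before `t = M`. -/
theorem norm_le_exp_of_hasExponentialDichotomy (h : IsSolutionFamily V u v)
    (hd : HasExponentialDichotomy k C (u z₀) (v z₀)) (hk : 0 < k)
    (hz : ‖z - z₀‖ ≤ Λ * Real.exp (-(k * M)) ^ 2)
    (hsmall : 4 * (‖z - z₀‖ * M * C * (C * Real.exp (k * M))) ≤ 1) (ht : 0 ≤ t) (htM : t ≤ M) :
    ‖u z t‖ ≤ (2 * C + 2 * C ^ 3 * Λ / k) * Real.exp (-(k * t)) := by
  have hC := hd.const_nonneg
  have hΛ : 0 ≤ Λ := nonneg_of_mul_nonneg_left ((norm_nonneg _).trans hz) (by positivity)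
  have hu : ∀ s, 0 ≤ s → s ≤ M → ‖u z s‖ ≤ 2 * C := fun s =>
    h.norm_le_of_hasExponentialDichotomy hd hk hsmall
  have huv : ‖∫ s in (0 : ℝ)..t, u z s * v z₀ s‖ ≤ M * (2 * C * (C * Real.exp (k * M))) :=
    norm_integral_mul_le ht htM (by positivity) (by positivity) hu fun s hs hsM =>
      (hd.norm_right_le s hs).trans (by gcongr)
  have huu : ‖∫ s in (0 : ℝ)..t, u z s * u z₀ s‖ ≤ 2 * C * C / k :=
    norm_integral_mul_le_of_decay hk hC hd.norm_left_le (by positivity) hu ht htM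
  have hcoeff : ‖1 + (z - z₀) * ∫ s in (0 : ℝ)..t, u z s * v z₀ s‖ ≤ 2 := by
    refine (norm_add_le _ _).trans ?_
    rw [norm_one, norm_mul]
    have := mul_le_mul_of_nonneg_left huv (norm_nonneg (z - z₀))
    linarith
  have hexp : Real.exp (-(k * M)) ^ 2 * Real.exp (k * t) ≤ Real.exp (-(k * t)) := by
    rw [← Real.exp_nat_mul, ← Real.exp_add, Real.exp_le_exp]
    push_cast
    nlinarith
  rw [h.variation z z₀ t]
  refine (norm_sub_le _ _).trans ?_
  rw [norm_mul, norm_mul, norm_mul]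
  have hut := hd.norm_left_le t ht
  have hvt := hd.norm_right_le t ht
  calc _ ≤ 2 * (C * Real.exp (-(k * t)))
        + Λ * Real.exp (-(k * M)) ^ 2 * (2 * C * C / k) * (C * Real.exp (k * t)) := by gcongr
    _ = 2 * C * Real.exp (-(k * t))
        + 2 * C ^ 3 * Λ / k * (Real.exp (-(k * M)) ^ 2 * Real.exp (k * t)) := by ring
    _ ≤ 2 * C * Real.exp (-(k * t)) + 2 * C ^ 3 * Λ / k * Real.exp (-(k * t)) := by gcongr
    _ = _ := by ring

theorem norm_integral_mul_sub_le (h : IsSolutionFamily V u v)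
    (hd : HasExponentialDichotomy k C (u z₀) (v z₀)) (hk : 0 < k) (hA : 0 ≤ A) (hM : 0 ≤ M)
    (hu : ∀ t, 0 ≤ t → t ≤ M → ‖u z t‖ ≤ A * Real.exp (-(k * t))) :
    ‖(∫ t in (0 : ℝ)..M, u z t * u z₀ t) - ∫ t in (0 : ℝ)..M, u z₀ t * u z₀ t‖
      ≤ 2 * A * C ^ 3 / k * M * ‖z - z₀‖ := by
  have hC := hd.const_nonneg
  have hint : ∀ z, IntervalIntegrable (fun t => u z t * u z₀ t) volume 0 M := fun z =>
    ((h.left z).continuous.mul (h.left z₀).continuous).intervalIntegrable _ _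
  have hsplit : ∀ t, u z t * u z₀ t - u z₀ t * u z₀ t
      = (z - z₀) * ((∫ s in (0 : ℝ)..t, u z s * v z₀ s) * u z₀ t * u z₀ t
        - (∫ s in (0 : ℝ)..t, u z s * u z₀ s) * (v z₀ t * u z₀ t)) := fun t => by
    nth_rewrite 1 [h.variation z z₀ t]
    ring
  have hbound : ∀ t ∈ Ioc 0 M, ‖u z t * u z₀ t - u z₀ t * u z₀ t‖
      ≤ ‖z - z₀‖ * (A * C ^ 3 * M) * Real.exp (-(k * t)) + ‖z - z₀‖ * (A * C ^ 3 / k) := by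
    rintro t ⟨ht, htM⟩
    have huv := norm_integral_mul_le_of_exp_bounds hA hC hu hd.norm_right_le ht.le htM
    have huu : ‖∫ s in (0 : ℝ)..t, u z s * u z₀ s‖ ≤ A * C / k :=
      norm_integral_mul_le_of_decay hk hC hd.norm_left_le hA (fun s hs hsM =>
        (hu s hs hsM).trans (mul_le_of_le_one_right hA
          (Real.exp_le_one_iff.2 (neg_nonpos.2 (mul_nonneg hk.le hs))))) ht.le htM
    have hut := hd.norm_left_le t ht.le
    have hutC := hd.norm_left_le_const hk ht.le
    have hvu := hd.norm_right_mul_left_le ht.le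
    rw [hsplit, norm_mul]
    calc _ ≤ ‖z - z₀‖ * (A * C * M * C * (C * Real.exp (-(k * t))) + A * C / k * (C * C)) := by
          refine mul_le_mul_of_nonneg_left ((norm_sub_le _ _).trans ?_) (norm_nonneg _)
          rw [norm_mul, norm_mul, norm_mul _ (v z₀ t * u z₀ t)]
          gcongr
      _ = _ := by ring
  rw [← intervalIntegral.integral_sub (hint z) (hint z₀)]
  have hcont : Continuous fun t => ‖z - z₀‖ * (A * C ^ 3 * M) * Real.exp (-(k * t)) := by fun_prop
  refine (intervalIntegral.norm_integral_le_of_norm_le hM (ae_of_all _ hbound)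
    ((hcont.add continuous_const).intervalIntegrable _ _)).trans ?_
  rw [intervalIntegral.integral_add (hcont.intervalIntegrable _ _) intervalIntegrable_const,
    intervalIntegral.integral_const_mul, intervalIntegral.integral_const, smul_eq_mul, sub_zero]
  have hexp := integral_exp_neg_mul_le hk M
  calc _ ≤ ‖z - z₀‖ * (A * C ^ 3 * M) * (1 / k) + M * (‖z - z₀‖ * (A * C ^ 3 / k)) := by gcongr
    _ = _ := by ring

theorem exists_amplitude_bounds (h : IsSolutionFamily V u v)
    (hd : HasExponentialDichotomy k C (u z₀) (v z₀)) (hk : 0 < k) (hΛ : 0 ≤ Λ) :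
    ∃ K, 0 ≤ K ∧ ∀ᶠ M in atTop, ∀ z, ‖z - z₀‖ ≤ Λ * Real.exp (-(k * M)) ^ 2 →
      ‖∫ t in (0 : ℝ)..M, u z t * v z₀ t‖ ≤ K * M ∧
      ‖(∫ t in (0 : ℝ)..M, u z t * u z₀ t) - ∫ t in (0 : ℝ)..M, u z₀ t * u z₀ t‖
        ≤ K * M * ‖z - z₀‖ := by
  have hC := hd.const_nonneg
  set A := 2 * C + 2 * C ^ 3 * Λ / k
  have hA : 0 ≤ A := by positivity
  have hsmall := ((tendsto_mul_exp_neg_mul hk).const_mul (4 * Λ * C ^ 2)).eventually_le_const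
    (u := 1) (by simp)
  refine ⟨A * C + 2 * A * C ^ 3 / k, by positivity, ?_⟩
  filter_upwards [hsmall, eventually_ge_atTop 0] with M hsmall hM z hz
  have hsmall_z : 4 * (‖z - z₀‖ * M * C * (C * Real.exp (k * M))) ≤ 1 := by
    have hinv : Real.exp (-(k * M)) * Real.exp (k * M) = 1 := by
      rw [← Real.exp_add, neg_add_cancel, Real.exp_zero]
    calc _ ≤ 4 * (Λ * Real.exp (-(k * M)) ^ 2 * M * C * (C * Real.exp (k * M))) := by gcongr
      _ = 4 * Λ * C ^ 2 * (M * Real.exp (-(k * M)) * (Real.exp (-(k * M)) * Real.exp (k * M))) := by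
        ring
      _ ≤ 1 := by rwa [hinv, mul_one]
  have hu : ∀ t, 0 ≤ t → t ≤ M → ‖u z t‖ ≤ A * Real.exp (-(k * t)) := fun t =>
    h.norm_le_exp_of_hasExponentialDichotomy hd hk hz hsmall_z
  refine ⟨(norm_integral_mul_le_of_exp_bounds hA hC hu hd.norm_right_le hM le_rfl).trans ?_,
    (h.norm_integral_mul_sub_le hd hk hA hM hu).trans ?_⟩
  · gcongr
    exact le_add_of_nonneg_right (by positivity)
  · gcongr
    exact le_add_of_nonneg_left (by positivity)

end IsSolutionFamily

/-! ### The outgoing condition near the bound state -/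

theorem csqrt_ofReal {E : ℝ} (hE : 0 ≤ E) : csqrt E = (Real.sqrt E : ℂ) := by
  rw [csqrt, Real.sqrt_eq_rpow, Complex.ofReal_cpow hE]
  simp

theorem csqrt_re_pos {z : ℂ} (hz : 0 < z.re) : 0 < (csqrt z).re := by
  have hz₀ : z ≠ 0 := by
    rintro rfl
    simp at hz
  have harg := abs_lt.1 (Complex.abs_arg_lt_pi_div_two_iff.2 (Or.inl hz))
  have him : (Complex.log z * (1 / 2)).im = z.arg / 2 := by
    rw [mul_one_div, Complex.div_ofNat_im, Complex.log_im]
  rw [csqrt, Complex.cpow_def_of_ne_zero hz₀, Complex.exp_re, him]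
  exact mul_pos (Real.exp_pos _)
    (Real.cos_pos_of_mem_Ioo ⟨by linarith [Real.pi_pos], by linarith [Real.pi_pos]⟩)

theorem csqrt_im_neg {z : ℂ} (hre : 0 < z.re) (him : z.im < 0) : (csqrt z).im < 0 := by
  have hsq := congrArg Complex.im (csqrt_sq z)
  rw [sq, Complex.mul_im] at hsq
  by_contra! hnonneg
  nlinarith [mul_nonneg (csqrt_re_pos hre).le hnonneg]

theorem norm_csqrt_sub_le {E : ℝ} (hE : 0 < E) {z : ℂ} (hz : 0 < z.re) :
    ‖csqrt z - Real.sqrt E‖ ≤ ‖z - E‖ / Real.sqrt E := by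
  have hfactor : z - E = (csqrt z - Real.sqrt E) * (csqrt z + Real.sqrt E) := by
    have hsqrt : (Real.sqrt E : ℂ) ^ 2 = E := by exact_mod_cast Real.sq_sqrt hE.le
    linear_combination hsqrt - csqrt_sq z
  rw [le_div_iff₀ (Real.sqrt_pos.2 hE), hfactor, norm_mul]
  refine mul_le_mul_of_nonneg_left ?_ (norm_nonneg _)
  have hre := Complex.re_le_norm (csqrt z + Real.sqrt E)
  rw [Complex.add_re, Complex.ofReal_re] at hre
  linarith [csqrt_re_pos hz]

theorem differentiableAt_csqrt {z : ℂ} (hz : 0 < z.re) : DifferentiableAt ℂ csqrt z :=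
  differentiableAt_id.cpow_const (Or.inl hz)

section OutgoingDefect

variable {w : ℝ → ℂ} {ζ ζ' : ℂ} {M P S : ℝ}

theorem norm_outgoingDefect_le (hw : ‖w M‖ ≤ P) (hw₁ : ‖deriv w M‖ ≤ P) (hζ : ‖ζ‖ ≤ S) :
    ‖outgoingDefect w ζ M‖ ≤ P * (1 + S) := by
  refine (norm_sub_le _ _).trans ?_
  rw [norm_mul, norm_mul, Complex.norm_I, one_mul]
  linarith [mul_le_mul hζ hw (norm_nonneg _) ((norm_nonneg _).trans hζ)]

theorem norm_outgoingDefect_sub_le (hw : ‖w M‖ ≤ P) :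
    ‖outgoingDefect w ζ M - outgoingDefect w ζ' M‖ ≤ ‖ζ - ζ'‖ * P := by
  have hsub : outgoingDefect w ζ M - outgoingDefect w ζ' M = -Complex.I * (ζ - ζ') * w M := by
    rw [outgoingDefect, outgoingDefect]
    ring
  rw [hsub, norm_mul, norm_mul, norm_neg, Complex.norm_I, one_mul]
  exact mul_le_mul_of_nonneg_left hw (norm_nonneg _)

theorem norm_le_norm_outgoingDefect {s : ℝ} (hs : 0 < s) (hw : starRingEnd ℂ (w M) = w M)
    (hw₁ : starRingEnd ℂ (deriv w M) = deriv w M) :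
    ‖deriv w M‖ ≤ ‖outgoingDefect w s M‖ ∧ ‖w M‖ ≤ ‖outgoingDefect w s M‖ / s := by
  obtain ⟨b, hb⟩ := Complex.conj_eq_iff_real.1 hw
  obtain ⟨b₁, hb₁⟩ := Complex.conj_eq_iff_real.1 hw₁
  have hre := Complex.abs_re_le_norm ((b₁ : ℂ) - Complex.I * s * b)
  have him := Complex.abs_im_le_norm ((b₁ : ℂ) - Complex.I * s * b)
  simp only [Complex.sub_re, Complex.sub_im, Complex.mul_re, Complex.mul_im, Complex.I_re,
    Complex.I_im, Complex.ofReal_re, Complex.ofReal_im, zero_mul, one_mul, mul_zero, sub_zero,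
    zero_sub, zero_add, abs_neg, abs_mul, abs_of_pos hs] at hre him
  rw [outgoingDefect, hb, hb₁, Complex.norm_real, Complex.norm_real, Real.norm_eq_abs,
    Real.norm_eq_abs, le_div_iff₀ hs, mul_comm |b|]
  exact ⟨hre, him⟩

/-- A solution whose Wronskian with a small solution is `1` cannot be small. -/
theorem inv_le_norm_outgoingDefect {s : ℝ} {a a₁ : ℂ} (hs : 0 < s)
    (ha : ‖a‖ ≤ P) (ha₁ : ‖a₁‖ ≤ P) (hw : starRingEnd ℂ (w M) = w M)
    (hw₁ : starRingEnd ℂ (deriv w M) = deriv w M) (hW : a * deriv w M - a₁ * w M = 1) :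
    (P * (1 + 1 / s))⁻¹ ≤ ‖outgoingDefect w s M‖ := by
  obtain ⟨hnorm₁, hnorm⟩ := norm_le_norm_outgoingDefect hs hw hw₁
  set D := ‖outgoingDefect w s M‖
  have hP : 0 ≤ P := (norm_nonneg _).trans ha
  have hone : 1 ≤ P * D + P * (D / s) := by
    calc (1 : ℝ) = ‖a * deriv w M - a₁ * w M‖ := by rw [hW, norm_one]
      _ ≤ ‖a‖ * ‖deriv w M‖ + ‖a₁‖ * ‖w M‖ := (norm_sub_le _ _).trans (by rw [norm_mul, norm_mul])
      _ ≤ _ := by gcongr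
  have hPpos : 0 < P := hP.lt_of_ne fun hP₀ => by
    rw [← hP₀] at hone
    linarith
  rw [inv_le_iff_one_le_mul₀ (by positivity)]
  calc (1 : ℝ) ≤ _ := hone
    _ = _ := by ring

end OutgoingDefect

theorem exists_eq_zero_of_le_norm_sub {F : ℂ → ℂ} {c : ℂ} {r m : ℝ} (hr : 0 < r) (hm : 0 < m)
    (hF : DifferentiableOn ℂ F (Metric.closedBall c r))
    (hlower : ∀ z ∈ Metric.closedBall c r, m * ‖z - c‖ ≤ ‖F z - F c‖) (hc : ‖F c‖ < m * r / 2) :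
    ∃ z ∈ Metric.closedBall c r, F z = 0 := by
  have hnonconst : ∃ᶠ z in 𝓝 c, F z ≠ F c := by
    have hne : ∃ᶠ z in 𝓝 c, z ≠ c :=
      ((eventually_mem_nhdsWithin (a := c) (s := {c}ᶜ)).frequently).filter_mono nhdsWithin_le_nhds
    refine (hne.and_eventually (Metric.closedBall_mem_nhds c hr)).mono ?_
    rintro z ⟨hz, hzr⟩ hFz
    have hle := hlower z hzr
    rw [hFz, sub_self, norm_zero] at hle
    exact absurd hle (not_le.2 (mul_pos hm (norm_pos_iff.2 (sub_ne_zero.2 hz))))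
  refine (hF.diffContOnCl_ball subset_rfl).ball_subset_image_closedBall (ε := m * r) hr
    (fun z hz => ?_) hnonconst ?_
  · rw [← mem_sphere_iff_norm.1 hz]
    exact hlower z (Metric.sphere_subset_closedBall hz)
  · rwa [mem_ball_zero_iff.symm.trans Metric.mem_ball_comm] at hc

theorem exists_zero_near_newton_step {P Q : ℂ → ℂ} {c : ℂ} {r A A' B β : ℝ} (hr : 0 < r)
    (hβ : 0 < β)
    (hF : DifferentiableOn ℂ (fun z => P z - (z - c) * Q z) (Metric.closedBall c r))
    (hP : ∀ z ∈ Metric.closedBall c r, ‖P z - P c‖ ≤ A * ‖z - c‖)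
    (hQ : ∀ z ∈ Metric.closedBall c r, ‖Q z - Q c‖ ≤ A' * ‖z - c‖)
    (hA : 0 ≤ A) (hA' : 0 ≤ A') (hsmall : A + A' * r ≤ β / 2)
    (hPc : ‖P c‖ ≤ B) (hB : 4 * B < β * r) (hQc : β ≤ ‖Q c‖) :
    ∃ z ∈ Metric.closedBall c r, P z = (z - c) * Q z ∧
      ‖(z - c) - P c / Q c‖ ≤ (A * r + A' * r ^ 2) / β := by
  have hlower : ∀ z ∈ Metric.closedBall c r,
      β / 2 * ‖z - c‖ ≤ ‖(P z - (z - c) * Q z) - (P c - (c - c) * Q c)‖ := by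
    intro z hz
    have hzr := mem_closedBall_iff_norm.1 hz
    have hQz : β - A' * r ≤ ‖Q z‖ := by
      have hle := (norm_sub_norm_le (Q c) (Q z)).trans_eq (norm_sub_rev _ _)
      linarith [hQ z hz, mul_le_mul_of_nonneg_left hzr hA']
    have hsub := norm_sub_norm_le ((z - c) * Q z) (P z - P c)
    rw [norm_mul] at hsub
    rw [sub_self, zero_mul, sub_zero, sub_right_comm, norm_sub_rev (P z - P c)]
    nlinarith [hP z hz, mul_le_mul_of_nonneg_left hQz (norm_nonneg (z - c)), norm_nonneg (z - c)]
  obtain ⟨z, hz, hzero⟩ := exists_eq_zero_of_le_norm_sub hr (half_pos hβ) hF hlower (by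
    rw [sub_self, zero_mul, sub_zero]
    linarith)
  have hQc_pos : 0 < ‖Q c‖ := hβ.trans_le hQc
  have hzr := mem_closedBall_iff_norm.1 hz
  have herror : (z - c) - P c / Q c = ((P z - P c) - (z - c) * (Q z - Q c)) / Q c := by
    have hQc_ne := norm_pos_iff.1 hQc_pos
    field_simp
    linear_combination -hzero
  refine ⟨z, hz, sub_eq_zero.1 hzero, ?_⟩
  rw [herror, norm_div]
  refine div_le_div₀ (by positivity) ((norm_sub_le _ _).trans ?_) hβ hQc
  rw [norm_mul]
  have hPz := (hP z hz).trans (mul_le_mul_of_nonneg_left hzr hA)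
  have hQz := (hQ z hz).trans (mul_le_mul_of_nonneg_left hzr hA')
  calc _ ≤ A * r + r * (A' * r) := by gcongr
    _ = _ := by ring

theorem conj_deriv_eq {w : ℝ → ℂ} (hw : ∀ x, starRingEnd ℂ (w x) = w x) (x : ℝ) :
    starRingEnd ℂ (deriv w x) = deriv w x := by
  have hstar : (fun y => star (w y)) = w := funext hw
  have hderiv := deriv.star (f := w) (x := x)
  rw [hstar] at hderiv
  exact hderiv.symm

theorem integral_mul_self_of_conj_eq {w : ℝ → ℂ} (hw : ∀ x, starRingEnd ℂ (w x) = w x) (a b : ℝ) :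
    ∫ t in a..b, w t * w t = ((∫ t in a..b, Complex.normSq (w t) : ℝ) : ℂ) := by
  rw [← intervalIntegral.integral_ofReal]
  refine intervalIntegral.integral_congr fun t _ => ?_
  simp only [← Complex.mul_conj, hw]

theorem exists_le_integral_normSq {w : ℝ → ℂ} (hw : Continuous w)
    (hne : ∃ x ∈ Icc (0 : ℝ) 1, w x ≠ 0) :
    ∃ I₁ : ℝ, 0 < I₁ ∧ ∀ M, 1 ≤ M → I₁ ≤ ∫ t in (0 : ℝ)..M, Complex.normSq (w t) := by
  have hcont : Continuous fun t => Complex.normSq (w t) := Complex.continuous_normSq.comp hw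
  obtain ⟨x, hx, hwx⟩ := hne
  exact ⟨_, intervalIntegral.integral_pos zero_lt_one hcont.continuousOn
    (fun t _ => Complex.normSq_nonneg _) ⟨x, hx, Complex.normSq_pos.2 hwx⟩, fun M hM =>
    intervalIntegral.integral_mono_interval le_rfl zero_le_one hM
      (ae_of_all _ fun t => Complex.normSq_nonneg _) (hcont.intervalIntegrable _ _)⟩

theorem re_pos_of_norm_sub_ofReal_lt {z : ℂ} {E : ℝ} (hz : ‖z - E‖ < E) : 0 < z.re := by
  have hre := (Complex.abs_re_le_norm (z - E)).trans_lt hz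
  rw [Complex.sub_re, Complex.ofReal_re] at hre
  linarith [(abs_lt.1 hre).1]

theorem norm_csqrt_le {E : ℝ} (hE : 0 < E) {z : ℂ} (hre : 0 < z.re) (hz : ‖z - E‖ ≤ 1) :
    ‖csqrt z‖ ≤ Real.sqrt E + 1 / Real.sqrt E := by
  have hsub := (norm_csqrt_sub_le hE hre).trans (div_le_div_of_nonneg_right hz (Real.sqrt_nonneg E))
  have hnorm := norm_sub_norm_le (csqrt z) (Real.sqrt E)
  rw [Complex.norm_real, Real.norm_of_nonneg (Real.sqrt_nonneg E)] at hnorm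
  linarith

namespace IsSolutionFamily

variable {V : ℝ → ℝ} {u v : ℂ → ℝ → ℂ} {z₀ : ℂ} {k C : ℝ}

theorem exists_ne_zero_on_Icc (h : IsSolutionFamily V u v) (z : ℂ) :
    ∃ x ∈ Icc (0 : ℝ) 1, u z x ≠ 0 := by
  by_contra! hzero
  have hlocal : u z =ᶠ[𝓝 (1 / 2)] fun _ => 0 := by
    filter_upwards [Icc_mem_nhds (a := (0 : ℝ)) (b := 1) (by norm_num) (by norm_num)] using hzero
  refine (h.ne_zero_or_deriv_ne_zero z (1 / 2)).elim (· hlocal.self_of_nhds) fun hderiv => ?_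
  exact hderiv (by rw [hlocal.deriv_eq, deriv_const])

theorem dichotomy_const_pos (h : IsSolutionFamily V u v)
    (hd : HasExponentialDichotomy k C (u z₀) (v z₀)) : 0 < C := by
  refine hd.const_nonneg.lt_of_ne fun hC => ?_
  have hu := hd.norm_left_le 0 le_rfl
  have hu₁ := hd.norm_deriv_left_le 0 le_rfl
  rw [← hC, zero_mul, norm_le_zero_iff] at hu hu₁
  exact (h.ne_zero_or_deriv_ne_zero z₀ 0).elim (· hu) (· hu₁)

end IsSolutionFamily

/-- By variation of constants, `outgoingDefect (u z) (csqrt z) M` is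
`newtonNumerator u v E M z - (z - E) * newtonDenominator u v E M z`; the quotient of the two
coefficients at `z = E` is the first Newton step for its zero near `E`. -/
noncomputable def newtonNumerator (u v : ℂ → ℝ → ℂ) (E M : ℝ) (z : ℂ) : ℂ :=
  (1 + (z - E) * ∫ t in (0 : ℝ)..M, u z t * v E t) * outgoingDefect (u E) (csqrt z) M

/-- See `newtonNumerator`. -/
noncomputable def newtonDenominator (u v : ℂ → ℝ → ℂ) (E M : ℝ) (z : ℂ) : ℂ :=
  (∫ t in (0 : ℝ)..M, u z t * u E t) * outgoingDefect (v E) (csqrt z) M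

section Newton

variable {u v : ℂ → ℝ → ℂ} {z : ℂ} {E k C M K L : ℝ}

theorem newtonNumerator_self (u v : ℂ → ℝ → ℂ) (M : ℝ) (hE : 0 ≤ E) :
    newtonNumerator u v E M E = outgoingDefect (u E) (Real.sqrt E) M := by
  rw [newtonNumerator, sub_self, zero_mul, add_zero, one_mul, csqrt_ofReal hE]

theorem newtonDenominator_self (u v : ℂ → ℝ → ℂ) (M : ℝ) (hE : 0 ≤ E) :
    newtonDenominator u v E M E
      = (∫ t in (0 : ℝ)..M, u E t * u E t) * outgoingDefect (v E) (Real.sqrt E) M := by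
  rw [newtonDenominator, csqrt_ofReal hE]

theorem norm_newtonNumerator_self_le (hd : HasExponentialDichotomy k C (u E) (v E)) (hE : 0 ≤ E)
    (hM : 0 ≤ M) :
    ‖newtonNumerator u v E M E‖ ≤ C * Real.exp (-(k * M)) * (1 + Real.sqrt E) := by
  rw [newtonNumerator_self u v M hE]
  exact norm_outgoingDefect_le (hd.norm_left_le M hM) (hd.norm_deriv_left_le M hM)
    (by rw [Complex.norm_real, Real.norm_of_nonneg (Real.sqrt_nonneg E)])

theorem norm_newtonNumerator_sub_le (hd : HasExponentialDichotomy k C (u E) (v E)) (hE : 0 < E)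
    (hM : 0 ≤ M) (hre : 0 < z.re) (hz : ‖z - E‖ ≤ 1)
    (hK : ‖∫ t in (0 : ℝ)..M, u z t * v E t‖ ≤ K) :
    ‖newtonNumerator u v E M z - newtonNumerator u v E M E‖
      ≤ (K * (C * (1 + (Real.sqrt E + 1 / Real.sqrt E))) + C / Real.sqrt E)
        * Real.exp (-(k * M)) * ‖z - E‖ := by
  set a := ∫ t in (0 : ℝ)..M, u z t * v E t with ha
  have hC := hd.const_nonneg
  have hK₀ : 0 ≤ K := (norm_nonneg _).trans hK
  have hdefect := norm_outgoingDefect_le (hd.norm_left_le M hM) (hd.norm_deriv_left_le M hM)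
    (norm_csqrt_le hE hre hz)
  have hsub := (norm_outgoingDefect_sub_le (ζ := csqrt z) (ζ' := Real.sqrt E)
    (hd.norm_left_le M hM)).trans (mul_le_mul_of_nonneg_right (norm_csqrt_sub_le hE hre)
      (mul_nonneg hC (Real.exp_pos _).le))
  have hsplit : newtonNumerator u v E M z - newtonNumerator u v E M E
      = (z - E) * (a * outgoingDefect (u E) (csqrt z) M)
        + (outgoingDefect (u E) (csqrt z) M - outgoingDefect (u E) (Real.sqrt E) M) := by
    rw [newtonNumerator_self u v M hE.le, newtonNumerator, ← ha]
    ring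
  rw [hsplit]
  refine (norm_add_le _ _).trans ?_
  rw [norm_mul, norm_mul]
  calc _ ≤ ‖z - E‖ * (K * (C * Real.exp (-(k * M)) * (1 + (Real.sqrt E + 1 / Real.sqrt E))))
        + ‖z - E‖ / Real.sqrt E * (C * Real.exp (-(k * M))) := by gcongr
    _ = _ := by ring

theorem norm_newtonDenominator_sub_le (hd : HasExponentialDichotomy k C (u E) (v E)) (hE : 0 < E)
    (hM : 0 ≤ M) (hre : 0 < z.re) (hz : ‖z - E‖ ≤ 1)
    (hK : ‖(∫ t in (0 : ℝ)..M, u z t * u E t) - ∫ t in (0 : ℝ)..M, u E t * u E t‖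
      ≤ K * ‖z - E‖) (hL : ‖∫ t in (0 : ℝ)..M, u E t * u E t‖ ≤ L) :
    ‖newtonDenominator u v E M z - newtonDenominator u v E M E‖
      ≤ (K * (C * (1 + (Real.sqrt E + 1 / Real.sqrt E))) + L * (C / Real.sqrt E))
        * Real.exp (k * M) * ‖z - E‖ := by
  set J := ∫ t in (0 : ℝ)..M, u z t * u E t with hJ
  set J₀ := ∫ t in (0 : ℝ)..M, u E t * u E t with hJ₀
  have hC := hd.const_nonneg
  have hL₀ : 0 ≤ L := (norm_nonneg _).trans hL
  have hdefect := norm_outgoingDefect_le (hd.norm_right_le M hM) (hd.norm_deriv_right_le M hM)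
    (norm_csqrt_le hE hre hz)
  have hsub := (norm_outgoingDefect_sub_le (ζ := csqrt z) (ζ' := Real.sqrt E)
    (hd.norm_right_le M hM)).trans (mul_le_mul_of_nonneg_right (norm_csqrt_sub_le hE hre)
      (mul_nonneg hC (Real.exp_pos _).le))
  have hsplit : newtonDenominator u v E M z - newtonDenominator u v E M E
      = (J - J₀) * outgoingDefect (v E) (csqrt z) M
        + J₀ * (outgoingDefect (v E) (csqrt z) M - outgoingDefect (v E) (Real.sqrt E) M) := by
    rw [newtonDenominator_self u v M hE.le, newtonDenominator, ← hJ, ← hJ₀]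
    ring
  have hKz : 0 ≤ K * ‖z - E‖ := (norm_nonneg _).trans hK
  rw [hsplit]
  refine (norm_add_le _ _).trans ?_
  rw [norm_mul, norm_mul]
  calc _ ≤ K * ‖z - E‖ * (C * Real.exp (k * M) * (1 + (Real.sqrt E + 1 / Real.sqrt E)))
        + L * (‖z - E‖ / Real.sqrt E * (C * Real.exp (k * M))) := by gcongr
    _ = _ := by ring

end Newton

namespace IsSolutionFamily

variable {V : ℝ → ℝ} {u v : ℂ → ℝ → ℂ} {E k C M : ℝ}

theorem outgoingDefect_eq_newton (h : IsSolutionFamily V u v) (E M : ℝ) (z : ℂ) :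
    outgoingDefect (u z) (csqrt z) M
      = newtonNumerator u v E M z - (z - E) * newtonDenominator u v E M z := by
  simp only [outgoingDefect, newtonNumerator, newtonDenominator]
  linear_combination h.variation_deriv z E M - Complex.I * csqrt z * h.variation z E M

theorem le_norm_newtonDenominator_self (h : IsSolutionFamily V u v)
    (hd : HasExponentialDichotomy k C (u E) (v E)) (hE : 0 < E) (hM : 0 ≤ M)
    (hv : ∀ x, starRingEnd ℂ (v E x) = v E x) {I₁ : ℝ}
    (hI₁ : I₁ ≤ ‖∫ t in (0 : ℝ)..M, u E t * u E t‖) :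
    I₁ * (C * (1 + 1 / Real.sqrt E))⁻¹ * Real.exp (k * M) ≤ ‖newtonDenominator u v E M E‖ := by
  have hC := hd.const_nonneg
  have hdefect := inv_le_norm_outgoingDefect (Real.sqrt_pos.2 hE) (hd.norm_left_le M hM)
    (hd.norm_deriv_left_le M hM) (hv M) (conj_deriv_eq hv M) (h.wronskian E M)
  rw [newtonDenominator_self u v M hE.le, norm_mul, mul_assoc]
  refine mul_le_mul hI₁ (le_trans (le_of_eq ?_) hdefect) (by positivity) (norm_nonneg _)
  rw [mul_right_comm C, mul_inv _ (Real.exp _), Real.exp_neg, inv_inv]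

end IsSolutionFamily

theorem eventually_mul_exp_sq_lt {k δ : ℝ} (hk : 0 < k) (Λ : ℝ) (hδ : 0 < δ) :
    ∀ᶠ M in atTop, Λ * Real.exp (-(k * M)) ^ 2 < δ := by
  have hlim := ((tendsto_exp_neg_mul hk).pow 2).const_mul Λ
  rw [zero_pow two_ne_zero, mul_zero] at hlim
  exact hlim.eventually_lt_const hδ

theorem eventually_mul_mul_exp_sq_lt {k δ : ℝ} (hk : 0 < k) (Λ : ℝ) (hδ : 0 < δ) :
    ∀ᶠ M in atTop, Λ * (M * Real.exp (-(k * M)) ^ 2) < δ := by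
  have hlim := ((tendsto_mul_exp_neg_mul hk).mul (tendsto_exp_neg_mul hk)).const_mul Λ
  rw [mul_zero, mul_zero] at hlim
  filter_upwards [hlim.eventually_lt_const hδ] with M hM
  rwa [sq, ← mul_assoc M]

namespace IsSolutionFamily

variable {V : ℝ → ℝ} {u v : ℂ → ℝ → ℂ} {E k C M Λ : ℝ}

theorem exists_newton_bounds (h : IsSolutionFamily V u v)
    (hd : HasExponentialDichotomy k C (u E) (v E)) (hE : 0 < E) (hk : 0 < k) (hΛ : 0 ≤ Λ) :
    ∃ T, 0 ≤ T ∧ ∀ᶠ M in atTop, ∀ z : ℂ, ‖z - E‖ ≤ Λ * Real.exp (-(k * M)) ^ 2 →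
      ‖newtonNumerator u v E M z - newtonNumerator u v E M E‖
        ≤ T * M * Real.exp (-(k * M)) * ‖z - E‖ ∧
      ‖newtonDenominator u v E M z - newtonDenominator u v E M E‖
        ≤ T * M * Real.exp (k * M) * ‖z - E‖ := by
  obtain ⟨K, hK, hamplitude⟩ := h.exists_amplitude_bounds hd hk hΛ
  have hC := hd.const_nonneg
  set S := C * (1 + (Real.sqrt E + 1 / Real.sqrt E)) with hS
  set L := C * C / k
  refine ⟨K * S + (1 + L) * (C / Real.sqrt E), by positivity, ?_⟩
  filter_upwards [hamplitude, eventually_ge_atTop 1, eventually_mul_exp_sq_lt hk Λ hE,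
    eventually_mul_exp_sq_lt hk Λ one_pos] with M hM hM1 hsmallE hsmall1 z hz
  obtain ⟨hv, hu⟩ := hM z hz
  have hM0 : 0 ≤ M := zero_le_one.trans hM1
  have hre := re_pos_of_norm_sub_ofReal_lt (hz.trans_lt hsmallE)
  have hz1 := hz.trans hsmall1.le
  have hL_bound : ‖∫ t in (0 : ℝ)..M, u E t * u E t‖ ≤ L :=
    norm_integral_mul_le_of_decay hk hC hd.norm_left_le hC
      (fun x hx _ => hd.norm_left_le_const hk hx) hM0 le_rfl
  have hCE : 0 ≤ C / Real.sqrt E := by positivity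
  have hL0 : 0 ≤ L := by positivity
  refine ⟨(norm_newtonNumerator_sub_le hd hE hM0 hre hz1 hv).trans ?_,
    (norm_newtonDenominator_sub_le hd hE hM0 hre hz1 hu hL_bound).trans ?_⟩ <;>
  · gcongr
    rw [← hS]
    nlinarith [mul_le_mul_of_nonneg_left hM1 hCE,
      mul_le_mul_of_nonneg_left hM1 (mul_nonneg hL0 hCE)]

theorem exists_le_norm_newtonDenominator_self (h : IsSolutionFamily V u v)
    (hd : HasExponentialDichotomy k C (u E) (v E)) (hE : 0 < E)
    (hu : ∀ x, starRingEnd ℂ (u E x) = u E x) (hv : ∀ x, starRingEnd ℂ (v E x) = v E x) :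
    ∃ b, 0 < b ∧ ∀ M, 1 ≤ M → b * Real.exp (k * M) ≤ ‖newtonDenominator u v E M E‖ := by
  obtain ⟨I₁, hI₁, hI⟩ :=
    exists_le_integral_normSq (h.left E).continuous (h.exists_ne_zero_on_Icc E)
  have hC := h.dichotomy_const_pos hd
  refine ⟨I₁ * (C * (1 + 1 / Real.sqrt E))⁻¹, by positivity, fun M hM => ?_⟩
  refine h.le_norm_newtonDenominator_self hd hE (zero_le_one.trans hM) hv ?_
  rw [integral_mul_self_of_conj_eq hu, Complex.norm_real]
  exact (hI M hM).trans (le_abs_self _)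

theorem differentiableAt_outgoingDefect_csqrt (h : IsSolutionFamily V u v) (hM : 0 ≤ M) {z : ℂ}
    (hre : 0 < z.re) : DifferentiableAt ℂ (fun z => outgoingDefect (u z) (csqrt z) M) z :=
  (h.differentiable_deriv_apply hM z).sub
    (((differentiableAt_csqrt hre).const_mul Complex.I).mul (h.differentiable_apply hM z))

theorem exists_outgoing_energy (h : IsSolutionFamily V u v)
    (hd : HasExponentialDichotomy k C (u E) (v E)) (hE : 0 < E) (hk : 0 < k)
    (hu : ∀ x, starRingEnd ℂ (u E x) = u E x) (hv : ∀ x, starRingEnd ℂ (v E x) = v E x) :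
    ∃ K, ∀ᶠ M in atTop, ∃ z : ℂ, ‖z - E‖ ≤ K * Real.exp (-(k * M)) ^ 2 ∧ 0 < z.re ∧
      outgoingDefect (u z) (csqrt z) M = 0 ∧
      ‖z - E - newtonNumerator u v E M E / newtonDenominator u v E M E‖
        ≤ K * (M * Real.exp (-(k * M)) ^ 4) := by
  obtain ⟨b, hb, hdenominator⟩ := h.exists_le_norm_newtonDenominator_self hd hE hu hv
  have hC := hd.const_nonneg
  set B := C * (1 + Real.sqrt E) with hB
  set Λ := (4 * B + 1) / b with hΛ
  obtain ⟨T, hT, hbounds⟩ := h.exists_newton_bounds (Λ := Λ) hd hE hk (by positivity)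
  refine ⟨max Λ (T * (Λ + Λ ^ 2) / b), ?_⟩
  filter_upwards [hbounds, eventually_ge_atTop 1, eventually_mul_exp_sq_lt hk Λ hE,
    eventually_mul_mul_exp_sq_lt hk (T * (1 + Λ)) (half_pos hb)] with M hM hM1 hsmallE hsmall
  have hM0 : 0 ≤ M := zero_le_one.trans hM1
  have hnumerator := norm_newtonNumerator_self_le hd hE.le hM0
  specialize hdenominator M hM1
  have hexp : Real.exp (k * M) = (Real.exp (-(k * M)))⁻¹ := by rw [Real.exp_neg, inv_inv]
  rw [hexp] at hdenominator hM
  set q := Real.exp (-(k * M))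
  have hq : 0 < q := Real.exp_pos _
  have hre : ∀ z ∈ Metric.closedBall (E : ℂ) (Λ * q ^ 2), 0 < z.re := fun z hz =>
    re_pos_of_norm_sub_ofReal_lt ((mem_closedBall_iff_norm.1 hz).trans_lt hsmallE)
  obtain ⟨z, hz, hzero, herror⟩ := exists_zero_near_newton_step (r := Λ * q ^ 2)
    (A := T * M * q) (A' := T * M * q⁻¹) (B := B * q) (β := b * q⁻¹) (by positivity)
    (by positivity)
    (fun z hz => by
      simp only [← h.outgoingDefect_eq_newton]
      exact (h.differentiableAt_outgoingDefect_csqrt hM0 (hre z hz)).differentiableWithinAt)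
    (fun z hz => (hM z (mem_closedBall_iff_norm.1 hz)).1)
    (fun z hz => (hM z (mem_closedBall_iff_norm.1 hz)).2) (by positivity) (by positivity)
    (by
      calc T * M * q + T * M * q⁻¹ * (Λ * q ^ 2) = T * (1 + Λ) * (M * q ^ 2) * q⁻¹ := by
            field_simp
        _ ≤ b / 2 * q⁻¹ := by gcongr
        _ = b * q⁻¹ / 2 := by ring)
    (hnumerator.trans_eq (by rw [hB]; ring))
    (by
      rw [hΛ]
      field_simp
      linarith) hdenominator
  refine ⟨z, (mem_closedBall_iff_norm.1 hz).trans (by gcongr; exact le_max_left _ _), hre z hz,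
    by rw [h.outgoingDefect_eq_newton E, hzero, sub_self], herror.trans ?_⟩
  calc _ = T * (Λ + Λ ^ 2) / b * (M * q ^ 4) := by field_simp
    _ ≤ _ := by gcongr; exact le_max_right _ _

end IsSolutionFamily

/-! ### The expansion of the resonance -/

/-- `z` lies in the fourth quadrant, and satisfies the bound on its imaginary part and the two
expansions of the theorem at the cutoff `M`, with `C` as the constant in all error terms. -/
structure HasResonanceExpansion (u v : ℂ → ℝ → ℂ) (E k C M : ℝ) (z : ℂ) : Prop where
  re_pos : 0 < z.re
  im_neg : z.im < 0
  abs_im_le : |z.im| ≤ C * Real.exp (-2 * k * M)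
  norm_re_sub_le : ‖(z.re : ℂ) - ((E : ℂ) +
    (deriv (u E) M * deriv (v E) M + (E : ℂ) * u E M * v E M) /
      correctionDenom E (u E) (v E) M)‖ ≤ C * (M * Real.exp (-4 * k * M))
  norm_im_sub_le : ‖(z.im : ℂ) - (-(Real.sqrt E : ℂ)) / correctionDenom E (u E) (v E) M‖
    ≤ C * (M * Real.exp (-4 * k * M))

theorem exp_neg_nat_mul_mul (n : ℕ) (k M : ℝ) :
    Real.exp (-n * k * M) = Real.exp (-(k * M)) ^ n := by
  rw [← Real.exp_nat_mul]
  ring_nf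

theorem norm_ofReal_re_sub_le_and_im {z : ℂ} {x y δ : ℝ}
    (h : ‖z - (x + y * Complex.I)‖ ≤ δ) : ‖(z.re : ℂ) - x‖ ≤ δ ∧ ‖(z.im : ℂ) - y‖ ≤ δ := by
  have hre := (Complex.abs_re_le_norm _).trans h
  have him := (Complex.abs_im_le_norm _).trans h
  rw [← Complex.ofReal_sub, ← Complex.ofReal_sub, Complex.norm_real, Complex.norm_real]
  constructor
  · simpa using hre
  · simpa using him

theorem HasExponentialDichotomy.norm_correctionDenom_le {u v : ℝ → ℂ} {E k C M : ℝ}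
    (hd : HasExponentialDichotomy k C u v) (hE : 0 ≤ E) (hk : 0 < k) (hM : 0 ≤ M) :
    ‖correctionDenom E u v M‖ ≤ C ^ 2 * (1 + E) * (C * C / k) * Real.exp (k * M) ^ 2 := by
  have hC := hd.const_nonneg
  have hint : ‖∫ t in (0 : ℝ)..M, u t ^ 2‖ ≤ C * C / k := by
    simp only [sq]
    exact norm_integral_mul_le_of_decay hk hC hd.norm_left_le hC
      (fun x hx _ => hd.norm_left_le_const hk hx) hM le_rfl
  have hv := hd.norm_right_le M hM
  have hv₁ := hd.norm_deriv_right_le M hM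
  have hsum : ‖deriv v M ^ 2 + E * v M ^ 2‖
      ≤ (C * Real.exp (k * M)) ^ 2 + E * (C * Real.exp (k * M)) ^ 2 := by
    refine (norm_add_le _ _).trans ?_
    rw [norm_mul, norm_pow, norm_pow, Complex.norm_real, Real.norm_of_nonneg hE]
    gcongr
  rw [correctionDenom, norm_mul]
  calc _ ≤ ((C * Real.exp (k * M)) ^ 2 + E * (C * Real.exp (k * M)) ^ 2) * (C * C / k) := by gcongr
    _ = _ := by ring

theorem HasResonanceExpansion.of_norm_sub_le {u v : ℂ → ℝ → ℂ} {E k C M n d : ℝ} {z : ℂ}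
    (hn : deriv (u E) M * deriv (v E) M + (E : ℂ) * u E M * v E M = n)
    (hd : correctionDenom E (u E) (v E) M = d) (hd_pos : 0 < d) (hre : 0 < z.re)
    (hz : ‖z - E‖ ≤ C * Real.exp (-2 * k * M))
    (hexpansion : ‖z - ((E + n / d : ℝ) + (-Real.sqrt E / d : ℝ) * Complex.I)‖
      ≤ C * (M * Real.exp (-4 * k * M)))
    (hsmall : C * (M * Real.exp (-4 * k * M)) * d < Real.sqrt E) :
    HasResonanceExpansion u v E k C M z := by
  obtain ⟨hexp_re, hexp_im⟩ := norm_ofReal_re_sub_le_and_im hexpansion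
  refine ⟨hre, ?_, ?_, ?_, ?_⟩
  · rw [← Complex.ofReal_sub, Complex.norm_real] at hexp_im
    linarith [(abs_le.1 hexp_im).2, neg_div d (Real.sqrt E), (lt_div_iff₀ hd_pos).2 hsmall]
  · simpa only [Complex.sub_im, Complex.ofReal_im, sub_zero] using
      (Complex.abs_im_le_norm (z - E)).trans hz
  · rw [hn, hd]
    exact_mod_cast hexp_re
  · rw [hd]
    exact_mod_cast hexp_im

namespace IsSolutionFamily

variable {V : ℝ → ℝ} {u v : ℂ → ℝ → ℂ} {E k C M : ℝ}

theorem exists_pos_eq_correctionDenom (h : IsSolutionFamily V u v) (hE : 0 < E)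
    (hu : ∀ x, starRingEnd ℂ (u E x) = u E x) (hv : ∀ x, starRingEnd ℂ (v E x) = v E x)
    (hM : 1 ≤ M) : ∃ d : ℝ, 0 < d ∧ correctionDenom E (u E) (v E) M = d := by
  obtain ⟨I₁, hI₁, hI⟩ :=
    exists_le_integral_normSq (h.left E).continuous (h.exists_ne_zero_on_Icc E)
  obtain ⟨b, hb⟩ := Complex.conj_eq_iff_real.1 (hv M)
  obtain ⟨b₁, hb₁⟩ := Complex.conj_eq_iff_real.1 (conj_deriv_eq hv M)
  refine ⟨(b₁ ^ 2 + E * b ^ 2) * ∫ t in (0 : ℝ)..M, Complex.normSq (u E t),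
    mul_pos ?_ (hI₁.trans_le (hI M hM)), ?_⟩
  · by_cases hb₁0 : b₁ = 0
    · have hb0 : b ≠ 0 := fun hb0 => by simpa [hb, hb₁, hb0, hb₁0] using h.wronskian E M
      positivity
    · positivity
  · simp only [correctionDenom, sq (u E _)]
    rw [integral_mul_self_of_conj_eq hu, hb, hb₁]
    push_cast
    ring

/-- Multiply numerator and denominator by `v' + i√E v` and use that the Wronskian is `1`. -/
theorem newton_step_eq (h : IsSolutionFamily V u v) (hE : 0 ≤ E)
    (hne : correctionDenom E (u E) (v E) M ≠ 0) :
    newtonNumerator u v E M E / newtonDenominator u v E M E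
      = (deriv (u E) M * deriv (v E) M + (E : ℂ) * u E M * v E M) /
          correctionDenom E (u E) (v E) M
        + -(Real.sqrt E : ℂ) / correctionDenom E (u E) (v E) M * Complex.I := by
  have hsqrt : (Real.sqrt E : ℂ) ^ 2 = E := by exact_mod_cast Real.sq_sqrt hE
  rw [newtonNumerator_self u v M hE, newtonDenominator_self u v M hE]
  have hfactor : correctionDenom E (u E) (v E) M
      = (∫ t in (0 : ℝ)..M, u E t * u E t) * outgoingDefect (v E) (Real.sqrt E) M
        * (deriv (v E) M + Complex.I * Real.sqrt E * v E M) := by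
    simp only [correctionDenom, sq (u E _), outgoingDefect]
    linear_combination (∫ t in (0 : ℝ)..M, u E t * u E t) * v E M ^ 2
      * (Real.sqrt E ^ 2 * Complex.I_sq - hsqrt)
  have hdenominator := left_ne_zero_of_mul (hfactor ▸ hne)
  rw [div_mul_eq_mul_div, ← add_div, div_eq_div_iff hdenominator hne, hfactor]
  simp only [outgoingDefect]
  linear_combination (-(∫ t in (0 : ℝ)..M, u E t * u E t)
    * (deriv (v E) M - Complex.I * Real.sqrt E * v E M))
      * (Complex.I * Real.sqrt E * h.wronskian E M + u E M * v E M
        * (Real.sqrt E ^ 2 * Complex.I_sq - hsqrt))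

theorem exists_hasResonanceExpansion (h : IsSolutionFamily V u v)
    (hd : HasExponentialDichotomy k C (u E) (v E)) (hE : 0 < E) (hk : 0 < k)
    (hu : ∀ x, starRingEnd ℂ (u E x) = u E x) (hv : ∀ x, starRingEnd ℂ (v E x) = v E x) :
    ∃ K, ∀ᶠ M in atTop, ∃ z : ℂ, HasResonanceExpansion u v E k K M z ∧
      outgoingDefect (u z) (csqrt z) M = 0 := by
  obtain ⟨K, henergy⟩ := h.exists_outgoing_energy hd hE hk hu hv
  set D := C ^ 2 * (1 + E) * (C * C / k)
  refine ⟨K, ?_⟩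
  filter_upwards [henergy, eventually_ge_atTop 1,
    eventually_mul_mul_exp_sq_lt hk (K * D) (Real.sqrt_pos.2 hE)] with M hM hM1 hsmall
  obtain ⟨z, hz, hre, hzero, herror⟩ := hM
  obtain ⟨d, hd_pos, hd_eq⟩ := h.exists_pos_eq_correctionDenom hE hu hv hM1
  obtain ⟨n, hn⟩ : ∃ n : ℝ, deriv (u E) M * deriv (v E) M + (E : ℂ) * u E M * v E M = n :=
    Complex.conj_eq_iff_real.1 (by
      simp only [map_add, map_mul, Complex.conj_ofReal, hu, hv, conj_deriv_eq hu,
        conj_deriv_eq hv])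
  have hd_le : d ≤ D * Real.exp (k * M) ^ 2 := by
    have hnorm := hd.norm_correctionDenom_le hE.le hk (zero_le_one.trans hM1)
    rw [hd_eq, Complex.norm_real] at hnorm
    exact (le_abs_self d).trans hnorm
  rw [h.newton_step_eq hE.le (by rw [hd_eq]; exact_mod_cast hd_pos.ne'), hn, hd_eq, sub_sub,
    ← add_assoc] at herror
  have hexp2 : Real.exp (-2 * k * M) = Real.exp (-(k * M)) ^ 2 := mod_cast exp_neg_nat_mul_mul 2 k M
  have hexp4 : Real.exp (-4 * k * M) = Real.exp (-(k * M)) ^ 4 := mod_cast exp_neg_nat_mul_mul 4 k M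
  have herror_nonneg := (norm_nonneg _).trans herror
  refine ⟨z, .of_norm_sub_le hn hd_eq hd_pos hre (hexp2 ▸ hz) ?_ ?_, hzero⟩ <;> rw [hexp4]
  · push_cast
    exact herror
  · have hcancel : Real.exp (-(k * M)) * Real.exp (k * M) = 1 := by
      rw [← Real.exp_add, neg_add_cancel, Real.exp_zero]
    calc K * (M * Real.exp (-(k * M)) ^ 4) * d
        ≤ K * (M * Real.exp (-(k * M)) ^ 4) * (D * Real.exp (k * M) ^ 2) := by gcongr
      _ = K * D * (M * Real.exp (-(k * M)) ^ 2) * (Real.exp (-(k * M)) * Real.exp (k * M)) ^ 2 := by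
          ring
      _ < Real.sqrt E := by rwa [hcancel, one_pow, mul_one]

end IsSolutionFamily

/-- `u z` and `v z` solve initial value problems at `0` with real data which do not depend on `z`
and have Wronskian `1`, where the data of `u z` are those of a function of parity `ε = ±1`. -/
def IsParityFamily (V : ℝ → ℝ) (ε : ℂ) (u v : ℂ → ℝ → ℂ) : Prop :=
  ε * ε = 1 ∧ ∃ a b c d : ℝ, a * d - b * c = 1 ∧ (a : ℂ) = ε * a ∧ -(b : ℂ) = ε * b ∧
    ∀ z, SolvesIVP V z a b (u z) ∧ SolvesIVP V z c d (v z)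

namespace IsParityFamily

variable {V W : ℝ → ℝ} {ε : ℂ} {u v : ℂ → ℝ → ℂ} {E K M R : ℝ} {z : ℂ}

theorem isSolutionFamily (h : IsParityFamily V ε u v) (hV : Continuous V) :
    IsSolutionFamily V u v := by
  obtain ⟨-, a, b, c, d, hdet, -, -, huv⟩ := h
  refine ⟨fun z => (huv z).1.1.isClassicalSolution hV,
    fun z => (huv z).2.1.isClassicalSolution hV, fun z z' => ?_, fun z z' => ?_, fun z => ?_⟩
  · rw [(huv z).1.2.1, (huv z').1.2.1]
  · rw [(huv z).1.2.2, (huv z').1.2.2]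
  · rw [(huv z).1.2.1, (huv z).1.2.2, (huv z).2.2.1, (huv z).2.2.2]
    exact_mod_cast hdet

theorem apply_neg (h : IsParityFamily V ε u v) (hV : Continuous V) (hVe : Function.Even V) (z : ℂ) :
    (∀ x, u z (-x) = ε * u z x) ∧ ∀ x, deriv (u z) (-x) = -ε * deriv (u z) x := by
  have hfamily := h.isSolutionFamily hV
  obtain ⟨-, a, b, _, _, -, ha, hb, huv⟩ := h
  exact (hfamily.left z).parity hV hVe (by rwa [(huv z).1.2.1]) (by rwa [(huv z).1.2.2])

theorem conj_eq (h : IsParityFamily V ε u v) (hV : Continuous V) (E : ℝ) :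
    (∀ x, starRingEnd ℂ (u E x) = u E x) ∧ ∀ x, starRingEnd ℂ (v E x) = v E x := by
  have hfamily := h.isSolutionFamily hV
  obtain ⟨-, a, b, c, d, -, -, -, huv⟩ := h
  exact ⟨((hfamily.left E).conj_eq hV (by rw [(huv E).1.2.1, Complex.conj_ofReal])
      (by rw [(huv E).1.2.2, Complex.conj_ofReal])).1,
    ((hfamily.right E).conj_eq hV (by rw [(huv E).2.2.1, Complex.conj_ofReal])
      (by rw [(huv E).2.2.2, Complex.conj_ofReal])).1⟩

theorem wronskian_conj_zero (h : IsParityFamily V ε u v) (z : ℂ) :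
    u z 0 * starRingEnd ℂ (deriv (u z) 0) - deriv (u z) 0 * starRingEnd ℂ (u z 0) = 0 := by
  obtain ⟨-, a, b, _, _, -, -, -, huv⟩ := h
  rw [(huv z).1.2.1, (huv z).1.2.2, Complex.conj_ofReal, Complex.conj_ofReal]
  ring

theorem exists_hasExponentialDichotomy (h : IsParityFamily V ε u v) (hV : Continuous V)
    (hK : ∀ x, |V x| ≤ K) (hW : Function.Periodic W 1) (hVW : ∀ x, R < x → V x = W x)
    (hL : MemLp (u E) 2 volume) :
    ∃ k C : ℝ, 0 < k ∧ (∃ μ : ℝ, IsCharacteristicMultiplier W E μ ∧ k = Real.log |μ|) ∧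
      HasExponentialDichotomy k C (u E) (v E) := by
  have hfamily := h.isSolutionFamily hV
  have hu := hfamily.left E
  have hv := hfamily.right E
  obtain ⟨hlim, hlim₁⟩ := hu.tendsto_zero hV hK hL
  have hp : ∀ x, R + 1 ≤ x → V (x + 1) = V x := fun x hx => by
    rw [hVW x (by linarith), hVW (x + 1) (by linarith), hW]
  obtain ⟨m, γ, hm, hm1, hum, hum₁, hvm, hvm₁⟩ :=
    hu.exists_floquet_pair hV hp hv (hfamily.wronskian E) (h.conj_eq hV E).1 hlim hlim₁
  obtain ⟨C, hd⟩ := _root_.exists_hasExponentialDichotomy hu hv hm hm1 hum hum₁ hvm hvm₁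
  have hgrowing := hv.add (hu.const_mul γ)
  obtain ⟨x, hx, hne⟩ := hgrowing.exists_ge_ne_zero (y := u E) (y₁ := deriv (u E))
    (fun x hzero => one_ne_zero (α := ℂ) (by linear_combination -hzero - hfamily.wronskian E x))
    (R + 1)
  refine ⟨Real.log |m⁻¹|, C, ?_, ⟨m⁻¹, ?_, rfl⟩, hd⟩
  · rw [abs_inv]
    exact Real.log_pos ((one_lt_inv₀ (abs_pos.2 hm)).2 hm1)
  · rw [← Complex.ofReal_inv] at hvm hvm₁
    exact isCharacteristicMultiplier_of_isQuasiperiodicFrom hV hW (fun x hx => hVW x (by linarith))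
      (inv_ne_zero hm) hgrowing ⟨x, hx, hne⟩ hvm hvm₁

theorem isResonance (h : IsParityFamily V ε u v) (hV : Continuous V) (hVe : Function.Even V)
    (hM : 0 < M) (hre : 0 < z.re) (him : z.im < 0) (hz : outgoingDefect (u z) (csqrt z) M = 0) :
    IsResonance (truncate V M) z :=
  ⟨csqrt_im_neg hre him, (h.isSolutionFamily hV).isResolventPole hV hM
    (fun z => (h.apply_neg hV hVe z).1) (fun z => (h.apply_neg hV hVe z).2) h.wronskian_conj_zero
    (csqrt_im_neg hre him) (by rwa [csqrt_sq])⟩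

theorem isResonantState_outgoingState (h : IsParityFamily V ε u v) (hV : Continuous V)
    (hVe : Function.Even V) (hM : 0 < M) (hz : outgoingDefect (u z) (csqrt z) M = 0) :
    IsResonantState (truncate V M) z (outgoingState ε (csqrt z) M (u z)) ∧
      ∀ Ψ, IsResonantState (truncate V M) z Ψ →
        ∃ c : ℂ, ∀ x, Ψ x = c * outgoingState ε (csqrt z) M (u z) x := by
  have hfamily := h.isSolutionFamily hV
  have hout : deriv (u z) M = Complex.I * csqrt z * u z M := sub_eq_zero.1 hz
  have hne : u z M ≠ 0 := fun hzero => by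
    simpa [hzero, hout] using hfamily.ne_zero_or_deriv_ne_zero z M
  have hstate := _root_.isResonantState_outgoingState hV hM (hfamily.left z)
    (h.apply_neg hV hVe z).1 (h.apply_neg hV hVe z).2 hout hne
  exact ⟨hstate, fun Ψ hΨ => hΨ.eq_const_mul_outgoingState hV hM hne hstate.2.1⟩

end IsParityFamily

theorem even_and_odd_of_parity {ε : ℂ} {Φ Ψ : ℝ → ℂ} (hne : Φ ≠ 0)
    (hΦ : ∀ x, Φ (-x) = ε * Φ x) (hΨ : ∀ x, Ψ (-x) = ε * Ψ x) :
    (Function.Even Φ → Function.Even Ψ) ∧ (Function.Odd Φ → Function.Odd Ψ) := by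
  obtain ⟨x, hx⟩ := Function.ne_iff.1 hne
  refine ⟨fun heven y => ?_, fun hodd y => ?_⟩
  · have hε : ε = 1 := mul_right_cancel₀ hx (by rw [← hΦ, heven, one_mul])
    rw [hΨ, hε, one_mul]
  · have hε : ε = -1 := mul_right_cancel₀ hx (by rw [← hΦ, hodd, neg_one_mul])
    rw [hΨ, hε, neg_one_mul]

theorem IsBoundState.exists_isParityFamily {V : ℝ → ℝ} {E K : ℝ} {Φ : ℝ → ℂ} {u v : ℂ → ℝ → ℂ}
    (hΦ : IsBoundState V E Φ) (hV : Continuous V) (hVe : Function.Even V) (hK : ∀ x, |V x| ≤ K)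
    (huv_even : Function.Even Φ → ∀ z, SolvesIVP V z 1 0 (u z) ∧ SolvesIVP V z 0 1 (v z))
    (huv_odd : Function.Odd Φ → ∀ z, SolvesIVP V z 0 1 (u z) ∧ SolvesIVP V z (-1) 0 (v z)) :
    (Function.Even Φ ∨ Function.Odd Φ) ∧
      ∃ ε α : ℂ, IsParityFamily V ε u v ∧ ∀ x, Φ x = α * u E x := by
  have hclassical : IsClassicalSolution V E Φ (deriv Φ) := hΦ.2.2.isClassicalSolution hV
  rcases hclassical.even_or_odd hV hVe (hclassical.mul_eq_zero_of_memLp hV hVe hK hΦ.2.1) with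
    ⟨h0, heven⟩ | ⟨h0, hodd⟩
  · have huv := huv_even heven
    refine ⟨.inl heven, 1, Φ 0, ⟨by norm_num, 1, 0, 0, 1, by norm_num, by simp, by simp, fun z => by
      simpa only [Complex.ofReal_zero, Complex.ofReal_one] using huv z⟩, congrFun ?_⟩
    exact (hclassical.unique hV (((huv E).1.1.isClassicalSolution hV).const_mul (Φ 0)) (a := 0)
      (by rw [(huv E).1.2.1, mul_one]) (by rw [h0, (huv E).1.2.2, mul_zero])).1
  · have huv := huv_odd hodd
    refine ⟨.inr hodd, -1, deriv Φ 0, ⟨by norm_num, 0, 1, -1, 0, by norm_num, by simp, by simp,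
      fun z => by
        simpa only [Complex.ofReal_zero, Complex.ofReal_one, Complex.ofReal_neg] using huv z⟩,
      congrFun ?_⟩
    exact (hclassical.unique hV (((huv E).1.1.isClassicalSolution hV).const_mul (deriv Φ 0))
      (a := 0) (by rw [h0, (huv E).1.2.1, mul_zero]) (by rw [(huv E).1.2.2, mul_one])).1

theorem IsBoundState.memLp_of_eq_const_mul {V : ℝ → ℝ} {E : ℝ} {Φ w : ℝ → ℂ} {α : ℂ}
    (hΦ : IsBoundState V E Φ) (hw : ∀ x, Φ x = α * w x) : MemLp w 2 volume := by
  have hα : α ≠ 0 := fun hα => hΦ.1 (funext fun x => by rw [hw, hα, zero_mul, Pi.zero_apply])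
  have hw' : w = fun x => α⁻¹ * Φ x := funext fun x => by rw [hw, inv_mul_cancel_left₀ hα]
  rw [hw']
  exact hΦ.2.1.const_mul _

theorem mainTheorem3_general
    (V Vper Vdef : ℝ → ℝ) (ρ E : ℝ) (Φ : ℝ → ℂ) (u v : ℂ → ℝ → ℂ)
    (hV : Continuous V)
    (hVsum : ∀ x, V x = Vper x + Vdef x)
    (hVper : ∀ x, Vper (x + 1) = Vper x)
    (hVdef : ∀ x, ρ < |x| → Vdef x = 0)
    (hVeven : Function.Even V)
    (hE : 0 < E)
    (hΦ : IsBoundState V E Φ)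
    (huv_even : Function.Even Φ → ∀ z, SolvesIVP V z 1 0 (u z) ∧ SolvesIVP V z 0 1 (v z))
    (huv_odd : Function.Odd Φ → ∀ z, SolvesIVP V z 0 1 (u z) ∧ SolvesIVP V z (-1) 0 (v z)) :
    (Function.Even Φ ∨ Function.Odd Φ) ∧
    ∃ k : ℝ, 0 < k ∧
      (∃ μ : ℝ, IsCharacteristicMultiplier Vper E μ ∧ k = Real.log |μ|) ∧
      ∃ M₀ C : ℝ, ρ < M₀ ∧ ∀ M : ℝ, M₀ ≤ M →
        ∃ zs : ℂ, IsResonance (truncate V M) zs ∧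
          0 < zs.re ∧ zs.im < 0 ∧
          |zs.im| ≤ C * Real.exp (-2 * k * M) ∧
          ‖(zs.re : ℂ) - ((E : ℂ) +
              (deriv (u E) M * deriv (v E) M + (E : ℂ) * u E M * v E M) /
                correctionDenom E (u E) (v E) M)‖
            ≤ C * (M * Real.exp (-4 * k * M)) ∧
          ‖(zs.im : ℂ) - (-(Real.sqrt E : ℂ)) / correctionDenom E (u E) (v E) M‖
            ≤ C * (M * Real.exp (-4 * k * M)) ∧
          ∃ Φs : ℝ → ℂ, IsResonantState (truncate V M) zs Φs ∧
            (∀ Ψ : ℝ → ℂ, IsResonantState (truncate V M) zs Ψ →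
              ∃ c : ℂ, ∀ x, Ψ x = c * Φs x) ∧
            (∀ x, 0 ≤ x → x ≤ M → Φs x = u zs x) ∧
            (∀ x, M < x →
              Φs x = u zs M * Complex.exp (Complex.I * csqrt zs * ((x - M : ℝ) : ℂ))) ∧
            (Function.Even Φ → Function.Even Φs) ∧
            (Function.Odd Φ → Function.Odd Φs) := by
  obtain ⟨K, hK⟩ := exists_abs_le_of_even hV hVeven hVsum hVper hVdef
  obtain ⟨hparity, ε, α, hfamily, hΦu⟩ :=
    hΦ.exists_isParityFamily hV hVeven hK huv_even huv_odd
  have hVW : ∀ x, ρ < x → V x = Vper x := fun x hx => by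
    rw [hVsum, hVdef x (hx.trans_le (le_abs_self x)), add_zero]
  obtain ⟨k, C, hk, hmultiplier, hdichotomy⟩ := hfamily.exists_hasExponentialDichotomy hV hK
    hVper hVW (hΦ.memLp_of_eq_const_mul hΦu)
  obtain ⟨hu, hv⟩ := hfamily.conj_eq hV E
  obtain ⟨C', hC'⟩ :=
    (hfamily.isSolutionFamily hV).exists_hasResonanceExpansion hdichotomy hE hk hu hv
  obtain ⟨M₀, hM₀⟩ := eventually_atTop.1 (hC'.and ((eventually_gt_atTop 0).and
    (eventually_gt_atTop ρ)))
  refine ⟨hparity, k, hk, hmultiplier, M₀, C', (hM₀ M₀ le_rfl).2.2, fun M hM => ?_⟩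
  obtain ⟨⟨z, hz, hout⟩, hM_pos, -⟩ := hM₀ M hM
  obtain ⟨hstate, hunique⟩ := hfamily.isResonantState_outgoingState hV hVeven hM_pos hout
  have hΦ_neg : ∀ x, Φ (-x) = ε * Φ x := fun x => by
    rw [hΦu, hΦu, (hfamily.apply_neg hV hVeven E).1, mul_left_comm]
  exact ⟨z, hfamily.isResonance hV hVeven hM_pos hz.re_pos hz.im_neg hout, hz.re_pos, hz.im_neg,
    hz.abs_im_le, hz.norm_re_sub_le, hz.norm_im_sub_le, _, hstate, hunique,
    fun x hx hxM => outerExtend_of_mem ⟨by linarith, hxM⟩, fun x hx => outerExtend_of_gt hM_pos hx,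
    even_and_odd_of_parity hΦ.1 hΦ_neg
      (outgoingState_neg hM_pos hfamily.1 (hfamily.apply_neg hV hVeven z).1)⟩

theorem mainTheorem3
    (V Vper Vdef : ℝ → ℝ) (ρ E : ℝ) (Φ : ℝ → ℂ) (u v : ℂ → ℝ → ℂ)
    (hVsmooth : ContDiff ℝ ∞ V)
    (hVsum : ∀ x, V x = Vper x + Vdef x)
    (hVper : ∀ x, Vper (x + 1) = Vper x)
    (hρ : 0 ≤ ρ)
    (hVdef : ∀ x, ρ < |x| → Vdef x = 0)
    (hVeven : Function.Even V)
    (hE : 0 < E)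
    (hΦ : IsBoundState V E Φ)
    (huv_even : Function.Even Φ → ∀ z, SolvesIVP V z 1 0 (u z) ∧ SolvesIVP V z 0 1 (v z))
    (huv_odd : Function.Odd Φ → ∀ z, SolvesIVP V z 0 1 (u z) ∧ SolvesIVP V z (-1) 0 (v z)) :
    (Function.Even Φ ∨ Function.Odd Φ) ∧
    ∃ k : ℝ, 0 < k ∧
      (∃ μ : ℝ, IsCharacteristicMultiplier Vper E μ ∧ k = Real.log |μ|) ∧
      ∃ M₀ C : ℝ, ρ < M₀ ∧ ∀ M : ℝ, M₀ ≤ M →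
        ∃ zs : ℂ, IsResonance (truncate V M) zs ∧
          0 < zs.re ∧ zs.im < 0 ∧
          |zs.im| ≤ C * Real.exp (-2 * k * M) ∧
          ‖(zs.re : ℂ) - ((E : ℂ) +
              (deriv (u E) M * deriv (v E) M + (E : ℂ) * u E M * v E M) /
                correctionDenom E (u E) (v E) M)‖
            ≤ C * (M * Real.exp (-4 * k * M)) ∧
          ‖(zs.im : ℂ) - (-(Real.sqrt E : ℂ)) / correctionDenom E (u E) (v E) M‖
            ≤ C * (M * Real.exp (-4 * k * M)) ∧
          ∃ Φs : ℝ → ℂ, IsResonantState (truncate V M) zs Φs ∧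
            (∀ Ψ : ℝ → ℂ, IsResonantState (truncate V M) zs Ψ →
              ∃ c : ℂ, ∀ x, Ψ x = c * Φs x) ∧
            (∀ x, 0 ≤ x → x ≤ M → Φs x = u zs x) ∧
            (∀ x, M < x →
              Φs x = u zs M * Complex.exp (Complex.I * csqrt zs * ((x - M : ℝ) : ℂ))) ∧
            (Function.Even Φ → Function.Even Φs) ∧
            (Function.Odd Φ → Function.Odd Φs) :=
  mainTheorem3_general V Vper Vdef ρ E Φ u v hVsmooth.continuous hVsum hVper hVdef hVeven hE hΦ
    huv_even huv_odd
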